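/- Let $H$ be a real separable Hilbert space, identified with $H^*$, and let $V$ be a real reflexive Banach space embedded continuously, densely and compactly into $H$, so that $V\subseteq H\equiv H^*\subseteq V^*$ and $\langle u,v\rangle_V=\langle u,v\rangle_H$ for $u\in H$, $v\in V$, where $\langle\cdot,\cdot\rangle_V$ is the pairing of $V^*$ and $V$. Let $T>0$ and let $A:[0,T]\times V\to V^*$ be restrictedly measurable, i.e. for every representative $u$ of an element of $L^1([0,T];V)$ the map $t\mapsto A(t,u(t))$ is Lebesgue measurable from $[0,T]$ to $V^*$. Let $\alpha>1$, $\beta\ge 0$, $\delta>0$, $C\in\mathbb R$, and let $f\in L^1([0,T];\mathbb R)$ be nonnegative, such that for all $t\in[0,T]$ and $v,v_1,v_2\in V$: (H1) the map $s\mapsto\langle A(t,v_1+sv_2),v\rangle_V$ is continuous on $\mathbb R$; (H2) $\langle A(t,v_1)-A(t,v_2),v_1-v_2\rangle_V\le\big(f(t)+\rho(v_1)+\eta(v_2)\big)\|v_1-v_2\|_H^2$, where $\rho,\eta:V\to[0,\infty)$ are Borel measurable and bounded on bounded subsets of $V$; (H3) $2\langle A(t,v),v\rangle_V\le-\delta\|v\|_V^\alpha+g(\|v\|_H^2)+f(t)$,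 where $g:[0,\infty)\to[0,\infty)$ is continuous and nondecreasing; (H4) $\|A(t,v)\|_{V^*}\le\big(f(t)^{\frac{\alpha-1}{\alpha}}+C\|v\|_V^{\alpha-1}\big)\big(1+\|v\|_H^\beta\big)$. For $u_0\in H$ and $S\in(0,T]$, a solution on $[0,S]$ of $u'(t)=A(t,u(t))$, $u(0)=u_0$, is a function $$u\in L^\alpha([0,S];V)\cap C([0,S];H)$$ whose generalized derivative (as a $V^*$-valued function) satisfies $u'=A(\cdot,u(\cdot))$ a.e. and $u'\in L^{\frac{\alpha}{\alpha-1}}([0,S];V^*)$, and for which $$\langle u(t),v\rangle_H=\langle u_0,v\rangle_H+\int_0^t\langle A(s,u(s)),v\rangle_V\,ds,\qquad t\in[0,S],\ v\in V.$$ (i) Let $u_0\in H$. There is a $T_0\in(0,T]$ with $$T_0<\int_{\|u_0\|_H^2+\int_0^{T_0}f(s)\,ds}^{\infty}\frac{dx}{g(x)}\qquad(\ast)$$ (the right-hand side taken in $[0,\infty]$, with $1/0=\infty$). For every $T_0\in(0,T]$ satisfying $(\ast)$ there is a solution on $[0,T_0]$. If moreover there are constants $C',\gamma\ge0$ with $$\rho(v)+\eta(v)\le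 C'(1+\|v\|_V^\alpha)(1+\|v\|_H^\gamma),\qquad v\in V,$$ then the solution on $[0,T_0]$ is unique. (ii) If $g(x)=cx$ for some constant $c$, then for every $u_0\in H$ all assertions of (i) hold with $T_0=T$: there is a solution on $[0,T]$, and it is unique under the additional bound on $\rho+\eta$. -/

import Mathlib

open MeasureTheory Set Topology
open scoped ContDiff ENNReal

noncomputable section

namespace GelfandEvolution

variable {V H : Type*} [NormedAddCommGroup V] [NormedSpace ℝ V]
  [NormedAddCommGroup H] [InnerProductSpace ℝ H]

/-- A normed space is reflexive if the canonical map into its bidual is onto. -/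
def IsReflexive (V : Type*) [NormedAddCommGroup V] [NormedSpace ℝ V] : Prop :=
  Function.Surjective (NormedSpace.inclusionInDoubleDual ℝ V)

/-- `ι` realizes `V ⊆ H ≡ H* ⊆ V*` as a Gelfand triple: `V` is reflexive and is embedded
continuously (`ι` is a continuous linear map) and densely into `H`. -/
structure IsGelfandTriple (ι : V →L[ℝ] H) : Prop where
  reflexive : IsReflexive V
  injective : Function.Injective ι
  denseRange : DenseRange ι

/-- The embedding `H ≡ H* ⊆ V*`, under which `⟨h, v⟩_V = ⟨h, v⟩_H`. -/
def toDual (ι : V →L[ℝ] H) (h : H) : StrongDual ℝ V :=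
  (innerSL ℝ h).comp ι

/-- Restricted measurability: for every representative of an element of `L¹([0,T]; V)`, the map
`t ↦ A(t, u(t))` is (Lebesgue) measurable from `[0,T]` into `V*`. -/
def RestrictedlyMeasurable (T : ℝ) (A : ℝ → V → StrongDual ℝ V) : Prop :=
  ∀ u : ℝ → V, IntegrableOn u (Icc 0 T) volume →
    AEStronglyMeasurable (fun t => A t (u t)) (volume.restrict (Icc 0 T))

/-- Hemicontinuity. -/
def Hemicontinuity (T : ℝ) (A : ℝ → V → StrongDual ℝ V) : Prop :=
  ∀ t ∈ Icc (0 : ℝ) T, ∀ v₁ v₂ v : V, Continuous fun s : ℝ => A t (v₁ + s • v₂) v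

/-- Local monotonicity with weights `ρ`, `η`. -/
def LocalMonotonicity (ι : V →L[ℝ] H) (T : ℝ) (A : ℝ → V → StrongDual ℝ V)
    (f : ℝ → ℝ) (ρ η : V → ℝ) : Prop :=
  ∀ t ∈ Icc (0 : ℝ) T, ∀ v₁ v₂ : V,
    (A t v₁ - A t v₂) (v₁ - v₂) ≤ (f t + ρ v₁ + η v₂) * ‖ι (v₁ - v₂)‖ ^ 2

/-- The requirements on the weights in local monotonicity: a nonnegative Borel function on `V` that is bounded
on bounded sets. -/
structure IsWeight [MeasurableSpace V] (ρ : V → ℝ) : Prop where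
  nonneg : ∀ v, 0 ≤ ρ v
  measurable : Measurable ρ
  bounded_on_balls : ∀ R : ℝ, ∃ M : ℝ, ∀ v : V, ‖v‖ ≤ R → ρ v ≤ M

/-- Generalized coercivity with nonlinearity `g`. -/
def GeneralizedCoercivity (ι : V →L[ℝ] H) (T : ℝ) (A : ℝ → V → StrongDual ℝ V)
    (α δ : ℝ) (f g : ℝ → ℝ) : Prop :=
  ∀ t ∈ Icc (0 : ℝ) T, ∀ v : V,
    2 * A t v v ≤ -δ * ‖v‖ ^ α + g (‖ι v‖ ^ 2) + f t

/-- The requirements on `g : [0,∞) → [0,∞)` in generalized coercivity; values at negative numbers are irrelevant. -/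
structure IsCoercivityFunction (g : ℝ → ℝ) : Prop where
  nonneg : ∀ x, 0 ≤ x → 0 ≤ g x
  monotoneOn : MonotoneOn g (Ici 0)
  continuousOn : ContinuousOn g (Ici 0)

/-- The growth condition. -/
def Growth (ι : V →L[ℝ] H) (T : ℝ) (A : ℝ → V → StrongDual ℝ V)
    (α β C : ℝ) (f : ℝ → ℝ) : Prop :=
  ∀ t ∈ Icc (0 : ℝ) T, ∀ v : V,
    ‖A t v‖ ≤ (f t ^ ((α - 1) / α) + C * ‖v‖ ^ (α - 1)) * (1 + ‖ι v‖ ^ β)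

/-- The additional bound on the weights under which solutions are unique. -/
def WeightBound (ι : V →L[ℝ] H) (α : ℝ) (ρ η : V → ℝ) : Prop :=
  ∃ C γ : ℝ, 0 ≤ C ∧ 0 ≤ γ ∧
    ∀ v : V, ρ v + η v ≤ C * (1 + ‖v‖ ^ α) * (1 + ‖ι v‖ ^ γ)

/-- `W` is the generalized derivative of `U` on `(0, S)`, for integrable `U, W : (0,S) → E`. -/
def HasGeneralizedDeriv {E : Type*} [NormedAddCommGroup E] [NormedSpace ℝ E]
    (S : ℝ) (U W : ℝ → E) : Prop :=
  IntegrableOn U (Ioo 0 S) volume ∧ IntegrableOn W (Ioo 0 S) volume ∧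
    ∀ φ : ℝ → ℝ, ContDiff ℝ ∞ φ → HasCompactSupport φ → tsupport φ ⊆ Ioo 0 S →
      ∫ t in Ioo 0 S, deriv φ t • U t = -∫ t in Ioo 0 S, φ t • W t

/-- `u` is a solution on `[0, S]` of `u' = A(t, u)`, `u(0) = u₀`.  The function `u` is the
continuous `H`-valued representative and `ū` a `V`-valued representative of the same class
(it is unique up to null sets since `ι` is injective); `w` is the generalized derivative of
`u`, regarded as a function with values in `V*`. -/
structure IsSolution (ι : V →L[ℝ] H) (A : ℝ → V → StrongDual ℝ V) (α : ℝ) (u₀ : H) (S : ℝ)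
    (u : ℝ → H) : Prop where
  continuousOn : ContinuousOn u (Icc 0 S)
  equation : ∃ (ū : ℝ → V) (w : ℝ → StrongDual ℝ V),
    (∀ᵐ t ∂(volume.restrict (Icc 0 S)), ι (ū t) = u t) ∧
    MemLp ū (ENNReal.ofReal α) (volume.restrict (Icc 0 S)) ∧
    MemLp w (ENNReal.ofReal (α / (α - 1))) (volume.restrict (Icc 0 S)) ∧
    HasGeneralizedDeriv S (fun t => toDual ι (u t)) w ∧
    (∀ᵐ t ∂(volume.restrict (Icc 0 S)), w t = A t (ū t)) ∧
    ∀ t ∈ Icc (0 : ℝ) S, ∀ v : V,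
      inner ℝ (u t) (ι v) = inner ℝ u₀ (ι v) + ∫ s in (0 : ℝ)..t, A s (ū s) v

/-- Solutions on `[0, S]` are unique. -/
def UniqueSolution (ι : V →L[ℝ] H) (A : ℝ → V → StrongDual ℝ V) (α : ℝ) (u₀ : H) (S : ℝ) :
    Prop :=
  ∀ u₁ u₂ : ℝ → H, IsSolution ι A α u₀ S u₁ → IsSolution ι A α u₀ S u₂ →
    EqOn u₁ u₂ (Icc 0 S)

/-- The lifetime condition coming from Bihari's inequality: with `G(x) = ∫_{x₀}^x ds / g(s)` and
`K = ‖u₀‖² + ∫₀^S f`, it says `S < sup G - G(K) = ∫_K^∞ ds / g(s)`.  The integral is taken in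
`[0, ∞]`, with `1 / 0 = ∞`. -/
def BihariTime (f g : ℝ → ℝ) (u₀ : H) (S : ℝ) : Prop :=
  ENNReal.ofReal S <
    ∫⁻ x in Ioi (‖u₀‖ ^ 2 + ∫ t in (0 : ℝ)..S, f t), (ENNReal.ofReal (g x))⁻¹

end GelfandEvolution

end

/-! Solutions are limits of Galerkin curves, but `A` is only hemicontinuous and restrictedly
measurable in the state, so the finite-dimensional problems are not treated as ordinary differential
equations. A small time delay is put into the right-hand side instead: the delayed integral equation
is solved interval by interval with no continuity in the state at all (`exists_delay_solution`). A
truncation, shown afterwards to be inactive, supplies the integrable bound. Coercivity bounds the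
squared `H`-norm by a function `z` with `z' ≤ g(z)`, and Bihari's inequality bounds `z` on the whole
interval under the lifetime condition, uniformly in the subspace and the delay
(`exists_bihari_bound`, `exists_galerkin`).

Weak equicontinuity in time gives a subsequence converging weakly in `H` at every time; Fatou's
lemma and reflexivity put the limit in `L^α(V)`. The nonlinear term is identified pointwise in time
(`exists_weak_solution_of_approx`). With `v n` the approximations and `ū` the limit, put `x n t =
⟨A(t, v n t), v n t - ū t⟩`. Local monotonicity and compactness of the embedding give `limsup x n t
≤ 0` almost everywhere, coercivity gives an integrable majorant, and the energy balance gives a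
nonnegative lower limit of the integrals. Hence `x n` tends to zero in `L¹`, and almost everywhere
along a subsequence. At such times the approximations are bounded in `V`, and Minty's argument shows
that `A(t, v n t)` converges weakly-* to `A(t, ū t)` (`tendsto_apply_of_tendsto_apply_sub`). The
growth bound allows passage to the limit under the time integral.

The energy tool is `eventually_integral_apply_le`: testing the increments of `u` against left step
functions approximating `ū` bounds the integral of `⟨A n, ū⟩` above by half the increment of the
squared norm, up to a small error. For a moving sequence of right-hand sides it supplies the lower
limit above; for a constant sequence it is one half of the energy equality, the other half following
by time reversal (`norm_sq_eq_of_weak_equation`). The equality turns weak continuity into strong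
continuity in `H`, and applied to a difference of two solutions it yields uniqueness through
Gronwall's lemma. -/

namespace GelfandEvolution

open Filter

/-! ### Elementary inequalities and integrability tools -/

section Auxiliary

variable {E : Type*} [NormedAddCommGroup E]

lemma ofReal_ne_zero_of_pos {q : ℝ} (hq : 0 < q) : ENNReal.ofReal q ≠ 0 := by
  simpa using hq

lemma memLp_ofReal_iff {Ω : Type*} [MeasurableSpace Ω] {μ : Measure Ω} {q : ℝ} (hq : 0 < q)
    {u : Ω → E} :
    MemLp u (ENNReal.ofReal q) μ ↔
      AEStronglyMeasurable u μ ∧ Integrable (fun t => ‖u t‖ ^ q) μ := by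
  constructor
  · intro h
    refine ⟨h.1, ?_⟩
    have := h.integrable_norm_rpow (ofReal_ne_zero_of_pos hq) ENNReal.ofReal_ne_top
    rwa [ENNReal.toReal_ofReal hq.le] at this
  · rintro ⟨h1, h2⟩
    rw [← integrable_norm_rpow_iff h1 (ofReal_ne_zero_of_pos hq) ENNReal.ofReal_ne_top,
      ENNReal.toReal_ofReal hq.le]
    exact h2

lemma holderConjugate_of_one_lt {α : ℝ} (hα : 1 < α) : (α / (α - 1)).HolderConjugate α :=
  (Real.HolderConjugate.conjExponent hα).symm

lemma one_lt_conjExponent {α : ℝ} (hα : 1 < α) : 1 < α / (α - 1) :=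
  (holderConjugate_of_one_lt hα).lt

/-- Young's inequality with an arbitrarily small weight on the first factor. -/
lemma exists_young {α : ℝ} (hα : 1 < α) {r : ℝ} (hr : 0 < r) :
    ∃ c, 0 ≤ c ∧ ∀ a b : ℝ, 0 ≤ a → 0 ≤ b →
      a * b ≤ r * a ^ (α / (α - 1)) + c * b ^ α := by
  have hp := one_lt_conjExponent hα
  have hp0 : 0 < α / (α - 1) := by linarith
  set p := α / (α - 1)
  -- Young's inequality is applied to `l * a` and `l⁻¹ * b`, which have the same product; this `l`
  -- satisfies `l ^ p = r`.
  set l := r ^ p⁻¹ with hl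
  have hlpos : 0 < l := Real.rpow_pos_of_pos hr _
  refine ⟨(l⁻¹) ^ α, by positivity, fun a b ha hb => ?_⟩
  have h := Real.young_inequality_of_nonneg (a := l * a) (b := l⁻¹ * b) (by positivity)
    (by positivity) (holderConjugate_of_one_lt hα)
  have e1 : l * a * (l⁻¹ * b) = a * b := by field_simp
  have e2 : (l * a) ^ p = r * a ^ p := by
    rw [Real.mul_rpow hlpos.le ha, hl, ← Real.rpow_mul hr.le, inv_mul_cancel₀ hp0.ne',
      Real.rpow_one]
  have e3 : (l⁻¹ * b) ^ α = l⁻¹ ^ α * b ^ α := Real.mul_rpow (by positivity) hb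
  rw [e1] at h
  change a * b ≤ (l * a) ^ p / p + (l⁻¹ * b) ^ α / α at h
  rw [e2, e3] at h
  have h1 : r * a ^ p / p ≤ r * a ^ p := div_le_self (by positivity) hp.le
  have h2 : l⁻¹ ^ α * b ^ α / α ≤ l⁻¹ ^ α * b ^ α := div_le_self (by positivity) hα.le
  linarith

lemma add_rpow_le {q x y : ℝ} (hq : 0 ≤ q) (hx : 0 ≤ x) (hy : 0 ≤ y) :
    (x + y) ^ q ≤ 2 ^ q * (x ^ q + y ^ q) := by
  have h1 : (x + y) ^ q ≤ (2 * max x y) ^ q :=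
    Real.rpow_le_rpow (by positivity)
      (by have := le_max_left x y; have := le_max_right x y; linarith) hq
  rw [Real.mul_rpow (by norm_num) (by positivity)] at h1
  refine h1.trans (mul_le_mul_of_nonneg_left ?_ (by positivity))
  have := Real.rpow_nonneg hx q
  have := Real.rpow_nonneg hy q
  rcases max_cases x y with ⟨h, -⟩ | ⟨h, -⟩ <;> rw [h] <;> linarith

lemma norm_sub_rpow_le_three {q : ℝ} (hq : 0 ≤ q) (a b c d : E) :
    ‖a - d‖ ^ q ≤ 4 ^ q * (‖a - b‖ ^ q + ‖b - c‖ ^ q + ‖c - d‖ ^ q) := by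
  have h2 : (1 : ℝ) ≤ 2 ^ q := Real.one_le_rpow (by norm_num) hq
  have h4 : (4 : ℝ) ^ q = 2 ^ q * 2 ^ q := by
    rw [← Real.mul_rpow (by norm_num) (by norm_num)]; norm_num
  have h1 : ‖a - d‖ ≤ (‖a - b‖ + ‖b - c‖) + ‖c - d‖ := by
    have := norm_sub_le_norm_sub_add_norm_sub a b d
    have := norm_sub_le_norm_sub_add_norm_sub b c d
    linarith
  have h3 := (Real.rpow_le_rpow (norm_nonneg _) h1 hq).trans
    (add_rpow_le hq (by positivity) (by positivity))
  have h5 := add_rpow_le hq (norm_nonneg (a - b)) (norm_nonneg (b - c))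
  have h6 : 0 ≤ ‖c - d‖ ^ q := by positivity
  calc ‖a - d‖ ^ q ≤ _ := h3
    _ ≤ 2 ^ q * (2 ^ q * (‖a - b‖ ^ q + ‖b - c‖ ^ q) + 2 ^ q * ‖c - d‖ ^ q) := by
        gcongr
        nlinarith
    _ = _ := by rw [h4]; ring

lemma IntegrableOn.intervalIntegrable_of_subset {S a b : ℝ} {F : ℝ → E}
    (hF : IntegrableOn F (Icc 0 S)) (ha : a ∈ Icc 0 S) (hb : b ∈ Icc 0 S) :
    IntervalIntegrable F volume a b := by
  rw [intervalIntegrable_iff]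
  refine hF.mono_set (uIoc_subset_uIcc.trans ?_)
  exact uIcc_subset_Icc ha hb

end Auxiliary

/-! ### Step-function approximation at well-chosen nodes -/

section Partition

variable {E : Type*} [NormedAddCommGroup E]

lemma integral_norm_rpow_le_of_eLpNorm_le {Ω : Type*} [MeasurableSpace Ω] {μ : Measure Ω} {q : ℝ}
    (hq : 0 < q) {u : Ω → E} (hu : MemLp u (ENNReal.ofReal q) μ) {r : ℝ} (hr : 0 ≤ r)
    (h : eLpNorm u (ENNReal.ofReal q) μ ≤ ENNReal.ofReal (r ^ q⁻¹)) :
    ∫ t, ‖u t‖ ^ q ∂μ ≤ r := by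
  rw [hu.eLpNorm_eq_integral_rpow_norm (ofReal_ne_zero_of_pos hq) ENNReal.ofReal_ne_top,
    ENNReal.toReal_ofReal hq.le, ENNReal.ofReal_le_ofReal_iff (by positivity)] at h
  have h0 : 0 ≤ ∫ t, ‖u t‖ ^ q ∂μ := integral_nonneg fun t => by positivity
  exact (Real.rpow_le_rpow_iff h0 hr (inv_pos.2 hq)).1 h

/-- Among the shifts of a uniform grid there is one that sees a small part of `F`. -/
lemma exists_shift {S : ℝ} (hS : 0 < S) {F : ℝ → ℝ} (hF : IntegrableOn F (Icc 0 S))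
    {Q : ℝ → Prop} (hQ : ∀ᵐ t ∂(volume.restrict (Icc 0 S)), Q t) {N : ℕ} (hN : 0 < N) :
    ∃ θ ∈ Ioc 0 (S / N), (∀ j < N, Q (θ + j * (S / N))) ∧
      (S / N) * ∑ j ∈ Finset.range N, F (θ + j * (S / N)) ≤ ∫ t in (0 : ℝ)..S, F t := by
  have hN' : (0 : ℝ) < N := by exact_mod_cast hN
  set h := S / N with hh
  have hpos : 0 < h := by positivity
  have hNh : N * h = S := by rw [hh]; field_simp
  have hmem : ∀ j ≤ N, (j : ℝ) * h ∈ Icc 0 S := fun j hj => by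
    refine ⟨by positivity, ?_⟩
    rw [← hNh]
    have : (j : ℝ) ≤ N := by exact_mod_cast hj
    gcongr
  have hint : ∀ j < N, IntervalIntegrable F volume (j * h) ((j + 1 : ℕ) * h) := fun j hj =>
    IntegrableOn.intervalIntegrable_of_subset hF (hmem j hj.le) (hmem (j + 1) hj)
  have hsum := intervalIntegral.sum_integral_adjacent_intervals (f := F) (μ := volume)
    (a := fun j : ℕ => (j : ℝ) * h) (n := N) hint
  have hshift : ∀ j < N, IntervalIntegrable (fun θ => F (θ + j * h)) volume 0 h := fun j hj => by
    have := (hint j hj).comp_add_right (j * h)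
    convert this using 1
    · simp
    · push_cast; ring
  have hGint : IntervalIntegrable (fun θ => ∑ j ∈ Finset.range N, F (θ + j * h)) volume 0 h := by
    have := IntervalIntegrable.sum (μ := volume) (a := 0) (b := h) (Finset.range N)
      (f := fun j θ => F (θ + j * h)) (fun j hj => hshift j (Finset.mem_range.1 hj))
    rwa [Finset.sum_fn] at this
  have hG : ∫ θ in (0 : ℝ)..h, ∑ j ∈ Finset.range N, F (θ + j * h) = ∫ t in (0 : ℝ)..S, F t := by
    rw [intervalIntegral.integral_finsetSum (fun j hj => hshift j (Finset.mem_range.1 hj))]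
    simp only [Nat.cast_zero, zero_mul, hNh] at hsum
    rw [← hsum]
    refine Finset.sum_congr rfl fun j _ => ?_
    rw [intervalIntegral.integral_comp_add_right]
    congr 1
    · simp
    · push_cast; ring
  -- Shifts for which some node falls into the exceptional set of `Q`: a null set, being covered by
  -- countably many translates of one.
  set bad : Set ℝ := {θ | θ ∈ Ioc 0 h ∧ ∃ j < N, ¬ Q (θ + j * h)} with hbad
  have hnull : volume bad = 0 := by
    have h1 : volume {t | t ∈ Icc 0 S ∧ ¬ Q t} = 0 := by
      rw [ae_restrict_iff' measurableSet_Icc, ae_iff] at hQ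
      convert hQ using 2
      ext t; simp [and_assoc]
    have h2 : bad ⊆ ⋃ j : ℕ, (fun θ => θ + j * h) ⁻¹' {t | t ∈ Icc 0 S ∧ ¬ Q t} := by
      rintro θ ⟨hθ, j, hj, hn⟩
      refine mem_iUnion.2 ⟨j, ⟨⟨by have := hθ.1; positivity, ?_⟩, hn⟩⟩
      have h3 := (hmem (j + 1) hj).2
      push_cast at h3
      have := hθ.2
      linarith
    refine measure_mono_null h2 (measure_iUnion_null fun j => ?_)
    rw [measure_preimage_add_right]
    exact h1
  have hIoc : IntegrableOn (fun θ => ∑ j ∈ Finset.range N, F (θ + j * h)) (Ioc 0 h) :=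
    (intervalIntegrable_iff_integrableOn_Ioc_of_le hpos.le).1 hGint
  have hN0 : (volume.restrict (Ioc 0 h)) (bad ∪ (Ioc 0 h)ᶜ) = 0 := by
    refine measure_union_null (Measure.restrict_le_self.absolutelyContinuous hnull) ?_
    rw [Measure.restrict_apply measurableSet_Ioc.compl]
    simp
  -- Outside any null set some value is at most the average. The complement of the interval is put
  -- into the null set so that the chosen `θ` lies in the interval.
  obtain ⟨θ, hθ, hle⟩ := exists_notMem_null_le_average
    (μ := volume.restrict (Ioc 0 h)) (by simp [hpos]) hIoc hN0
  have hθ' : θ ∈ Ioc 0 h := by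
    by_contra hc; exact hθ (Or.inr hc)
  refine ⟨θ, hθ', fun j hj => ?_, ?_⟩
  · by_contra hc
    exact hθ (Or.inl ⟨hθ', j, hj, hc⟩)
  · rw [← hG, intervalIntegral.integral_of_le hpos.le]
    rw [setAverage_eq] at hle
    simp only [measureReal_def, Real.volume_Ioc, sub_zero, ENNReal.toReal_ofReal hpos.le,
      smul_eq_mul] at hle
    calc _ ≤ h * (h⁻¹ * ∫ θ in Ioc 0 h, ∑ j ∈ Finset.range N, F (θ + j * h)) := by gcongr
      _ = _ := by field_simp

variable [NormedSpace ℝ E]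

/-- Approximation of an `L^α` function by its left Riemann step functions, with a prescribed value
on the first interval. -/
lemma exists_partition {α S : ℝ} (hα : 1 < α) (hS : 0 < S) {u : ℝ → E}
    (hu : MemLp u (ENNReal.ofReal α) (volume.restrict (Icc 0 S)))
    {Q : ℝ → Prop} (hQ : ∀ᵐ t ∂(volume.restrict (Icc 0 S)), Q t) (v₀ : E) {ε : ℝ} (hε : 0 < ε) :
    ∃ (N : ℕ) (τ : ℕ → ℝ) (v : ℕ → E), (∀ k ≤ N + 1, τ k ∈ Icc 0 S) ∧
      (∀ k, τ k ≤ τ (k + 1)) ∧ τ 0 = 0 ∧ τ (N + 1) = S ∧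
      v 0 = v₀ ∧ (∀ k, 1 ≤ k → k ≤ N → Q (τ k) ∧ v k = u (τ k)) ∧
      ∑ k ∈ Finset.range (N + 1), ∫ s in τ k..τ (k + 1), ‖u s - v k‖ ^ α ≤ ε := by
  have hα0 : 0 < α := by linarith
  set B : ℝ := 4 ^ α with hB
  have hBpos : 0 < B := by positivity
  -- Half of `ε` pays for the first interval. On the others three errors of size `e` occur, each
  -- with the factor `B`: `u` against `ψ`, the oscillation of `ψ`, and `ψ` against `u` at the nodes.
  set e : ℝ := ε / (2 * (B * 3)) with he
  have hepos : 0 < e := by positivity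
  obtain ⟨ψ, hψ, hψm⟩ := hu.exists_boundedContinuous_eLpNorm_sub_le ENNReal.ofReal_ne_top
    (ε := ENNReal.ofReal (e ^ α⁻¹)) (by simpa using Real.rpow_pos_of_pos hepos _)
  have hψint := integral_norm_rpow_le_of_eLpNorm_le hα0 (hu.sub hψm) hepos.le hψ
  have hFint : IntegrableOn (fun t => ‖u t - ψ t‖ ^ α) (Icc 0 S) :=
    ((memLp_ofReal_iff hα0).1 (hu.sub hψm)).2
  have hsub : ∀ c : E, IntegrableOn (fun t => ‖u t - c‖ ^ α) (Icc 0 S) := fun c =>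
    ((memLp_ofReal_iff hα0).1 (hu.sub (memLp_const c))).2
  have huc : UniformContinuousOn ψ (Icc 0 S) :=
    isCompact_Icc.uniformContinuousOn_of_continuous ψ.continuous.continuousOn
  obtain ⟨d, hd, hdψ⟩ := Metric.uniformContinuousOn_iff.1 huc ((e / S) ^ α⁻¹) (by positivity)
  have hfirst : Tendsto (fun x => ∫ s in (0 : ℝ)..x, ‖u s - v₀‖ ^ α) (𝓝[Icc 0 S] 0) (𝓝 0) := by
    have := intervalIntegral.continuousOn_primitive_interval (hsub v₀ |>.mono_set
      (by rw [uIcc_of_le hS.le])) 0 (by simp [hS.le])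
    rw [uIcc_of_le hS.le] at this
    simpa [ContinuousWithinAt] using this
  have hN : ∃ N : ℕ, 0 < N ∧ S / N < d ∧ ∫ s in (0 : ℝ)..S / N, ‖u s - v₀‖ ^ α < ε / 2 := by
    have t1 : Tendsto (fun N : ℕ => S / N) atTop (𝓝 0) := tendsto_const_div_atTop_nhds_zero_nat S
    have t2 : Tendsto (fun N : ℕ => S / N) atTop (𝓝[Icc 0 S] 0) := by
      refine tendsto_nhdsWithin_iff.2 ⟨t1, ?_⟩
      filter_upwards [eventually_ge_atTop 1] with N hN
      have : (1 : ℝ) ≤ N := by exact_mod_cast hN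
      exact ⟨by positivity, div_le_self hS.le this⟩
    have t3 := (hfirst.comp t2).eventually (gt_mem_nhds (half_pos hε))
    obtain ⟨N, h1, h2, h3⟩ :=
      ((eventually_gt_atTop 0).and ((t1.eventually (gt_mem_nhds hd)).and t3)).exists
    exact ⟨N, h1, h2, h3⟩
  obtain ⟨N, hN0, hNd, hN1⟩ := hN
  obtain ⟨θ, hθ, hθQ, hθF⟩ := exists_shift hS hFint hQ hN0
  have hN' : (0 : ℝ) < N := by exact_mod_cast hN0
  set h := S / N with hh
  have hpos : 0 < h := by positivity
  have hNh : N * h = S := by rw [hh]; field_simp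
  -- The nodes are `0, θ, θ + h, …`. Since `0 < θ ≤ h`, the minimum is inactive for indices `1` to
  -- `N` and equals `S` at `N + 1`.
  set τ : ℕ → ℝ := fun k => if k = 0 then 0 else min S (θ + ((k : ℝ) - 1) * h) with hτ
  have hτ0 : τ 0 = 0 := by simp [hτ]
  have hτs : ∀ k : ℕ, τ (k + 1) = min S (θ + k * h) := fun k => by simp [hτ]
  have hτle : ∀ k < N, τ (k + 1) = θ + k * h := fun k hk => by
    rw [hτs, min_eq_right]
    have h1 : ((k : ℝ) + 1) * h ≤ N * h := by
      have : (k : ℝ) + 1 ≤ N := by exact_mod_cast hk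
      gcongr
    have := hθ.2
    linarith
  have hτmono : ∀ k, τ k ≤ τ (k + 1) := by
    intro k
    rcases k with _ | k
    · rw [hτ0, hτs]
      simp only [Nat.cast_zero, zero_mul, add_zero]
      exact le_min hS.le hθ.1.le
    · rw [hτs, hτs]
      refine min_le_min le_rfl ?_
      push_cast; nlinarith
  have hτmem : ∀ k, τ k ∈ Icc 0 S := by
    intro k
    rcases k with _ | k
    · simp [hτ0, hS.le]
    · rw [hτs]
      exact ⟨le_min hS.le (by have := hθ.1; positivity), min_le_left _ _⟩
  have hτN : τ (N + 1) = S := by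
    rw [hτs, hNh, min_eq_left]
    have := hθ.1
    linarith
  have hstep : ∀ k, τ (k + 1 + 1) ≤ τ (k + 1) + h := fun k => by
    rw [hτs, hτs, ← min_add_add_right]
    refine min_le_min (by linarith) ?_
    push_cast; linarith
  refine ⟨N, τ, fun k => if k = 0 then v₀ else u (τ k), fun k _ => hτmem k, hτmono, hτ0, hτN,
    by simp, ?_, ?_⟩
  · intro k hk1 hkN
    obtain ⟨j, rfl⟩ : ∃ j, k = j + 1 := ⟨k - 1, by omega⟩
    refine ⟨?_, by simp⟩
    rw [hτle j (by omega)]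
    exact hθQ j (by omega)
  · rw [Finset.sum_range_succ']
    simp only [Nat.add_eq_zero_iff, one_ne_zero, and_false, if_false, if_true]
    have hlast : ∫ s in τ 0..τ (0 + 1), ‖u s - v₀‖ ^ α ≤ ε / 2 := by
      have h1 : τ (0 + 1) = θ := by simpa using hτle 0 hN0
      rw [hτ0, h1]
      refine le_trans ?_ hN1.le
      refine intervalIntegral.integral_mono_interval le_rfl hθ.1.le hθ.2 ?_ ?_
      · exact Eventually.of_forall fun s => by positivity
      · refine IntegrableOn.intervalIntegrable_of_subset (hsub v₀) (by simp [hS.le])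
          ⟨hpos.le, ?_⟩
        have : (1 : ℝ) ≤ N := by exact_mod_cast hN0
        exact div_le_self hS.le this
    have hmain : ∀ k ∈ Finset.range N, ∫ s in τ (k + 1)..τ (k + 1 + 1), ‖u s - u (τ (k + 1))‖ ^ α ≤
        B * ((∫ s in τ (k + 1)..τ (k + 1 + 1), ‖u s - ψ s‖ ^ α) + h * (e / S)
          + h * ‖u (θ + k * h) - ψ (θ + k * h)‖ ^ α) := by
      intro k hk
      have hk' := Finset.mem_range.1 hk
      set a := τ (k + 1) with ha
      set b := τ (k + 1 + 1) with hb
      have hab : a ≤ b := hτmono _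
      have hba : b - a ≤ h := by have := hstep k; linarith
      have hi := IntegrableOn.intervalIntegrable_of_subset hFint (hτmem (k + 1)) (hτmem (k + 1 + 1))
      have hi2 := IntegrableOn.intervalIntegrable_of_subset (hsub (u a)) (hτmem (k + 1))
        (hτmem (k + 1 + 1))
      have hpt : ∀ s ∈ Icc a b, ‖u s - u a‖ ^ α ≤
          B * (‖u s - ψ s‖ ^ α + (e / S + ‖u a - ψ a‖ ^ α)) := by
        intro s hs
        have h1 := norm_sub_rpow_le_three hα0.le (u s) (ψ s) (ψ a) (u a)
        have h2 : ‖ψ s - ψ a‖ ^ α ≤ e / S := by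
          have h3 := hdψ s ⟨(hτmem (k + 1)).1.trans hs.1, hs.2.trans (hτmem (k + 1 + 1)).2⟩ a
            (hτmem (k + 1)) (by
              rw [Real.dist_eq, abs_of_nonneg (by linarith [hs.1])]
              linarith [hs.2])
          rw [dist_eq_norm] at h3
          calc ‖ψ s - ψ a‖ ^ α ≤ ((e / S) ^ α⁻¹) ^ α := by gcongr
            _ = e / S := by
              rw [← Real.rpow_mul (by positivity), inv_mul_cancel₀ hα0.ne', Real.rpow_one]
        rw [norm_sub_rev (ψ a) (u a)] at h1
        refine h1.trans (mul_le_mul_of_nonneg_left ?_ hBpos.le)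
        linarith
      calc ∫ s in a..b, ‖u s - u a‖ ^ α
          ≤ ∫ s in a..b, B * (‖u s - ψ s‖ ^ α + (e / S + ‖u a - ψ a‖ ^ α)) :=
            intervalIntegral.integral_mono_on hab hi2
              ((hi.add intervalIntegrable_const).const_mul B) hpt
        _ = B * ((∫ s in a..b, ‖u s - ψ s‖ ^ α) + (b - a) * (e / S + ‖u a - ψ a‖ ^ α)) := by
            rw [intervalIntegral.integral_const_mul, intervalIntegral.integral_add hi
              intervalIntegrable_const, intervalIntegral.integral_const, smul_eq_mul]
        _ ≤ B * ((∫ s in a..b, ‖u s - ψ s‖ ^ α) + h * (e / S + ‖u a - ψ a‖ ^ α)) := by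
            gcongr
        _ = _ := by rw [ha, hτle k hk']; ring
    have hsumF : ∑ k ∈ Finset.range N, (∫ s in τ (k + 1)..τ (k + 1 + 1), ‖u s - ψ s‖ ^ α) ≤ e := by
      have h1 := intervalIntegral.sum_integral_adjacent_intervals (μ := volume)
        (f := fun s => ‖u s - ψ s‖ ^ α) (a := fun k => τ (k + 1)) (n := N)
        (fun k _ => IntegrableOn.intervalIntegrable_of_subset hFint (hτmem _) (hτmem _))
      rw [h1, hτN]
      refine le_trans ?_ hψint
      rw [intervalIntegral.integral_of_le (hτmem _).2, ]
      refine setIntegral_mono_set hFint (Eventually.of_forall fun s => by positivity) ?_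
      exact (Ioc_subset_Icc_self.trans (Icc_subset_Icc_left (hτmem _).1)).eventuallyLE
    have hint_eq : ∫ t in (0 : ℝ)..S, ‖u t - ψ t‖ ^ α ≤ e := by
      rw [intervalIntegral.integral_of_le hS.le, ← integral_Icc_eq_integral_Ioc]
      exact hψint
    have hfin := Finset.sum_le_sum hmain
    rw [← Finset.mul_sum, Finset.sum_add_distrib, Finset.sum_add_distrib, Finset.sum_const,
      Finset.card_range, nsmul_eq_mul, ← Finset.mul_sum] at hfin
    have h5 : (N : ℝ) * (h * (e / S)) = e := by
      rw [← mul_assoc, hNh]; field_simp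
    have h6 : B * (e + e + e) = ε / 2 := by rw [he]; field_simp; ring
    have h7 : B * ((∑ k ∈ Finset.range N, ∫ s in τ (k + 1)..τ (k + 1 + 1), ‖u s - ψ s‖ ^ α)
        + N * (h * (e / S)) + h * ∑ k ∈ Finset.range N, ‖u (θ + k * h) - ψ (θ + k * h)‖ ^ α)
        ≤ B * (e + e + e) := by
      rw [h5]
      gcongr
      exact hθF.trans hint_eq
    linarith

end Partition

end GelfandEvolution

namespace GelfandEvolution

open Filter

/-! ### Energy inequality and energy equality -/

section Energy

variable {V H : Type*} [NormedAddCommGroup V] [NormedSpace ℝ V]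
  [NormedAddCommGroup H] [InnerProductSpace ℝ H]

lemma aestronglyMeasurable_apply {Ω : Type*} [MeasurableSpace Ω] {μ : Measure Ω}
    {w : Ω → StrongDual ℝ V} {u : Ω → V} (hw : AEStronglyMeasurable w μ)
    (hu : AEStronglyMeasurable u μ) : AEStronglyMeasurable (fun t => w t (u t)) μ :=
  (ContinuousLinearMap.apply ℝ ℝ (E := V)).aestronglyMeasurable_comp₂ hu hw

lemma integrable_apply {α : ℝ} (hα : 1 < α) {Ω : Type*} [MeasurableSpace Ω] {μ : Measure Ω}
    {w : Ω → StrongDual ℝ V} {u : Ω → V}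
    (hw : MemLp w (ENNReal.ofReal (α / (α - 1))) μ) (hu : MemLp u (ENNReal.ofReal α) μ) :
    Integrable (fun t => w t (u t)) μ := by
  have hα0 : 0 < α := by linarith
  have hp0 : 0 < α / (α - 1) := by linarith [one_lt_conjExponent hα]
  obtain ⟨c, hc, hy⟩ := exists_young hα one_pos
  have h1 := ((memLp_ofReal_iff hp0).1 hw).2
  have h2 := ((memLp_ofReal_iff hα0).1 hu).2
  refine ((h1.const_mul 1).add (h2.const_mul c)).mono' (aestronglyMeasurable_apply hw.1 hu.1) ?_
  refine Eventually.of_forall fun t => ?_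
  exact ((w t).le_opNorm _).trans (hy _ _ (norm_nonneg _) (norm_nonneg _))

lemma integrable_apply_const {α : ℝ} (hα : 1 < α) {Ω : Type*} [MeasurableSpace Ω] {μ : Measure Ω}
    [IsFiniteMeasure μ] {w : Ω → StrongDual ℝ V}
    (hw : MemLp w (ENNReal.ofReal (α / (α - 1))) μ) (v : V) :
    Integrable (fun t => w t v) μ :=
  integrable_apply hα hw (memLp_const v)

/-- Twice each summand is the increment of the squared norm minus the square of the step. Dropping
those squares loses equality but requires no control of the steps. -/
lemma sum_inner_sub_le (a : ℕ → H) (M : ℕ) :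
    ∑ k ∈ Finset.range M, inner ℝ (a (k + 1) - a k) (a k) ≤ (‖a M‖ ^ 2 - ‖a 0‖ ^ 2) / 2 := by
  induction M with
  | zero => simp
  | succ M ih =>
    rw [Finset.sum_range_succ]
    have h := norm_sub_sq_real (a (M + 1)) (a M)
    have h2 : inner ℝ (a (M + 1) - a M) (a M) = inner ℝ (a (M + 1)) (a M) - ‖a M‖ ^ 2 := by
      rw [inner_sub_left, real_inner_self_eq_norm_sq]
    have := sq_nonneg ‖a (M + 1) - a M‖
    linarith

/-- Asymptotic upper energy bound for a bounded sequence of right-hand sides whose primitives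
converge weakly. -/
lemma eventually_integral_apply_le {ι : V →L[ℝ] H} (hι : DenseRange ι) {α S : ℝ} (hα : 1 < α)
    (hS : 0 < S) {A : ℕ → ℝ → StrongDual ℝ V}
    (hA : ∀ n, MemLp (A n) (ENNReal.ofReal (α / (α - 1))) (volume.restrict (Icc 0 S)))
    {c : ℝ} (hc : ∀ n, ∫ t in (0 : ℝ)..S, ‖A n t‖ ^ (α / (α - 1)) ≤ c)
    {u : ℝ → H} {R : ℝ} (hR : ∀ t ∈ Icc 0 S, ‖u t‖ ≤ R)
    (hlim : ∀ s ∈ Icc 0 S, ∀ t ∈ Icc 0 S, ∀ v : V,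
      Tendsto (fun n => ∫ r in s..t, A n r v) atTop (𝓝 (inner ℝ (u t - u s) (ι v))))
    {ū : ℝ → V} (hū : MemLp ū (ENNReal.ofReal α) (volume.restrict (Icc 0 S)))
    (hιu : ∀ᵐ t ∂(volume.restrict (Icc 0 S)), ι (ū t) = u t) {ε : ℝ} (hε : 0 < ε) :
    ∀ᶠ n in atTop, ∫ t in (0 : ℝ)..S, A n t (ū t) ≤ (‖u S‖ ^ 2 - ‖u 0‖ ^ 2) / 2 + ε := by
  have hα0 : 0 < α := by linarith
  have hp0 : 0 < α / (α - 1) := by linarith [one_lt_conjExponent hα]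
  have hR0 : 0 ≤ R := (norm_nonneg _).trans (hR 0 (by simp [hS.le]))
  have hApow : ∀ n, IntegrableOn (fun t => ‖A n t‖ ^ (α / (α - 1))) (Icc 0 S) := fun n =>
    ((memLp_ofReal_iff hp0).1 (hA n)).2
  have hc0 : 0 ≤ c := (intervalIntegral.integral_nonneg hS.le
    (fun t _ => by positivity)).trans (hc 0)
  obtain ⟨cy, hcy, hy⟩ := exists_young hα (r := ε / (4 * (c + 1))) (by positivity)
  -- The initial value need not lie in the image of `V`, so the first step value is only an
  -- approximation in `H`; the later nodes satisfy `ι (ū t) = u t` exactly.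
  obtain ⟨v₀, hv₀⟩ : ∃ v₀, ‖ι v₀ - u 0‖ ≤ ε / (8 * (R + 1)) := by
    obtain ⟨v₀, h⟩ := hι.exists_dist_lt (u 0) (ε := ε / (8 * (R + 1))) (by positivity)
    refine ⟨v₀, ?_⟩
    rw [dist_comm, dist_eq_norm] at h
    exact h.le
  obtain ⟨N, τ, v, hτmem, hτmono, hτ0, hτN, hv0, hvk, hsum⟩ :=
    exists_partition hα hS hū hιu v₀ (ε := ε / (4 * (cy + 1))) (by positivity)
  have hmem : ∀ k ∈ Finset.range (N + 1), τ k ∈ Icc 0 S ∧ τ (k + 1) ∈ Icc 0 S := fun k hk => by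
    have := Finset.mem_range.1 hk
    exact ⟨hτmem k (by omega), hτmem (k + 1) (by omega)⟩
  set L := ∑ k ∈ Finset.range (N + 1), inner ℝ (u (τ (k + 1)) - u (τ k)) (ι (v k)) with hL
  have hLle : L ≤ (‖u S‖ ^ 2 - ‖u 0‖ ^ 2) / 2 + ε / 4 := by
    have h1 := sum_inner_sub_le (fun k => u (τ k)) (N + 1)
    simp only [hτ0, hτN] at h1
    have h2 : L = ∑ k ∈ Finset.range (N + 1), inner ℝ (u (τ (k + 1)) - u (τ k)) (u (τ k))
        + inner ℝ (u (τ 1) - u (τ 0)) (ι v₀ - u (τ 0)) := by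
      rw [hL, Finset.sum_range_succ', Finset.sum_range_succ', hv0, inner_sub_right]
      have : ∀ k ∈ Finset.range N, inner ℝ (u (τ (k + 1 + 1)) - u (τ (k + 1))) (ι (v (k + 1)))
          = inner ℝ (u (τ (k + 1 + 1)) - u (τ (k + 1))) (u (τ (k + 1))) := fun k hk => by
        have := Finset.mem_range.1 hk
        obtain ⟨h3, h4⟩ := hvk (k + 1) (by omega) (by omega)
        rw [h4, h3]
      rw [Finset.sum_congr rfl this]
      ring
    have h3 : inner ℝ (u (τ 1) - u (τ 0)) (ι v₀ - u (τ 0)) ≤ ε / 4 := by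
      refine (real_inner_le_norm _ _).trans ?_
      rw [hτ0]
      have h4 : ‖u (τ 1) - u 0‖ ≤ 2 * (R + 1) := by
        have h5 := norm_sub_le (u (τ 1)) (u 0)
        have h6 := hR _ (hτmem 1 (by omega))
        have h7 := hR 0 (by simp [hS.le])
        linarith
      calc _ ≤ (2 * (R + 1)) * (ε / (8 * (R + 1))) := by gcongr
        _ = ε / 4 := by field_simp; ring
    rw [hτ0] at h2 h3
    linarith
  have hconv : Tendsto (fun n => ∑ k ∈ Finset.range (N + 1),
      ∫ r in τ k..τ (k + 1), A n r (v k)) atTop (𝓝 L) :=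
    tendsto_finsetSum _ fun k hk => hlim _ (hmem k hk).1 _ (hmem k hk).2 _
  filter_upwards [hconv.eventually (gt_mem_nhds (show L < L + ε / 4 by linarith))] with n hn
  have hAu : IntegrableOn (fun t => A n t (ū t)) (Icc 0 S) := integrable_apply hα (hA n) hū
  have hAv : ∀ v, IntegrableOn (fun t => A n t v) (Icc 0 S) := integrable_apply_const hα (hA n)
  have hupow : ∀ v, IntegrableOn (fun t => ‖ū t - v‖ ^ α) (Icc 0 S) := fun v =>
    ((memLp_ofReal_iff hα0).1 (hū.sub (memLp_const v))).2
  -- Freezing `ū` at the node costs a pairing that Young's inequality splits into a part controlled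
  -- by the uniform bound `c` and a part controlled by the step approximation. The partition does
  -- not depend on `n`.
  have hpiece : ∀ k ∈ Finset.range (N + 1), ∫ t in τ k..τ (k + 1), A n t (ū t) ≤
      (∫ t in τ k..τ (k + 1), A n t (v k))
      + (ε / (4 * (c + 1)) * (∫ t in τ k..τ (k + 1), ‖A n t‖ ^ (α / (α - 1)))
      + cy * ∫ t in τ k..τ (k + 1), ‖ū t - v k‖ ^ α) := by
    intro k hk
    obtain ⟨m1, m2⟩ := hmem k hk
    have i1 := IntegrableOn.intervalIntegrable_of_subset hAu m1 m2
    have i2 := IntegrableOn.intervalIntegrable_of_subset (hAv (v k)) m1 m2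
    have i3 := (IntegrableOn.intervalIntegrable_of_subset (hApow n) m1 m2).const_mul
      (ε / (4 * (c + 1)))
    have i4 := (IntegrableOn.intervalIntegrable_of_subset (hupow (v k)) m1 m2).const_mul cy
    rw [← intervalIntegral.integral_const_mul, ← intervalIntegral.integral_const_mul,
      ← intervalIntegral.integral_add i3 i4, ← intervalIntegral.integral_add i2 (i3.add i4)]
    refine intervalIntegral.integral_mono_on (hτmono k) i1 (i2.add (i3.add i4)) fun t _ => ?_
    have h1 : A n t (ū t) = A n t (v k) + A n t (ū t - v k) := by simp
    rw [h1]
    gcongr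
    exact (le_abs_self _).trans (((A n t).le_opNorm _).trans
      (hy _ _ (norm_nonneg _) (norm_nonneg _)))
  have hsplit : ∀ {F : ℝ → ℝ}, IntegrableOn F (Icc 0 S) →
      ∑ k ∈ Finset.range (N + 1), ∫ t in τ k..τ (k + 1), F t = ∫ t in (0 : ℝ)..S, F t := by
    intro F hF
    rw [intervalIntegral.sum_integral_adjacent_intervals (fun k hk =>
      IntegrableOn.intervalIntegrable_of_subset hF (hmem k (Finset.mem_range.2 hk)).1
        (hmem k (Finset.mem_range.2 hk)).2), hτ0, hτN]
  have htot := Finset.sum_le_sum hpiece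
  rw [hsplit hAu, Finset.sum_add_distrib, Finset.sum_add_distrib, ← Finset.mul_sum,
    ← Finset.mul_sum, hsplit (hApow n)] at htot
  have h1 : ε / (4 * (c + 1)) * (∫ t in (0 : ℝ)..S, ‖A n t‖ ^ (α / (α - 1))) ≤ ε / 4 := by
    calc _ ≤ ε / (4 * (c + 1)) * (c + 1) := by gcongr; linarith [hc n]
      _ = ε / 4 := by field_simp
  have h2 : cy * ∑ k ∈ Finset.range (N + 1), ∫ t in τ k..τ (k + 1), ‖ū t - v k‖ ^ α ≤ ε / 4 := by
    calc _ ≤ cy * (ε / (4 * (cy + 1))) := mul_le_mul_of_nonneg_left hsum hcy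
      _ ≤ (cy + 1) * (ε / (4 * (cy + 1))) := by gcongr; linarith
      _ = ε / 4 := by field_simp
  linarith

/-- A constant sequence of right-hand sides makes the asymptotic estimate an honest inequality, with
`ε` arbitrary. -/
lemma norm_sq_ge_of_weak_equation {ι : V →L[ℝ] H} (hι : DenseRange ι) {α S : ℝ} (hα : 1 < α)
    (hS : 0 ≤ S) {w : ℝ → StrongDual ℝ V}
    (hw : MemLp w (ENNReal.ofReal (α / (α - 1))) (volume.restrict (Icc 0 S)))
    {u : ℝ → H} {R : ℝ} (hR : ∀ t ∈ Icc 0 S, ‖u t‖ ≤ R)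
    (heq : ∀ s ∈ Icc 0 S, ∀ t ∈ Icc 0 S, ∀ v : V,
      inner ℝ (u t - u s) (ι v) = ∫ r in s..t, w r v)
    {ū : ℝ → V} (hū : MemLp ū (ENNReal.ofReal α) (volume.restrict (Icc 0 S)))
    (hιu : ∀ᵐ t ∂(volume.restrict (Icc 0 S)), ι (ū t) = u t) :
    ‖u 0‖ ^ 2 + 2 * ∫ t in (0 : ℝ)..S, w t (ū t) ≤ ‖u S‖ ^ 2 := by
  rcases hS.eq_or_lt with rfl | hS
  · simp
  have h := fun ε (hε : 0 < ε) => eventually_integral_apply_le hι hα hS (A := fun _ => w)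
    (fun _ => hw) (fun _ => le_rfl) hR
    (fun s hs t ht v => by rw [heq s hs t ht v]; exact tendsto_const_nhds) hū hιu hε
  simp only [eventually_const] at h
  have := le_of_forall_pos_le_add h
  linarith

/-- The energy equality in a Gelfand triple. -/
theorem norm_sq_eq_of_weak_equation {ι : V →L[ℝ] H} (hι : DenseRange ι) {α S : ℝ} (hα : 1 < α)
    {w : ℝ → StrongDual ℝ V}
    (hw : MemLp w (ENNReal.ofReal (α / (α - 1))) (volume.restrict (Icc 0 S)))
    {u : ℝ → H} {R : ℝ} (hR : ∀ t ∈ Icc 0 S, ‖u t‖ ≤ R)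
    (heq : ∀ s ∈ Icc 0 S, ∀ t ∈ Icc 0 S, ∀ v : V,
      inner ℝ (u t - u s) (ι v) = ∫ r in s..t, w r v)
    {ū : ℝ → V} (hū : MemLp ū (ENNReal.ofReal α) (volume.restrict (Icc 0 S)))
    (hιu : ∀ᵐ t ∂(volume.restrict (Icc 0 S)), ι (ū t) = u t) {t : ℝ} (ht : t ∈ Icc 0 S) :
    ‖u t‖ ^ 2 = ‖u 0‖ ^ 2 + 2 * ∫ s in (0 : ℝ)..t, w s (ū s) := by
  have hsub : Icc 0 t ⊆ Icc 0 S := Icc_subset_Icc_right ht.2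
  have hmono := Measure.restrict_mono_set (volume : Measure ℝ) hsub
  have hw' := hw.mono_measure hmono
  have hū' := hū.mono_measure hmono
  have hιu' := ae_mono hmono hιu
  refine le_antisymm ?_ (norm_sq_ge_of_weak_equation hι hα ht.1 hw' (fun s hs => hR s (hsub hs))
    (fun s hs r hr v => heq s (hsub hs) r (hsub hr) v) hū' hιu')
  have hmp : MeasurePreserving (fun s => t - s) (volume.restrict (Icc 0 t))
      (volume.restrict (Icc 0 t)) := by
    have h := (Measure.measurePreserving_sub_left (volume : Measure ℝ) t).restrict_preimage
      (s := Icc 0 t) measurableSet_Icc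
    simpa using h
  have hmem : ∀ s ∈ Icc 0 t, t - s ∈ Icc 0 S := fun s hs =>
    ⟨by linarith [hs.2], by linarith [hs.1, ht.2]⟩
  -- The reversed curve `s ↦ u (t - s)` solves the equation with right-hand side `-w (t - s)`, and
  -- the same one-sided estimate for it is the missing inequality.
  have h := norm_sq_ge_of_weak_equation hι hα ht.1 (w := fun s => -w (t - s))
    (u := fun s => u (t - s)) (ū := fun s => ū (t - s))
    (hw'.comp_measurePreserving hmp).neg (fun s hs => hR _ (hmem s hs))
    (fun s hs r hr v => by
      rw [heq _ (hmem s hs) _ (hmem r hr) v, intervalIntegral.integral_symm]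
      simp only [neg_apply, intervalIntegral.integral_neg]
      rw [intervalIntegral.integral_comp_sub_left (fun x => w x v)])
    (hū'.comp_measurePreserving hmp) (hmp.quasiMeasurePreserving.ae hιu')
  simp only [sub_zero, sub_self, neg_apply,
    intervalIntegral.integral_neg] at h
  rw [intervalIntegral.integral_comp_sub_left (fun x => w x (ū x))] at h
  simp only [sub_zero, sub_self] at h
  linarith

end Energy

end GelfandEvolution

namespace GelfandEvolution

open Filter

/-! ### Bihari's inequality with a margin -/

section Bihari

lemma IsCoercivityFunction.continuous_comp_max {g : ℝ → ℝ} (hg : IsCoercivityFunction g) :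
    Continuous fun x => g (max x 0) :=
  hg.continuousOn.comp_continuous (by fun_prop) fun x => by simp

/-- The lifetime condition is strict, so it survives a small perturbation: by Fatou's lemma the
improper integral is at most the lower limit of integrals over bounded intervals starting beyond
`K`, with `g` raised by a positive constant. The raised `g` never vanishes, so its reciprocal is
continuous. -/
lemma exists_lt_integral_inv {g : ℝ → ℝ} (hg : IsCoercivityFunction g) {K S : ℝ} (hK : 0 ≤ K)
    (h : ENNReal.ofReal S < ∫⁻ x in Ioi K, (ENNReal.ofReal (g x))⁻¹) :
    ∃ ε > 0, ∃ M, S < ∫ x in (K + ε)..M, (g (max x 0) + ε)⁻¹ := by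
  have hgc := hg.continuous_comp_max
  have hg0 : ∀ x, 0 ≤ g (max x 0) := fun x => hg.nonneg _ (le_max_right _ _)
  set e : ℕ → ℝ := fun n => 1 / ((n : ℝ) + 1) with he
  have hepos : ∀ n, 0 < e n := fun n => by simp only [he]; positivity
  have helim : Tendsto e atTop (𝓝 0) := tendsto_one_div_add_atTop_nhds_zero_nat
  set F : ℕ → ℝ → ℝ≥0∞ := fun n =>
    (Ioc (K + e n) n).indicator fun x => (ENNReal.ofReal (g (max x 0) + e n))⁻¹ with hF
  have hFm : ∀ n, Measurable (F n) := fun n =>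
    Measurable.indicator ((hgc.measurable.add_const _).ennreal_ofReal.inv) measurableSet_Ioc
  have hlim : ∀ x ∈ Ioi K, Tendsto (fun n => F n x) atTop (𝓝 (ENNReal.ofReal (g x))⁻¹) := by
    intro x hx
    have hx' : K < x := hx
    have hmax : max x 0 = x := max_eq_left (by linarith)
    have h1 : ∀ᶠ n in atTop, K + e n < x := by
      have : Tendsto (fun n => K + e n) atTop (𝓝 (K + 0)) := tendsto_const_nhds.add helim
      exact this.eventually (gt_mem_nhds (by simpa using hx'))
    have h2 : ∀ᶠ n : ℕ in atTop, x ≤ n := tendsto_natCast_atTop_atTop.eventually_ge_atTop x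
    have h3 : Tendsto (fun n => (ENNReal.ofReal (g (max x 0) + e n))⁻¹) atTop
        (𝓝 (ENNReal.ofReal (g x))⁻¹) := by
      have : Tendsto (fun n => g (max x 0) + e n) atTop (𝓝 (g x + 0)) := by
        rw [hmax]; exact tendsto_const_nhds.add helim
      rw [add_zero] at this
      exact ((continuous_inv.tendsto _).comp ((ENNReal.continuous_ofReal.tendsto _).comp this))
    refine h3.congr' ?_
    filter_upwards [h1, h2] with n hn1 hn2
    rw [hF]
    simp [hn1, hn2]
  have hfatou : ∫⁻ x in Ioi K, (ENNReal.ofReal (g x))⁻¹ ≤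
      liminf (fun n => ∫⁻ x in Ioi K, F n x) atTop := by
    refine le_trans (le_of_eq ?_) (lintegral_liminf_le hFm)
    exact setLIntegral_congr_fun measurableSet_Ioi fun x hx => (hlim x hx).liminf_eq.symm
  obtain ⟨n, hn⟩ := (eventually_lt_of_lt_liminf (h.trans_le hfatou)).exists
  have hn' : ENNReal.ofReal S < ∫⁻ x in Ioc (K + e n) n, (ENNReal.ofReal (g (max x 0) + e n))⁻¹ := by
    refine hn.trans_le ?_
    rw [← lintegral_indicator measurableSet_Ioc]
    exact setLIntegral_le_lintegral _ _
  have hlt : K + e n < n := by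
    by_contra hc
    rw [Ioc_eq_empty hc] at hn'
    simp at hn'
  refine ⟨e n, hepos n, n, ?_⟩
  have hpos : ∀ x, 0 < g (max x 0) + e n := fun x => by linarith [hg0 x, hepos n]
  have hcont : Continuous fun x => (g (max x 0) + e n)⁻¹ :=
    (hgc.add continuous_const).inv₀ fun x => (hpos x).ne'
  have heq : ∫⁻ x in Ioc (K + e n) n, (ENNReal.ofReal (g (max x 0) + e n))⁻¹ =
      ENNReal.ofReal (∫ x in (K + e n)..n, (g (max x 0) + e n)⁻¹) := by
    rw [intervalIntegral.integral_of_le hlt.le, ofReal_integral_eq_lintegral_ofReal]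
    · refine lintegral_congr fun x => ?_
      rw [ENNReal.ofReal_inv_of_pos (hpos x)]
    · exact (intervalIntegrable_iff_integrableOn_Ioc_of_le hlt.le).1
        (hcont.intervalIntegrable _ _)
    · exact Eventually.of_forall fun x => (inv_pos.2 (hpos x)).le
  rw [heq] at hn'
  exact (ENNReal.ofReal_lt_ofReal_iff'.1 hn').1

/-- Bihari's inequality, in differential form and with a margin. -/
lemma exists_bihari_bound {g : ℝ → ℝ} (hg : IsCoercivityFunction g) {K S : ℝ} (hK : 0 ≤ K)
    (h : ENNReal.ofReal S < ∫⁻ x in Ioi K, (ENNReal.ofReal (g x))⁻¹) :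
    ∃ ε > 0, ∃ M, ∀ z z' : ℝ → ℝ, z 0 ≤ K + ε → ContinuousOn z (Icc 0 S) →
      (∀ t ∈ Ioo 0 S, HasDerivAt z (z' t) t ∧ z' t ≤ g (z t)) → (∀ t ∈ Icc 0 S, 0 ≤ z t) →
      ∀ t ∈ Icc 0 S, z t ≤ M := by
  obtain ⟨ε, hε, M, hM⟩ := exists_lt_integral_inv hg hK h
  refine ⟨ε, hε, M, fun z z' hz0 hzc hzd hznn => ?_⟩
  have hpos : ∀ x, 0 < g (max x 0) + ε := fun x => by
    linarith [hg.nonneg _ (le_max_right x 0)]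
  have hcont : Continuous fun x => (g (max x 0) + ε)⁻¹ :=
    (hg.continuous_comp_max.add continuous_const).inv₀ fun x => (hpos x).ne'
  -- Along `z` the function `Φ` grows at rate at most one and starts at a value at most zero, so it
  -- stays at most `S < Φ M`; strict monotonicity of `Φ` then bounds `z`.
  set Φ : ℝ → ℝ := fun y => ∫ x in (K + ε)..y, (g (max x 0) + ε)⁻¹ with hΦ
  have hΦd : ∀ y, HasDerivAt Φ (g (max y 0) + ε)⁻¹ y := fun y =>
    intervalIntegral.integral_hasDerivAt_right (hcont.intervalIntegrable _ _)
      (hcont.stronglyMeasurableAtFilter _ _) hcont.continuousAt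
  have hΦmono : StrictMono Φ := strictMono_of_deriv_pos fun y => by
    rw [(hΦd y).deriv]; exact inv_pos.2 (hpos y)
  have hΦc : Continuous Φ := continuous_iff_continuousAt.2 fun y => (hΦd y).continuousAt
  have hanti : AntitoneOn (fun t => Φ (z t) - t) (Icc 0 S) := by
    have hd : ∀ t ∈ Ioo 0 S,
        HasDerivAt (fun t => Φ (z t) - t) ((g (max (z t) 0) + ε)⁻¹ * z' t - 1) t := fun t ht =>
      ((hΦd (z t)).comp t (hzd t ht).1).sub (hasDerivAt_id t)
    refine antitoneOn_of_deriv_nonpos (convex_Icc 0 S)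
      ((hΦc.comp_continuousOn hzc).sub continuousOn_id) ?_ ?_
    · rw [interior_Icc]
      exact fun t ht => (hd t ht).differentiableAt.differentiableWithinAt
    · rw [interior_Icc]
      intro t ht
      rw [(hd t ht).deriv]
      have h1 : max (z t) 0 = z t := max_eq_left (hznn t ⟨ht.1.le, ht.2.le⟩)
      have h2 : z' t ≤ g (max (z t) 0) + ε := by rw [h1]; linarith [(hzd t ht).2]
      have h3 : (g (max (z t) 0) + ε)⁻¹ * z' t ≤ 1 := by
        rw [inv_mul_le_iff₀ (hpos _)]; linarith
      linarith
  intro t ht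
  have h1 : Φ (z t) - t ≤ Φ (z 0) - 0 := hanti ⟨le_rfl, ht.1.trans ht.2⟩ ht ht.1
  have h2 : Φ (z 0) ≤ Φ (K + ε) := hΦmono.monotone hz0
  have h3 : Φ (K + ε) = 0 := intervalIntegral.integral_same
  have h4 : S < Φ M := hM
  exact (hΦmono.lt_iff_lt.1 (show Φ (z t) < Φ M by linarith [ht.2])).le

end Bihari

/-! ### Integral equations with delay -/

section Delay

variable {E : Type*} [NormedAddCommGroup E] [NormedSpace ℝ E]

/-- An integral equation with a delay is solvable without any continuity in the state variable. -/
lemma exists_delay_solution {B : ℝ → E → E} {m : ℝ → ℝ}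
    (hm : Integrable m) (hB : ∀ u : ℝ → E, Continuous u → AEStronglyMeasurable fun s => B s (u s))
    (hbd : ∀ s x, ‖B s x‖ ≤ m s) (x₀ : E) {h : ℝ} (hh : 0 < h) (S : ℝ) :
    ∃ u : ℝ → E, Continuous u ∧
      ∀ t ∈ Icc 0 S, u t = x₀ + ∫ s in (0 : ℝ)..t, B s (u (max (s - h) 0)) := by
  set Ψ : (ℝ → E) → ℝ → E := fun u t => x₀ + ∫ s in (0 : ℝ)..t, B s (u (max (s - h) 0)) with hΨ
  have hcont : ∀ u, Continuous u → Continuous (Ψ u) := fun u hu => by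
    have hint : Integrable fun s => B s (u (max (s - h) 0)) :=
      hm.mono' (hB (fun s => u (max (s - h) 0)) (by fun_prop)) (Eventually.of_forall fun s => hbd _ _)
    exact continuous_const.add
      (intervalIntegral.continuous_primitive (fun a b => hint.intervalIntegrable) 0)
  set U : ℕ → ℝ → E := fun j => Ψ^[j] fun _ => x₀ with hU
  have hUs : ∀ j, U (j + 1) = Ψ (U j) := fun j => Function.iterate_succ_apply' Ψ j _
  have hUc : ∀ j, Continuous (U j) := by
    intro j
    induction j with
    | zero => exact continuous_const
    | succ j ih => rw [hUs]; exact hcont _ ih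
  -- The right-hand side at time `s` sees the curve only at time `max (s - h) 0`. The Picard
  -- iterates are thus eventually constant, settling on one more interval of length `h` per
  -- iteration, and no contraction is needed.
  have hstab : ∀ j : ℕ, ∀ t ∈ Icc 0 (j * h), U (j + 1) t = U j t := by
    intro j
    induction j with
    | zero =>
      intro t ht
      have : t = 0 := by simpa using ht
      simp [hU, hΨ, this]
    | succ j ih =>
      intro t ht
      rw [hUs (j + 1), hUs j]
      simp only [hΨ]
      congr 1
      refine intervalIntegral.integral_congr fun s hs => ?_
      rw [uIcc_of_le ht.1] at hs
      have h1 : max (s - h) 0 ∈ Icc 0 (j * h) := by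
        refine ⟨le_max_right _ _, max_le ?_ (by positivity)⟩
        have := ht.2
        push_cast at this
        linarith [hs.2]
      exact congrArg (B s) (by rw [← ih _ h1, hUs])
  obtain ⟨j, hj⟩ := exists_nat_gt (S / h)
  rw [div_lt_iff₀ hh] at hj
  refine ⟨U j, hUc j, fun t ht => ?_⟩
  rw [← hstab j t ⟨ht.1, ht.2.trans hj.le⟩, hUs]

end Delay

/-! ### Finite-dimensional projections of the dual -/

section Projection

variable {V H : Type*} [NormedAddCommGroup V] [NormedSpace ℝ V]
  [NormedAddCommGroup H] [InnerProductSpace ℝ H]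

/-- `toDual` as a continuous linear map. -/
noncomputable def toDualL (ι : V →L[ℝ] H) : H →L[ℝ] StrongDual ℝ V :=
  LinearMap.mkContinuous
    { toFun := toDual ι
      map_add' := fun x y => by ext v; simp [toDual]
      map_smul' := fun r x => by ext v; simp [toDual] } ‖ι‖ fun x => by
    refine ((innerSL ℝ x).opNorm_comp_le ι).trans ?_
    rw [innerSL_apply_norm, mul_comm]

@[simp] lemma toDualL_apply (ι : V →L[ℝ] H) (h : H) : toDualL ι h = toDual ι h := rfl

@[simp] lemma toDual_apply (ι : V →L[ℝ] H) (h : H) (v : V) : toDual ι h v = inner ℝ h (ι v) := rfl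

/-- The Galerkin projection: an `H`-orthonormal basis of the image of `F` lifts to vectors of `F`,
and a functional is expanded with its values on them as coefficients. On the image of `H` it is the
orthogonal projection onto `ι(F)`, whence the contraction property and the identity on `F` below. -/
lemma exists_dual_projection {ι : V →L[ℝ] H} (hι : Function.Injective ι) (F : Submodule ℝ V)
    [FiniteDimensional ℝ F] :
    ∃ P : StrongDual ℝ V →L[ℝ] V, (∀ y, P y ∈ F) ∧
      ∀ y, ∀ v ∈ F, inner ℝ (ι (P y)) (ι v) = y v := by
  classical
  set G := F.map (ι : V →ₗ[ℝ] H) with hG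
  set b := stdOrthonormalBasis ℝ G
  have hex : ∀ i, ∃ e ∈ F, ι e = (b i : H) := fun i => by
    obtain ⟨e, he, h⟩ := Submodule.mem_map.1 (b i).2
    exact ⟨e, he, h⟩
  choose e heF he using hex
  refine ⟨∑ i, (ContinuousLinearMap.apply ℝ ℝ (e i)).smulRight (e i), fun y => ?_, fun y v hv => ?_⟩
  · rw [sum_apply]
    exact F.sum_mem fun i _ => F.smul_mem _ (heF i)
  · set x : G := ⟨ι v, Submodule.mem_map.2 ⟨v, hv, rfl⟩⟩ with hx
    have h1 : v = ∑ i, (inner ℝ (b i) x) • e i := by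
      apply hι
      have h2 := congrArg (fun z : G => (z : H)) (b.sum_repr' x)
      simp only [Submodule.coe_sum, Submodule.coe_smul] at h2
      rw [map_sum]
      simp only [map_smul, he]
      exact h2.symm
    have h3 : ∀ i, inner ℝ (ι (e i)) (ι v) = inner ℝ (b i) x := fun i => by
      rw [he]; rfl
    rw [sum_apply, map_sum, sum_inner]
    conv_rhs => rw [h1, map_sum]
    refine Finset.sum_congr rfl fun i _ => ?_
    simp only [ContinuousLinearMap.smulRight_apply, ContinuousLinearMap.apply_apply, map_smul,
      inner_smul_left, h3, smul_eq_mul, conj_trivial]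
    ring

lemma norm_projection_le {ι : V →L[ℝ] H} {F : Submodule ℝ V} {P : StrongDual ℝ V →L[ℝ] V}
    (hPF : ∀ y, P y ∈ F) (hP : ∀ y, ∀ v ∈ F, inner ℝ (ι (P y)) (ι v) = y v) (h : H) :
    ‖ι (P (toDual ι h))‖ ≤ ‖h‖ := by
  have h1 := hP (toDual ι h) _ (hPF (toDual ι h))
  rw [real_inner_self_eq_norm_sq, toDual_apply] at h1
  have h2 := real_inner_le_norm h (ι (P (toDual ι h)))
  by_contra! hc
  have := norm_nonneg h
  nlinarith

lemma projection_eq_self {ι : V →L[ℝ] H} (hι : Function.Injective ι) {F : Submodule ℝ V}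
    {P : StrongDual ℝ V →L[ℝ] V} (hPF : ∀ y, P y ∈ F)
    (hP : ∀ y, ∀ v ∈ F, inner ℝ (ι (P y)) (ι v) = y v) {x : V} (hx : x ∈ F) :
    P (toDual ι (ι x)) = x := by
  have h1 := hP (toDual ι (ι x)) _ (F.sub_mem (hPF (toDual ι (ι x))) hx)
  rw [toDual_apply, ← sub_eq_zero, ← inner_sub_left, ← map_sub] at h1
  have := inner_self_eq_zero.1 h1
  rw [map_sub, sub_eq_zero] at this
  exact hι this

end Projection

end GelfandEvolution

namespace GelfandEvolution

open Filter

/-! ### Growth estimates and delayed Galerkin curves -/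

section Growth

variable {V H : Type*} [NormedAddCommGroup V] [NormedSpace ℝ V]
  [NormedAddCommGroup H] [InnerProductSpace ℝ H]
  {ι : V →L[ℝ] H} {T α β δ C : ℝ} {A : ℝ → V → StrongDual ℝ V} {f g : ℝ → ℝ}

/-- The exponents in the growth condition become `1` and `α` when raised to the conjugate power, and
the factor in the `H`-norm is a constant on `H`-balls. The constant `C` may be negative and is
replaced by its absolute value. -/
lemma Growth.rpow_le (hgrowth : Growth ι T A α β C f) (hα : 1 < α) (hβ : 0 ≤ β)
    (hf : ∀ t ∈ Icc 0 T, 0 ≤ f t) {R : ℝ} (hR : 0 ≤ R) :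
    ∃ c, 0 ≤ c ∧ ∀ t ∈ Icc 0 T, ∀ v, ‖ι v‖ ≤ R →
      ‖A t v‖ ^ (α / (α - 1)) ≤ c * (f t + ‖v‖ ^ α) := by
  have hp0 : 0 < α / (α - 1) := by linarith [one_lt_conjExponent hα]
  have hα1 : α - 1 ≠ 0 := by linarith
  have hα0 : α ≠ 0 := by linarith
  set p := α / (α - 1) with hp
  have hpinv : (α - 1) / α * p = 1 := by rw [hp]; field_simp
  have hpinv' : (α - 1) * p = α := by rw [hp]; field_simp
  refine ⟨(2 ^ p * (1 + |C| ^ p)) * (1 + R ^ β) ^ p, by positivity, fun t ht v hv => ?_⟩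
  have hft := hf t ht
  have h1 : ‖A t v‖ ≤ (f t ^ ((α - 1) / α) + |C| * ‖v‖ ^ (α - 1)) * (1 + R ^ β) := by
    refine (hgrowth t ht v).trans ?_
    have h2 : C * ‖v‖ ^ (α - 1) ≤ |C| * ‖v‖ ^ (α - 1) := by
      gcongr; exact le_abs_self C
    have h3 : ‖ι v‖ ^ β ≤ R ^ β := Real.rpow_le_rpow (norm_nonneg _) hv hβ
    have h4 : 0 ≤ f t ^ ((α - 1) / α) + |C| * ‖v‖ ^ (α - 1) := by positivity
    calc _ ≤ (f t ^ ((α - 1) / α) + |C| * ‖v‖ ^ (α - 1)) * (1 + ‖ι v‖ ^ β) := by gcongr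
      _ ≤ _ := by gcongr
  have h2 := Real.rpow_le_rpow (norm_nonneg _) h1 hp0.le
  rw [Real.mul_rpow (by positivity) (by positivity)] at h2
  have h3 := add_rpow_le hp0.le (show 0 ≤ f t ^ ((α - 1) / α) by positivity)
    (show 0 ≤ |C| * ‖v‖ ^ (α - 1) by positivity)
  rw [Real.mul_rpow (abs_nonneg _) (by positivity), ← Real.rpow_mul hft,
    ← Real.rpow_mul (norm_nonneg _), hpinv, hpinv', Real.rpow_one] at h3
  have h4 : f t + |C| ^ p * ‖v‖ ^ α ≤ (1 + |C| ^ p) * (f t + ‖v‖ ^ α) := by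
    have : 0 ≤ |C| ^ p * f t := by positivity
    have : 0 ≤ ‖v‖ ^ α := by positivity
    linarith
  calc ‖A t v‖ ^ p ≤ _ := h2
    _ ≤ (2 ^ p * ((1 + |C| ^ p) * (f t + ‖v‖ ^ α))) * (1 + R ^ β) ^ p := by
        gcongr
        exact h3.trans (by gcongr)
    _ = _ := by ring

/-- Restricted measurability concerns curves integrable on the full interval, so a curve on a
shorter one is extended by zero. -/
lemma RestrictedlyMeasurable.aestronglyMeasurable (hA : RestrictedlyMeasurable T A) {S : ℝ}
    (hST : S ≤ T) {u : ℝ → V} (hu : IntegrableOn u (Icc 0 S)) :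
    AEStronglyMeasurable (fun t => A t (u t)) (volume.restrict (Icc 0 S)) := by
  have h := hA ((Icc 0 S).indicator u) (hu.integrable_indicator measurableSet_Icc).integrableOn
  refine (h.mono_measure (Measure.restrict_mono_set _ (Icc_subset_Icc_right hST))).congr ?_
  filter_upwards [ae_restrict_mem measurableSet_Icc] with t ht
  rw [indicator_of_mem ht]

lemma memLp_apply_of_growth (hA : RestrictedlyMeasurable T A) (hα : 1 < α) {S c : ℝ}
    (hST : S ≤ T) (hf : IntegrableOn f (Icc 0 T)) {u : ℝ → V}
    (hu : MemLp u (ENNReal.ofReal α) (volume.restrict (Icc 0 S)))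
    (hc : ∀ᵐ t ∂(volume.restrict (Icc 0 S)),
      ‖A t (u t)‖ ^ (α / (α - 1)) ≤ c * (f t + ‖u t‖ ^ α)) :
    MemLp (fun t => A t (u t)) (ENNReal.ofReal (α / (α - 1))) (volume.restrict (Icc 0 S)) := by
  have hα0 : 0 < α := by linarith
  have hp0 : 0 < α / (α - 1) := by linarith [one_lt_conjExponent hα]
  have hui : IntegrableOn u (Icc 0 S) :=
    hu.integrable (by rw [← ENNReal.ofReal_one]; exact ENNReal.ofReal_le_ofReal hα.le)
  have hm := hA.aestronglyMeasurable hST hui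
  have h2 := ((memLp_ofReal_iff hα0).1 hu).2
  have hf' : IntegrableOn f (Icc 0 S) := hf.mono_set (Icc_subset_Icc_right hST)
  refine (memLp_ofReal_iff hp0).2 ⟨hm, ?_⟩
  refine ((hf'.add h2).const_mul c).mono' (by
    exact (hm.norm.aemeasurable.pow_const _).aestronglyMeasurable) ?_
  filter_upwards [hc] with t ht
  rw [Real.norm_of_nonneg (by positivity)]
  exact ht

/-- Galerkin approximations with an arbitrarily small delay. -/
lemma exists_galerkin [CompleteSpace V] (hinj : Function.Injective ι) (hdense : DenseRange ι)
    (hA : RestrictedlyMeasurable T A) (hα : 1 < α) (hβ : 0 ≤ β) (hδ : 0 < δ)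
    (hf : IntegrableOn f (Icc 0 T)) (hf_nonneg : ∀ t ∈ Icc 0 T, 0 ≤ f t)
    (hg : IsCoercivityFunction g) (hcoer : GeneralizedCoercivity ι T A α δ f g)
    (hgrowth : Growth ι T A α β C f) {S : ℝ} (hS : S ∈ Ioc 0 T) (u₀ : H) {ε₀ M : ℝ} (hε₀ : 0 < ε₀)
    (hM : ∀ z z' : ℝ → ℝ, z 0 ≤ (‖u₀‖ ^ 2 + ∫ t in (0 : ℝ)..S, f t) + ε₀ →
      ContinuousOn z (Icc 0 S) →
      (∀ t ∈ Ioo 0 S, HasDerivAt z (z' t) t ∧ z' t ≤ g (z t)) → (∀ t ∈ Icc 0 S, 0 ≤ z t) →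
      ∀ t ∈ Icc 0 S, z t ≤ M)
    (F : Submodule ℝ V) [FiniteDimensional ℝ F] {ε : ℝ} (hε : 0 < ε) :
    ∃ u û : ℝ → V, Continuous u ∧ Continuous û ∧
      (∀ t ∈ Icc 0 S, ∀ v ∈ F,
        inner ℝ (ι (û t)) (ι v) = inner ℝ u₀ (ι v) + ∫ s in (0 : ℝ)..t, A s (u s) v) ∧
      ‖ι (û 0)‖ ≤ ‖u₀‖ ∧
      ∀ t ∈ Icc 0 S, ‖ι (û t)‖ ^ 2 ≤ M ∧ ‖ι (u t)‖ ^ 2 ≤ M ∧ ‖û t - u t‖ ≤ ε ∧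
        ‖ι (û t)‖ ^ 2 ≤ ‖ι (û 0)‖ ^ 2 + 2 * (∫ s in (0 : ℝ)..t, A s (u s) (u s)) + ε := by
  have hα0 : 0 < α := by linarith
  have hp := one_lt_conjExponent hα
  have hp0 : 0 < α / (α - 1) := by linarith
  have hS0 : 0 ≤ S := hS.1.le
  have hsubT : Icc 0 S ⊆ Icc 0 T := Icc_subset_Icc_right hS.2
  have hfS : IntegrableOn f (Icc 0 S) := hf.mono_set hsubT
  obtain ⟨P, hPF, hP⟩ := exists_dual_projection hinj F
  -- On `F` the `V`-norm is controlled by the `H`-norm, so the a priori bound `M` becomes a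
  -- `V`-bound. It depends on `F`, which is harmless because `R` serves only for the truncation.
  set R : ℝ := ‖P‖ * (‖toDualL ι‖ * √M) with hR
  have hR0 : 0 ≤ R := by positivity
  have hFR : ∀ x ∈ F, ‖ι x‖ ^ 2 ≤ M → ‖x‖ ≤ R := fun x hx hxM => by
    rw [← projection_eq_self hinj hPF hP hx]
    refine (P.le_opNorm _).trans (mul_le_mul_of_nonneg_left ?_ (norm_nonneg P))
    refine ((toDualL ι).le_opNorm _).trans ?_
    gcongr
    exact Real.le_sqrt_of_sq_le hxM
  obtain ⟨c, hc, hcA⟩ := hgrowth.rpow_le hα hβ hf_nonneg (R := ‖ι‖ * R) (by positivity)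
  -- The summand `1` lets `a` dominate `‖A s x‖` as well as its conjugate power: a norm above one is
  -- at most its power.
  set a : ℝ → ℝ := fun s => 1 + c * (f s + R ^ α) with ha
  have hai : IntegrableOn a (Icc 0 S) :=
    (integrable_const _).add ((hfS.add (integrable_const _)).const_mul c)
  have ha_nonneg : ∀ s ∈ Icc 0 S, 0 ≤ a s := fun s hs => by
    have := hf_nonneg s (hsubT hs)
    simp only [ha]; positivity
  have hAa : ∀ s ∈ Icc 0 S, ∀ x, ‖x‖ ≤ R → ‖A s x‖ ^ (α / (α - 1)) ≤ a s ∧ ‖A s x‖ ≤ a s := by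
    intro s hs x hx
    have h1 : ‖A s x‖ ^ (α / (α - 1)) ≤ c * (f s + R ^ α) := by
      refine (hcA s (hsubT hs) x ((ι.le_opNorm x).trans (by gcongr))).trans ?_
      gcongr
    refine ⟨by simp only [ha]; linarith, ?_⟩
    rcases le_total ‖A s x‖ 1 with h | h
    · have := h1.trans' (show 0 ≤ ‖A s x‖ ^ (α / (α - 1)) by positivity)
      simp only [ha]; linarith
    · have := Real.self_le_rpow_of_one_le h hp.le
      simp only [ha]; linarith
  classical
  set Y : ℝ → V → StrongDual ℝ V := fun s x => if s ∈ Icc 0 S ∧ ‖x‖ ≤ R then A s x else 0 with hY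
  have hYa : ∀ s ∈ Icc 0 S, ∀ x, ‖Y s x‖ ^ (α / (α - 1)) ≤ a s ∧ ‖Y s x‖ ≤ a s := by
    intro s hs x
    by_cases h : ‖x‖ ≤ R
    · simp only [hY, hs, h, and_self, if_true]
      exact hAa s hs x h
    · simp only [hY, h, and_false, if_false, norm_zero]
      rw [Real.zero_rpow hp0.ne']
      exact ⟨ha_nonneg s hs, ha_nonneg s hs⟩
  have hYm : ∀ u : ℝ → V, Continuous u → AEStronglyMeasurable fun s => Y s (u s) := by
    intro u hu
    have h1 := hA.aestronglyMeasurable hS.2 (hu.continuousOn.integrableOn_Icc (a := 0) (b := S))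
    have h2 := (aestronglyMeasurable_indicator_iff measurableSet_Icc).2
      (h1.indicator (s := {s | ‖u s‖ ≤ R}) (measurableSet_le hu.norm.measurable measurable_const))
    convert h2 using 1
    ext1 s
    by_cases hs : s ∈ Icc 0 S <;> by_cases hus : ‖u s‖ ≤ R <;>
      simp only [hY, indicator, mem_ofPred_eq, hs, hus, and_self, and_false, false_and, if_true,
        if_false]
  set m : ℝ → ℝ := (Icc 0 S).indicator fun s => ‖P‖ * a s with hm
  have hmi : Integrable m :=
    IntegrableOn.integrable_indicator (Integrable.const_mul hai ‖P‖) measurableSet_Icc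
  have hPY : ∀ s x, ‖P (Y s x)‖ ≤ m s := by
    intro s x
    by_cases hs : s ∈ Icc 0 S
    · rw [hm, indicator_of_mem hs]
      refine (P.le_opNorm _).trans ?_
      gcongr
      exact (hYa s hs x).2
    · have : Y s x = 0 := by simp only [hY, hs, false_and, if_false]
      rw [hm, indicator_of_notMem hs, this, map_zero, norm_zero]
  set ε₁ := min ε ε₀ with hε₁
  have hε₁pos : 0 < ε₁ := lt_min hε hε₀
  set I := ∫ s in (0 : ℝ)..S, a s with hI
  have hI0 : 0 ≤ I := intervalIntegral.integral_nonneg hS0 ha_nonneg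
  -- The delay will move the curve by at most `r`; pairing that displacement with a functional
  -- bounded by `a` changes the energy by at most `2 * I * r ≤ ε₁`.
  set r := min ε₁ (ε₁ / (2 * (I + 1))) with hr
  have hrpos : 0 < r := lt_min hε₁pos (by positivity)
  obtain ⟨h, hh, hhm⟩ : ∃ h > 0, ∀ s ∈ Icc 0 S, ∀ t ∈ Icc 0 S, s ≤ t → t - s ≤ h →
      ∫ x in s..t, m x ≤ r := by
    have hcont : Continuous fun t => ∫ x in (0 : ℝ)..t, m x :=
      intervalIntegral.continuous_primitive (fun _ _ => hmi.intervalIntegrable) 0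
    obtain ⟨d, hd, hd'⟩ := Metric.uniformContinuousOn_iff.1
      (isCompact_Icc.uniformContinuousOn_of_continuous hcont.continuousOn :
        UniformContinuousOn _ (Icc 0 S)) r hrpos
    refine ⟨d / 2, by positivity, fun s hs t ht hst hts => ?_⟩
    have h1 := hd' t ht s hs (by rw [Real.dist_eq, abs_of_nonneg (by linarith)]; linarith)
    rw [Real.dist_eq, intervalIntegral.integral_interval_sub_left hmi.intervalIntegrable
      hmi.intervalIntegrable] at h1
    exact (le_abs_self _).trans h1.le
  obtain ⟨û, hûc, hû⟩ := exists_delay_solution (B := fun s x => P (Y s x)) hmi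
    (fun u hu => P.continuous.comp_aestronglyMeasurable (hYm u hu)) hPY (P (toDual ι u₀)) hh S
  set u : ℝ → V := fun s => û (max (s - h) 0) with hu
  have huc : Continuous u := by simp only [hu]; fun_prop
  set W : ℝ → StrongDual ℝ V := fun s => Y s (u s) with hW
  have hWm : AEStronglyMeasurable W := hYm u huc
  have hWi : Integrable W := by
    refine (IntegrableOn.integrable_indicator hai measurableSet_Icc).mono' hWm
      (Eventually.of_forall fun s => ?_)
    by_cases hs : s ∈ Icc 0 S
    · rw [indicator_of_mem hs]; exact (hYa s hs _).2
    · have : W s = 0 := by simp only [hW, hY, hs, false_and, if_false]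
      rw [indicator_of_notMem hs, this, norm_zero]
  have hWLp : MemLp W (ENNReal.ofReal (α / (α - 1))) (volume.restrict (Icc 0 S)) := by
    refine (memLp_ofReal_iff hp0).2 ⟨hWm.restrict, ?_⟩
    refine Integrable.mono' hai
      (hWm.restrict.norm.aemeasurable.pow_const _).aestronglyMeasurable ?_
    filter_upwards [ae_restrict_mem measurableSet_Icc] with s hs
    rw [Real.norm_of_nonneg (by positivity)]
    exact (hYa s hs _).1
  have hûP : ∀ t ∈ Icc 0 S, û t = P (toDual ι u₀) + P (∫ s in (0 : ℝ)..t, W s) := fun t ht => by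
    rw [hû t ht, ← P.intervalIntegral_comp_comm hWi.intervalIntegrable]
  have hûF : ∀ t ∈ Icc 0 S, û t ∈ F := fun t ht => by
    rw [hûP t ht]; exact F.add_mem (hPF _) (hPF _)
  have happly : ∀ s t v, (∫ x in s..t, W x) v = ∫ x in s..t, W x v := fun s t v =>
    (((ContinuousLinearMap.apply ℝ ℝ v).intervalIntegral_comp_comm
      (hWi.intervalIntegrable (a := s) (b := t))).symm)
  have hmemh : ∀ s ∈ Icc 0 S, max (s - h) 0 ∈ Icc 0 S := fun s hs =>
    ⟨le_max_right _ _, max_le (by linarith [hs.2]) hS0⟩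
  have hû0 : û 0 = P (toDual ι u₀) := by
    rw [hûP 0 (by simp [hS0])]; simp
  have hû_init : ‖ι (û 0)‖ ≤ ‖u₀‖ := by
    rw [hû0]; exact norm_projection_le hPF hP u₀
  have hweak : ∀ t ∈ Icc 0 S, ∀ v ∈ F,
      inner ℝ (ι (û t)) (ι v) = inner ℝ u₀ (ι v) + ∫ s in (0 : ℝ)..t, W s v := by
    intro t ht v hv
    rw [hûP t ht, map_add, inner_add_left, hP _ v hv, hP _ v hv, toDual_apply, happly]
  have hclose : ∀ t ∈ Icc 0 S, ‖û t - u t‖ ≤ r := by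
    intro t ht
    have h1 : û t - u t = ∫ s in (max (t - h) 0)..t, P (W s) := by
      simp only [hu]
      rw [hû t ht, hû _ (hmemh t ht), add_sub_add_left_eq_sub]
      have hi : ∀ a b, IntervalIntegrable (fun s => P (W s)) volume a b := fun a b =>
        (P.integrable_comp hWi).intervalIntegrable
      exact intervalIntegral.integral_interval_sub_left (hi _ _) (hi _ _)
    have h2 : max (t - h) 0 ≤ t := max_le (by linarith) ht.1
    rw [h1]
    refine (intervalIntegral.norm_integral_le_of_norm_le h2
      (Eventually.of_forall fun s _ => hPY s (u s)) hmi.intervalIntegrable).trans ?_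
    exact hhm _ (hmemh t ht) t ht h2 (by linarith [le_max_left (t - h) 0])
  have hûLp : MemLp û (ENNReal.ofReal α) (volume.restrict (Icc 0 S)) := by
    refine (memLp_ofReal_iff hα0).2 ⟨hûc.aestronglyMeasurable, ?_⟩
    exact (hûc.norm.rpow_const fun _ => Or.inr hα0.le).continuousOn.integrableOn_Icc
  have huLp : MemLp u (ENNReal.ofReal α) (volume.restrict (Icc 0 S)) := by
    refine (memLp_ofReal_iff hα0).2 ⟨huc.aestronglyMeasurable, ?_⟩
    exact (huc.norm.rpow_const fun _ => Or.inr hα0.le).continuousOn.integrableOn_Icc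
  have henergy : ∀ t ∈ Icc 0 S,
      ‖ι (û t)‖ ^ 2 = ‖ι (û 0)‖ ^ 2 + 2 * ∫ s in (0 : ℝ)..t, W s (û s) := by
    intro t ht
    obtain ⟨R', hR'⟩ := isCompact_Icc.exists_bound_of_continuousOn (s := Icc 0 S)
      (ι.continuous.comp hûc).continuousOn
    -- The curve is driven by the projected functional `P (W s)`, read back in the dual. Since the
    -- curve stays in `F`, the projection can afterwards be removed from the pairing.
    have key := norm_sq_eq_of_weak_equation hdense hα (S := S)
      (w := fun s => toDualL ι (ι (P (W s)))) (u := fun s => ι (û s)) (ū := û)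
      (((toDualL ι).comp (ι.comp P)).comp_memLp' hWLp) hR' (fun s hs t ht v => by
        rw [hûP s hs, hûP t ht, ← map_sub, add_sub_add_left_eq_sub, ← map_sub,
          intervalIntegral.integral_interval_sub_left hWi.intervalIntegrable
            hWi.intervalIntegrable]
        have h1 := ((((ContinuousLinearMap.apply ℝ ℝ v).comp
          ((toDualL ι).comp (ι.comp P))).intervalIntegral_comp_comm
          (hWi.intervalIntegrable (a := s) (b := t))))
        simp only [ContinuousLinearMap.comp_apply, ContinuousLinearMap.apply_apply,
          toDualL_apply, toDual_apply] at h1 ⊢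
        exact h1.symm)
      hûLp (Eventually.of_forall fun _ => rfl) ht
    rw [key]
    congr 2
    refine intervalIntegral.integral_congr fun s hs => ?_
    rw [uIcc_of_le ht.1] at hs
    simp only [toDualL_apply, toDual_apply]
    exact hP _ _ (hûF s ⟨hs.1, hs.2.trans ht.2⟩)
  have hWu : IntegrableOn (fun s => W s (u s)) (Icc 0 S) := integrable_apply hα hWLp huLp
  have hWû : IntegrableOn (fun s => W s (û s)) (Icc 0 S) := integrable_apply hα hWLp hûLp
  have hzero : (0 : ℝ) ∈ Icc 0 S := by simp [hS0]
  have herr : ∀ t ∈ Icc 0 S, 2 * ∫ s in (0 : ℝ)..t, a s * r ≤ ε₁ := by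
    intro t ht
    rw [intervalIntegral.integral_mul_const]
    have h1 : ∫ s in (0 : ℝ)..t, a s ≤ I := by
      refine intervalIntegral.integral_mono_interval le_rfl ht.1 ht.2 ?_
        (IntegrableOn.intervalIntegrable_of_subset hai hzero (by simp [hS0]))
      filter_upwards [ae_restrict_mem measurableSet_Ioc] with s hs
      exact ha_nonneg s (Ioc_subset_Icc_self hs)
    calc _ ≤ 2 * ((I + 1) * (ε₁ / (2 * (I + 1)))) := by
          gcongr
          · linarith
          · exact min_le_right _ _
      _ = ε₁ := by field_simp
  have hpair : ∀ s ∈ Icc 0 S, W s (û s) ≤ W s (u s) + a s * r := by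
    intro s hs
    have h1 : W s (û s) = W s (u s) + W s (û s - u s) := by simp
    rw [h1]
    gcongr
    refine (le_abs_self _).trans (((W s).le_opNorm _).trans ?_)
    exact mul_le_mul (hYa s hs _).2 (hclose s hs) (norm_nonneg _) (ha_nonneg s hs)
  have hgcont : Continuous fun s => g (‖ι (u s)‖ ^ 2) :=
    hg.continuousOn.comp_continuous ((ι.continuous.comp huc).norm.pow 2) fun s => by
      simp only [mem_Ici]; positivity
  -- Coercivity, without its negative term, survives truncation: where `W s` is zero the right-hand
  -- side is still nonnegative.
  have hcoerW : ∀ s ∈ Icc 0 S, 2 * W s (u s) ≤ g (‖ι (u s)‖ ^ 2) + f s := by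
    intro s hs
    have h0 : 0 ≤ g (‖ι (u s)‖ ^ 2) := hg.nonneg _ (by positivity)
    have h1 := hf_nonneg s (hsubT hs)
    by_cases hus : ‖u s‖ ≤ R
    · simp only [hW, hY, hs, hus, and_self, if_true]
      have h2 := hcoer s (hsubT hs) (u s)
      have : 0 ≤ δ * ‖u s‖ ^ α := by positivity
      linarith
    · simp only [hW, hY, hus, and_false, if_false, zero_apply]
      linarith
  set K := ‖u₀‖ ^ 2 + ∫ t in (0 : ℝ)..S, f t with hK
  have hK0 : 0 ≤ K := by
    have := intervalIntegral.integral_nonneg (μ := volume) hS0 fun t ht => hf_nonneg t (hsubT ht)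
    positivity
  -- A nondecreasing majorant of the squared norm. By monotonicity it also dominates the delayed
  -- curve, so its derivative is at most `g (z t)` and Bihari's bound applies despite the delay.
  set z : ℝ → ℝ := fun t => K + ε₁ + ∫ s in (0 : ℝ)..t, g (‖ι (u s)‖ ^ 2) with hz
  have hzmono : ∀ s t, s ≤ t → z s ≤ z t := by
    intro s t hst
    have h1 : z t - z s = ∫ x in s..t, g (‖ι (u x)‖ ^ 2) := by
      simp only [hz, add_sub_add_left_eq_sub]
      exact intervalIntegral.integral_interval_sub_left (hgcont.intervalIntegrable _ _)
        (hgcont.intervalIntegrable _ _)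
    have h2 : 0 ≤ ∫ x in s..t, g (‖ι (u x)‖ ^ 2) :=
      intervalIntegral.integral_nonneg hst fun x _ => hg.nonneg _ (by positivity)
    linarith
  have hz0 : z 0 = K + ε₁ := by simp [hz]
  have hûz : ∀ t ∈ Icc 0 S, ‖ι (û t)‖ ^ 2 ≤ z t := by
    intro t ht
    rw [henergy t ht]
    have i1 := IntegrableOn.intervalIntegrable_of_subset hWû hzero ht
    have i2 := hgcont.intervalIntegrable (μ := volume) 0 t
    have i3 := IntegrableOn.intervalIntegrable_of_subset hfS hzero ht
    have i4 := (IntegrableOn.intervalIntegrable_of_subset hai hzero ht).mul_const r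
    have h1 : ∫ s in (0 : ℝ)..t, 2 * W s (û s) ≤
        ∫ s in (0 : ℝ)..t, (g (‖ι (u s)‖ ^ 2) + f s + 2 * (a s * r)) := by
      refine intervalIntegral.integral_mono_on ht.1 (i1.const_mul 2)
        ((i2.add i3).add (i4.const_mul 2)) fun s hs => ?_
      have hs' : s ∈ Icc 0 S := ⟨hs.1, hs.2.trans ht.2⟩
      have := hpair s hs'
      have := hcoerW s hs'
      linarith
    rw [intervalIntegral.integral_add (i2.add i3) (i4.const_mul 2),
      intervalIntegral.integral_add i2 i3, intervalIntegral.integral_const_mul,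
      intervalIntegral.integral_const_mul] at h1
    have h2 : ∫ s in (0 : ℝ)..t, f s ≤ ∫ s in (0 : ℝ)..S, f s := by
      refine intervalIntegral.integral_mono_interval le_rfl ht.1 ht.2 ?_
        (IntegrableOn.intervalIntegrable_of_subset hfS hzero (by simp [hS0]))
      filter_upwards [ae_restrict_mem measurableSet_Ioc] with s hs
      exact hf_nonneg s (hsubT (Ioc_subset_Icc_self hs))
    have h3 := herr t ht
    have h4 : ‖ι (û 0)‖ ^ 2 ≤ ‖u₀‖ ^ 2 := by gcongr
    simp only [hz, hK]
    linarith
  have huz : ∀ t ∈ Icc 0 S, ‖ι (u t)‖ ^ 2 ≤ z t := fun t ht =>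
    (hûz _ (hmemh t ht)).trans (hzmono _ _ (max_le (by linarith) ht.1))
  have hzd : ∀ t, HasDerivAt z (g (‖ι (u t)‖ ^ 2)) t := fun t =>
    (intervalIntegral.integral_hasDerivAt_right (hgcont.intervalIntegrable _ _)
      (hgcont.stronglyMeasurableAtFilter _ _) hgcont.continuousAt).const_add _
  have hzM : ∀ t ∈ Icc 0 S, z t ≤ M := by
    refine hM z (fun t => g (‖ι (u t)‖ ^ 2)) ?_ ?_ ?_ ?_
    · rw [hz0]; gcongr; exact min_le_right _ _
    · exact fun t _ => (hzd t).continuousAt.continuousWithinAt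
    · intro t ht
      have ht' : t ∈ Icc 0 S := ⟨ht.1.le, ht.2.le⟩
      have h1 : 0 ≤ ‖ι (u t)‖ ^ 2 := by positivity
      exact ⟨hzd t, hg.monotoneOn h1 (h1.trans (huz t ht')) (huz t ht')⟩
    · exact fun t ht => (by positivity : (0 : ℝ) ≤ ‖ι (û t)‖ ^ 2).trans (hûz t ht)
  -- The bound by `M` shows that the truncation never acted.
  have hWA : ∀ s ∈ Icc 0 S, W s = A s (u s) := by
    intro s hs
    have h1 : ‖u s‖ ≤ R := hFR _ (hûF _ (hmemh s hs)) ((huz s hs).trans (hzM s hs))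
    simp only [hW, hY, hs, h1, and_self, if_true]
  refine ⟨u, û, huc, hûc, fun t ht v hv => ?_, hû_init, fun t ht =>
    ⟨(hûz t ht).trans (hzM t ht), (huz t ht).trans (hzM t ht), (hclose t ht).trans
      ((min_le_left _ _).trans (min_le_left _ _)), ?_⟩⟩
  · rw [hweak t ht v hv]
    congr 1
    refine intervalIntegral.integral_congr fun s hs => ?_
    rw [uIcc_of_le ht.1] at hs
    simp only [hWA s ⟨hs.1, hs.2.trans ht.2⟩]
  · have h1 : ∫ s in (0 : ℝ)..t, A s (u s) (u s) = ∫ s in (0 : ℝ)..t, W s (u s) := by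
      refine intervalIntegral.integral_congr fun s hs => ?_
      rw [uIcc_of_le ht.1] at hs
      simp only [hWA s ⟨hs.1, hs.2.trans ht.2⟩]
    rw [henergy t ht, h1]
    have i1 := IntegrableOn.intervalIntegrable_of_subset hWû hzero ht
    have i2 := IntegrableOn.intervalIntegrable_of_subset hWu hzero ht
    have i4 := (IntegrableOn.intervalIntegrable_of_subset hai hzero ht).mul_const r
    have h2 : ∫ s in (0 : ℝ)..t, W s (û s) ≤ ∫ s in (0 : ℝ)..t, (W s (u s) + a s * r) :=
      intervalIntegral.integral_mono_on ht.1 i1 (i2.add i4) fun s hs =>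
        hpair s ⟨hs.1, hs.2.trans ht.2⟩
    rw [intervalIntegral.integral_add i2 i4] at h2
    have h3 := herr t ht
    have h4 : ε₁ ≤ ε := min_le_left _ _
    linarith

end Growth

end GelfandEvolution

namespace GelfandEvolution

open Filter TopologicalSpace

/-! ### Separability and weak limits in a Gelfand triple -/

section Duality

lemma dense_submodule_of_forall_dual {E : Type*} [NormedAddCommGroup E] [NormedSpace ℝ E]
    (M : Submodule ℝ E) (h : ∀ y : StrongDual ℝ E, (∀ x ∈ M, y x = 0) → y = 0) :
    Dense (M : Set E) := by
  rw [Submodule.dense_iff_topologicalClosure_eq_top, Submodule.eq_top_iff']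
  intro x
  by_contra hx
  obtain ⟨y, r, hy, hyx⟩ := geometric_hahn_banach_closed_point
    (s := (M.topologicalClosure : Set E)) M.topologicalClosure.convex
    M.isClosed_topologicalClosure hx
  have hr : 0 < r := by simpa using hy 0 M.topologicalClosure.zero_mem
  have hzero : ∀ z ∈ M.topologicalClosure, y z = 0 := by
    intro z hz
    by_contra hne
    have := hy _ (M.topologicalClosure.smul_mem (r / y z) hz)
    rw [map_smul, smul_eq_mul, div_mul_cancel₀ _ hne] at this
    exact lt_irrefl _ this
  have h0 := h y fun z hz => hzero z (M.le_topologicalClosure hz)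
  rw [h0] at hyx
  simp only [zero_apply] at hyx
  linarith

/-- A normed space with separable dual is separable. -/
lemma separableSpace_of_dual {V : Type*} [NormedAddCommGroup V] [NormedSpace ℝ V]
    [SeparableSpace (StrongDual ℝ V)] : SeparableSpace V := by
  -- Unit-ball vectors that norm a dense sequence of functionals up to a factor of two; a functional
  -- vanishing on all of them is zero, so their span is dense.
  have hex : ∀ j : ℕ, ∃ v : V, ‖v‖ ≤ 1 ∧
      ‖denseSeq (StrongDual ℝ V) j‖ ≤ 2 * |denseSeq (StrongDual ℝ V) j v| := by
    intro j
    set y := denseSeq (StrongDual ℝ V) j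
    rcases (norm_nonneg y).eq_or_lt with h | h
    · exact ⟨0, by simp, by simp [← h]⟩
    · obtain ⟨v, hv, hyv⟩ := y.exists_lt_apply_of_lt_opNorm (half_lt_self h)
      rw [Real.norm_eq_abs] at hyv
      exact ⟨v, hv.le, by linarith⟩
  choose v hv hyv using hex
  have hdense : Dense (Submodule.span ℝ (range v) : Set V) := by
    refine dense_submodule_of_forall_dual _ fun y hy => ?_
    have hyv0 : ∀ j, y (v j) = 0 := fun j => hy _ (Submodule.subset_span (mem_range_self j))
    have hle : ∀ ε > 0, ‖y‖ ≤ 0 + ε := by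
      intro ε hε
      obtain ⟨j, hj⟩ := (denseRange_denseSeq (StrongDual ℝ V)).exists_dist_lt y
        (ε := ε / 3) (by positivity)
      rw [dist_eq_norm] at hj
      set z := denseSeq (StrongDual ℝ V) j with hz
      have h1 : |z (v j)| ≤ ‖y - z‖ := by
        have h2 : z (v j) = -((y - z) (v j)) := by simp [hyv0 j]
        rw [h2, abs_neg]
        exact ((y - z).le_opNorm _).trans (mul_le_of_le_one_right (norm_nonneg _) (hv j))
      have h2 : ‖y‖ ≤ ‖y - z‖ + ‖z‖ := by simpa using norm_add_le (y - z) z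
      have h3 : ‖z‖ ≤ 2 * |z (v j)| := hyv j
      linarith
    exact norm_eq_zero.1 (le_antisymm (le_of_forall_pos_le_add hle) (norm_nonneg _))
  have hsep : IsSeparable (Submodule.span ℝ (range v) : Set V) :=
    (countable_range v).isSeparable.span
  have := hsep.closure
  rw [hdense.closure_eq] at this
  exact isSeparable_univ_iff.1 this

variable {V H : Type*} [NormedAddCommGroup V] [NormedSpace ℝ V]
  [NormedAddCommGroup H] [InnerProductSpace ℝ H] {ι : V →L[ℝ] H}

/-- By reflexivity a functional on the dual that kills the image of `H` is evaluation at some `v`;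
testing against `ι v` itself gives `ι v = 0`. -/
lemma IsGelfandTriple.denseRange_toDualL (hι : IsGelfandTriple ι) :
    DenseRange (toDualL ι) := by
  have := dense_submodule_of_forall_dual (LinearMap.range (toDualL ι : H →ₗ[ℝ] StrongDual ℝ V))
    fun y hy => by
      obtain ⟨v, rfl⟩ := hι.reflexive y
      have h1 : inner ℝ (ι v) (ι v) = 0 := hy _ ⟨ι v, rfl⟩
      have h2 : ι v = ι 0 := by rw [map_zero]; exact inner_self_eq_zero.1 h1
      rw [hι.injective h2, map_zero]
  exact this

lemma IsGelfandTriple.separableSpace [SeparableSpace H] (hι : IsGelfandTriple ι) :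
    SeparableSpace V := by
  have : SeparableSpace (StrongDual ℝ V) :=
    hι.denseRange_toDualL.separableSpace (toDualL ι).continuous
  exact separableSpace_of_dual

lemma tendsto_clm_of_dense {κ : Type*} {l : Filter κ} {E : Type*} [NormedAddCommGroup E]
    [NormedSpace ℝ E] {X : Type*} {D : X → E} (hD : DenseRange D) {b : κ → StrongDual ℝ E}
    {B : StrongDual ℝ E} {R : ℝ} (hR : ∀ᶠ k in l, ‖b k‖ ≤ R)
    (hb : ∀ j, Tendsto (fun k => b k (D j)) l (𝓝 (B (D j)))) (y : E) :
    Tendsto (fun k => b k y) l (𝓝 (B y)) := by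
  rw [Metric.tendsto_nhds]
  intro ε hε
  set R' := max R 0 + ‖B‖ + 1 with hR'
  have hR'pos : 0 < R' := by positivity
  obtain ⟨j, hj⟩ := hD.exists_dist_lt y (ε := ε / (4 * R')) (by positivity)
  rw [dist_eq_norm] at hj
  have h1 := Metric.tendsto_nhds.1 (hb j) (ε / 2) (by positivity)
  have hbd : ∀ z : StrongDual ℝ E, ‖z‖ ≤ R' → |z (y - D j)| ≤ ε / 4 := fun z hz => by
    calc |z (y - D j)| ≤ ‖z‖ * ‖y - D j‖ := z.le_opNorm _
      _ ≤ R' * (ε / (4 * R')) := by gcongr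
      _ = ε / 4 := by field_simp
  filter_upwards [h1, hR] with k hk hkR
  rw [Real.dist_eq] at hk ⊢
  have h2 := hbd (b k) (by have := le_max_left R 0; have := norm_nonneg B; linarith)
  have h3 := hbd B (by have := le_max_right R 0; linarith)
  rw [map_sub] at h2 h3
  rw [abs_lt] at hk ⊢
  rw [abs_le] at h2 h3
  constructor <;> linarith [hk.1, hk.2, h2.1, h2.2, h3.1, h3.2]

/-- In a Gelfand triple, a `V`-bounded family that converges weakly in `H` converges weakly in
`V`. -/
lemma IsGelfandTriple.exists_weak_limit (hι : IsGelfandTriple ι) {κ : Type*} {l : Filter κ}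
    [l.NeBot] {v : κ → V} {R : ℝ} (hR : ∀ᶠ k in l, ‖v k‖ ≤ R) {x : H}
    (hx : ∀ h, Tendsto (fun k => inner ℝ (ι (v k)) h) l (𝓝 (inner ℝ x h))) :
    ∃ a, ι a = x ∧ ‖a‖ ≤ R ∧ ∀ y : StrongDual ℝ V, Tendsto (fun k => y (v k)) l (𝓝 (y a)) := by
  have hR0 : 0 ≤ R := by
    obtain ⟨k, hk⟩ := hR.exists
    exact (norm_nonneg _).trans hk
  -- Along an ultrafilter the bounded numbers `y (v k)` converge for all `y` simultaneously, so
  -- their limits depend linearly on `y` and reflexivity represents them by a vector `a`.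
  -- Convergence along `l` itself then follows by density of `H` in the dual.
  set U := Ultrafilter.of l
  have hUl : (U : Filter κ) ≤ l := Ultrafilter.of_le l
  have hex : ∀ y : StrongDual ℝ V, ∃ r : ℝ, Tendsto (fun k => y (v k)) U (𝓝 r) := by
    intro y
    have hmem : ∀ᶠ k in (U : Filter κ), y (v k) ∈ Metric.closedBall (0 : ℝ) (‖y‖ * R) := by
      filter_upwards [hUl hR] with k hk
      rw [mem_closedBall_zero_iff]
      exact (y.le_opNorm _).trans (by gcongr)
    obtain ⟨r, -, hr⟩ := (isCompact_closedBall (0 : ℝ) (‖y‖ * R)).ultrafilter_le_nhds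
      (U.map fun k => y (v k)) (le_principal_iff.2 hmem)
    exact ⟨r, hr⟩
  choose Λ hΛ using hex
  have hbound : ∀ y, ‖Λ y‖ ≤ R * ‖y‖ := fun y => by
    refine le_of_tendsto (hΛ y).norm ?_
    filter_upwards [hUl hR] with k hk
    exact (y.le_opNorm _).trans (by rw [mul_comm]; gcongr)
  set L : StrongDual ℝ (StrongDual ℝ V) := LinearMap.mkContinuous
    { toFun := Λ
      map_add' := fun y z => tendsto_nhds_unique (hΛ (y + z)) ((hΛ y).add (hΛ z))
      map_smul' := fun r y => tendsto_nhds_unique (hΛ (r • y)) ((hΛ y).const_mul r) } R hbound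
    with hL
  obtain ⟨a, ha⟩ := hι.reflexive L
  have haΛ : ∀ y : StrongDual ℝ V, y a = Λ y := fun y => by
    exact congrArg (fun z : StrongDual ℝ (StrongDual ℝ V) => z y) ha
  have hax : ι a = x := by
    refine ext_inner_right ℝ fun h => ?_
    have h1 := haΛ (toDual ι h)
    rw [toDual_apply, real_inner_comm] at h1
    rw [h1]
    refine tendsto_nhds_unique (hΛ (toDual ι h)) ?_
    simp only [toDual_apply]
    have := (hx h).mono_left hUl
    simpa only [real_inner_comm h] using this
  refine ⟨a, hax, ?_, ?_⟩
  · refine NormedSpace.norm_le_dual_bound ℝ a hR0 fun y => ?_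
    rw [haΛ]; exact hbound y
  · refine tendsto_clm_of_dense hι.denseRange_toDualL
      (b := fun k => NormedSpace.inclusionInDoubleDual ℝ V (v k))
      (B := NormedSpace.inclusionInDoubleDual ℝ V a)
      (hR.mono fun k hk => (NormedSpace.double_dual_bound ℝ V (v k)).trans hk) fun h => ?_
    simp only [NormedSpace.dual_def, toDualL_apply, toDual_apply, hax]
    simpa only [real_inner_comm h] using hx h

/-- The images stay in a compact set, and weak convergence leaves `x` as the only possible cluster
point. -/
lemma tendsto_of_isCompactOperator (hc : IsCompactOperator ι) {κ : Type*} {l : Filter κ}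
    {v : κ → V} {R : ℝ} (hR : ∀ᶠ k in l, ‖v k‖ ≤ R) {x : H}
    (hx : ∀ h, Tendsto (fun k => inner ℝ (ι (v k)) h) l (𝓝 (inner ℝ x h))) :
    Tendsto (fun k => ι (v k)) l (𝓝 x) := by
  have hK : IsCompact (closure (ι '' Metric.closedBall 0 R)) :=
    IsCompactOperator.isCompact_closure_image_closedBall (f := (ι : V →ₗ[ℝ] H)) hc R
  refine hK.tendsto_nhds_of_unique_mapClusterPt ?_ fun z _ hz => ?_
  · filter_upwards [hR] with k hk
    exact subset_closure ⟨v k, by simpa using hk, rfl⟩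
  · refine ext_inner_right ℝ fun h => ?_
    have h1 : MapClusterPt (inner ℝ z h) l fun k => inner ℝ (ι (v k)) h :=
      hz.continuousAt_comp (f := fun w => inner ℝ w h)
        (Continuous.continuousAt (by fun_prop))
    have h2 : ClusterPt (inner ℝ z h) (𝓝 (inner ℝ x h)) := ClusterPt.mono h1 (hx h)
    exact eq_of_nhds_neBot h2

end Duality

/-! ### Weakly convergent subsequences of curves -/

section WeakExtraction

variable {H : Type*} [NormedAddCommGroup H] [InnerProductSpace ℝ H]

/-- Orthonormal vectors are at distance `√2`, so the balls of radius one half around them are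
disjoint. -/
lemma countable_of_orthonormal [SeparableSpace H] {κ : Type*} {b : κ → H}
    (hb : Orthonormal ℝ b) : Countable κ := by
  refine Pairwise.countable_of_isOpen_disjoint (s := fun i => Metric.ball (b i) (1 / 2)) ?_
    (fun _ => Metric.isOpen_ball) fun i => ⟨b i, by simp⟩
  intro i j hij
  refine Metric.ball_disjoint_ball ?_
  have h := norm_sub_sq_real (b i) (b j)
  rw [hb.1 i, hb.1 j, hb.2 hij] at h
  rw [dist_eq_norm]
  nlinarith [norm_nonneg (b i - b j)]

variable [CompleteSpace H]

lemma aestronglyMeasurable_of_inner [SeparableSpace H] {Ω : Type*} [MeasurableSpace Ω]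
    {μ : Measure Ω} {u : Ω → H} (hu : ∀ h, AEStronglyMeasurable (fun t => inner ℝ (u t) h) μ) :
    AEStronglyMeasurable u μ := by
  obtain ⟨w, b, -⟩ := exists_hilbertBasis ℝ H
  have : Countable w := countable_of_orthonormal b.orthonormal
  refine aestronglyMeasurable_of_tendsto_ae (atTop : Filter (Finset w))
    (f := fun s t => ∑ i ∈ s, inner ℝ (u t) (b i) • b i) (fun s => ?_)
    (Eventually.of_forall fun t => ?_)
  · exact Finset.aestronglyMeasurable_fun_sum s fun i _ => (hu (b i)).smul_const (b i)
  · have h := b.hasSum_repr (u t)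
    simp only [b.repr_apply_apply, real_inner_comm] at h
    exact h

/-- A bounded and weakly equicontinuous sequence of curves in a Hilbert space has a subsequence
that converges weakly at all times. -/
lemma exists_subseq_tendsto_inner {S R : ℝ} (hS : 0 ≤ S) {x : ℕ → ℝ → H}
    (hR : ∀ n, ∀ t ∈ Icc 0 S, ‖x n t‖ ≤ R) {D : ℕ → H} (hD : DenseRange D)
    (heq : ∀ j, ∀ ε > 0, ∃ d > 0, ∀ᶠ n in atTop, ∀ s ∈ Icc 0 S, ∀ t ∈ Icc 0 S, |s - t| < d →
      |inner ℝ (x n s - x n t) (D j)| ≤ ε) :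
    ∃ (φ : ℕ → ℕ) (u : ℝ → H), StrictMono φ ∧ ∀ t ∈ Icc 0 S, ‖u t‖ ≤ R ∧
      ∀ h, Tendsto (fun n => inner ℝ (x (φ n) t) h) atTop (𝓝 (inner ℝ (u t) h)) := by
  have hR0 : 0 ≤ R := (norm_nonneg _).trans (hR 0 0 (by simp [hS]))
  have : Nonempty (Icc 0 S) := ⟨⟨0, by simp [hS]⟩⟩
  set τ : ℕ → Icc 0 S := denseSeq (Icc 0 S)
  -- A countable product of compact intervals replaces the diagonal argument, giving convergence at
  -- a dense set of times against a dense set of vectors. Equicontinuity and boundedness extend it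
  -- to all times and vectors.
  obtain ⟨a, -, φ, hφ, hlim⟩ := (isCompact_univ_pi (ι := ℕ × ℕ)
      (s := fun q => Metric.closedBall (0 : ℝ) (R * ‖D q.2‖))
      (fun q => isCompact_closedBall _ _)).tendsto_subseq
      (x := fun n q => inner ℝ (x n (τ q.1)) (D q.2)) (fun n q _ => by
        rw [mem_closedBall_zero_iff]
        refine (norm_inner_le_norm _ _).trans ?_
        gcongr
        exact hR n _ (τ q.1).2)
  rw [tendsto_pi_nhds] at hlim
  have hcauchy : ∀ t ∈ Icc 0 S, ∀ h, CauchySeq fun n => inner ℝ (x (φ n) t) h := by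
    intro t ht h
    rw [Metric.cauchySeq_iff]
    intro ε hε
    obtain ⟨j, hj⟩ := hD.exists_dist_lt h (ε := ε / (8 * (R + 1))) (by positivity)
    rw [dist_eq_norm] at hj
    obtain ⟨d, hd, hdn⟩ := heq j (ε / 8) (by positivity)
    obtain ⟨i, hi⟩ := (denseRange_denseSeq (Icc 0 S)).exists_dist_lt ⟨t, ht⟩ hd
    rw [Subtype.dist_eq, Real.dist_eq] at hi
    obtain ⟨N₁, hN₁⟩ := eventually_atTop.1 (hφ.tendsto_atTop.eventually hdn)
    obtain ⟨N₂, hN₂⟩ := Metric.cauchySeq_iff.1 (hlim (i, j)).cauchySeq (ε / 4) (by positivity)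
    have key : ∀ n ≥ N₁, |inner ℝ (x (φ n) t) h - inner ℝ (x (φ n) (τ i)) (D j)| ≤ ε / 4 := by
      intro n hn
      have h1 := hN₁ n hn t ht (τ i) (τ i).2 hi
      have h2 : |inner ℝ (x (φ n) t) (h - D j)| ≤ ε / 8 := by
        refine (abs_real_inner_le_norm _ _).trans ?_
        calc _ ≤ (R + 1) * (ε / (8 * (R + 1))) := by
              gcongr
              linarith [hR (φ n) t ht]
          _ = ε / 8 := by field_simp
      rw [inner_sub_left] at h1
      rw [inner_sub_right] at h2
      rw [abs_le] at h1 h2 ⊢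
      constructor <;> linarith [h1.1, h1.2, h2.1, h2.2]
    refine ⟨max N₁ N₂, fun m hm n hn => ?_⟩
    have h1 := key m ((le_max_left _ _).trans hm)
    have h2 := key n ((le_max_left _ _).trans hn)
    have h3 := hN₂ m ((le_max_right _ _).trans hm) n ((le_max_right _ _).trans hn)
    rw [Real.dist_eq] at h3 ⊢
    simp only [Function.comp_apply] at h3
    rw [abs_le] at h1 h2
    rw [abs_lt] at h3 ⊢
    constructor <;> linarith [h1.1, h1.2, h2.1, h2.2, h3.1, h3.2]
  have hex : ∀ t ∈ Icc 0 S, ∃ z : H, ‖z‖ ≤ R ∧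
      ∀ h, Tendsto (fun n => inner ℝ (x (φ n) t) h) atTop (𝓝 (inner ℝ z h)) := by
    intro t ht
    choose Λ hΛ using fun h => cauchySeq_tendsto_of_complete (hcauchy t ht h)
    have hbound : ∀ h, ‖Λ h‖ ≤ R * ‖h‖ := fun h => by
      refine le_of_tendsto (hΛ h).norm (Eventually.of_forall fun n => ?_)
      refine (norm_inner_le_norm _ _).trans ?_
      gcongr
      exact hR _ t ht
    set L : StrongDual ℝ H := LinearMap.mkContinuous
      { toFun := Λ
        map_add' := fun y z => tendsto_nhds_unique (hΛ (y + z)) (by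
          simpa only [inner_add_right] using (hΛ y).add (hΛ z))
        map_smul' := fun r y => tendsto_nhds_unique (hΛ (r • y)) (by
          simpa only [inner_smul_right, smul_eq_mul, RingHom.id_apply] using
            (hΛ y).const_mul r) } R hbound with hL
    refine ⟨(InnerProductSpace.toDual ℝ H).symm L, ?_, fun h => ?_⟩
    · rw [LinearIsometryEquiv.norm_map]
      exact LinearMap.mkContinuous_norm_le _ hR0 _
    · rw [InnerProductSpace.toDual_symm_apply]
      exact hΛ h
  choose! u hu using hex
  exact ⟨φ, u, hφ, hu⟩

end WeakExtraction

end GelfandEvolution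

namespace GelfandEvolution

open Filter

/-! ### Minty's argument for locally monotone operators -/

section PseudoMonotone

variable {V H : Type*} [NormedAddCommGroup V] [NormedSpace ℝ V]
  [NormedAddCommGroup H] [InnerProductSpace ℝ H] {ι : V →L[ℝ] H}

/-- Local monotonicity moves the operator from `v k` to the fixed vector `w`. What remains is linear
in `v k`, or quadratic in its strongly convergent image in `H`, and so passes to the limit. -/
lemma eventually_apply_sub_le {B : V → StrongDual ℝ V} {ρ η : V → ℝ} {r : ℝ}
    (hB : ∀ v₁ v₂, (B v₁ - B v₂) (v₁ - v₂) ≤ (r + ρ v₁ + η v₂) * ‖ι (v₁ - v₂)‖ ^ 2)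
    {κ : Type*} {l : Filter κ} {v : κ → V} {a : V} {M : ℝ} (hM : ∀ᶠ k in l, ρ (v k) ≤ M)
    (hv : ∀ y : StrongDual ℝ V, Tendsto (fun k => y (v k)) l (𝓝 (y a)))
    (hιv : Tendsto (fun k => ι (v k)) l (𝓝 (ι a))) (w : V) {ε : ℝ} (hε : 0 < ε) :
    ∀ᶠ k in l, B (v k) (v k - w) ≤ B w (a - w) + (r + M + η w) * ‖ι (a - w)‖ ^ 2 + ε := by
  have h1 : Tendsto (fun k => B w (v k - w) + (r + M + η w) * ‖ι (v k - w)‖ ^ 2) l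
      (𝓝 (B w (a - w) + (r + M + η w) * ‖ι (a - w)‖ ^ 2)) := by
    simp only [map_sub]
    exact ((hv (B w)).sub tendsto_const_nhds).add
      (((hιv.sub tendsto_const_nhds).norm.pow 2).const_mul _)
  filter_upwards [h1.eventually (gt_mem_nhds (lt_add_of_pos_right _ hε)), hM] with k hk hkM
  have h2 := hB (v k) w
  rw [sub_apply] at h2
  have h3 : (r + ρ (v k) + η w) * ‖ι (v k - w)‖ ^ 2 ≤ (r + M + η w) * ‖ι (v k - w)‖ ^ 2 := by
    gcongr
  linarith

/-- Pseudomonotonicity, by Minty's argument. -/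
lemma tendsto_apply_of_tendsto_apply_sub {B : V → StrongDual ℝ V} {ρ η : V → ℝ} {r : ℝ}
    (hB : ∀ v₁ v₂, (B v₁ - B v₂) (v₁ - v₂) ≤ (r + ρ v₁ + η v₂) * ‖ι (v₁ - v₂)‖ ^ 2)
    (hη : ∀ R, ∃ M, ∀ v, ‖v‖ ≤ R → η v ≤ M)
    (hhemi : ∀ v₁ v₂ v, Continuous fun s : ℝ => B (v₁ + s • v₂) v)
    {κ : Type*} {l : Filter κ} {v : κ → V} {a : V} {M : ℝ} (hM : ∀ᶠ k in l, ρ (v k) ≤ M)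
    (hv : ∀ y : StrongDual ℝ V, Tendsto (fun k => y (v k)) l (𝓝 (y a)))
    (hιv : Tendsto (fun k => ι (v k)) l (𝓝 (ι a)))
    (h0 : Tendsto (fun k => B (v k) (v k - a)) l (𝓝 0)) (z : V) :
    Tendsto (fun k => B (v k) z) l (𝓝 (B a z)) := by
  -- An upper bound suffices, since it is used for both `z` and `-z`.
  have key : ∀ z, ∀ ε > 0, ∀ᶠ k in l, B (v k) z ≤ B a z + ε := by
    intro z ε hε
    obtain ⟨Mη, hMη⟩ := hη (‖a‖ + ‖z‖)
    set c := |r + M + Mη| with hc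
    have hs1 : ∀ᶠ s in 𝓝[>] (0 : ℝ), B (a + s • (-z)) z < B a z + ε / 3 := by
      have h1 := ((hhemi a (-z) z).tendsto 0).mono_left (nhdsWithin_le_nhds (s := Ioi 0))
      simp only [zero_smul, add_zero] at h1
      exact h1.eventually (gt_mem_nhds (by linarith))
    have hs2 : ∀ᶠ s in 𝓝[>] (0 : ℝ), c * s * ‖ι z‖ ^ 2 < ε / 3 := by
      have h1 : Tendsto (fun s : ℝ => c * s * ‖ι z‖ ^ 2) (𝓝[>] 0) (𝓝 (c * 0 * ‖ι z‖ ^ 2)) :=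
        (Continuous.tendsto (by fun_prop) 0).mono_left nhdsWithin_le_nhds
      exact h1.eventually (gt_mem_nhds (by simpa using by positivity))
    have hs3 : ∀ᶠ s in 𝓝[>] (0 : ℝ), s < 1 :=
      mem_nhdsWithin_of_mem_nhds (gt_mem_nhds one_pos)
    obtain ⟨s, h1, h2, h3, hs⟩ :=
      (hs1.and (hs2.and (hs3.and self_mem_nhdsWithin))).exists
    have hs : 0 < s := hs
    -- Competing with `a - s z` and dividing by `s` leaves a monotonicity error of order `s`,
    -- because that error is quadratic. As `s < 1`, the competitor stays in a fixed ball, where `η`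
    -- is bounded; hemicontinuity sends `B w z` to `B a z`.
    set w := a + s • (-z) with hw
    have hwn : ‖w‖ ≤ ‖a‖ + ‖z‖ := by
      refine (norm_add_le _ _).trans ?_
      rw [norm_smul, norm_neg, Real.norm_of_nonneg hs.le]
      have := mul_le_of_le_one_left (norm_nonneg z) h3.le
      linarith
    have haw : a - w = s • z := by rw [hw]; simp
    filter_upwards [eventually_apply_sub_le hB hM hv hιv w (ε := s * (ε / 6)) (by positivity),
      h0.eventually (lt_mem_nhds (show -(s * (ε / 6)) < 0 by
        have : 0 < s * (ε / 6) := by positivity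
        linarith))] with k hk hk0
    have h4 : v k - w = (v k - a) + s • z := by rw [← haw]; abel
    rw [haw, h4, map_add, map_smul, map_smul, map_smul, norm_smul, Real.norm_of_nonneg hs.le,
      mul_pow, smul_eq_mul, smul_eq_mul] at hk
    have h5 : (r + M + η w) * (s ^ 2 * ‖ι z‖ ^ 2) ≤ s * (c * s * ‖ι z‖ ^ 2) := by
      have : r + M + η w ≤ c := by
        have := hMη w hwn
        have := le_abs_self (r + M + Mη)
        linarith
      calc _ ≤ c * (s ^ 2 * ‖ι z‖ ^ 2) := by gcongr
        _ = _ := by ring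
    have h6 : s * (c * s * ‖ι z‖ ^ 2) ≤ s * (ε / 3) := by gcongr
    have h7 : s * B w z ≤ s * (B a z + ε / 3) := by gcongr
    have h8 : s * B (v k) z ≤ s * (B a z + ε) := by linarith
    exact le_of_mul_le_mul_left h8 hs
  rw [Metric.tendsto_nhds]
  intro ε hε
  filter_upwards [key z (ε / 2) (by positivity), key (-z) (ε / 2) (by positivity)] with k h1 h2
  rw [map_neg, map_neg] at h2
  rw [Real.dist_eq, abs_lt]
  constructor <;> linarith

end PseudoMonotone

/-! ### Passing to the limit under the integral -/

section MeasureLemmas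

variable {Ω : Type*} [MeasurableSpace Ω] {μ : Measure Ω}

/-- Positive parts vanish in the mean by dominated convergence. Since `|x| = 2 x⁺ - x`, the lower
bound on the integrals then forces convergence in `L¹`, hence almost everywhere along a subsequence.
-/
lemma exists_subseq_tendsto_zero {x : ℕ → Ω → ℝ} (hx : ∀ n, Integrable (x n) μ) {k : Ω → ℝ}
    (hk : Integrable k μ) (hk0 : ∀ᵐ t ∂μ, 0 ≤ k t) (hxk : ∀ n, ∀ᵐ t ∂μ, x n t ≤ k t)
    (hup : ∀ᵐ t ∂μ, ∀ ε > 0, ∀ᶠ n in atTop, x n t ≤ ε)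
    (hlow : ∀ ε > 0, ∀ᶠ n in atTop, -ε ≤ ∫ t, x n t ∂μ) :
    ∃ ψ : ℕ → ℕ, StrictMono ψ ∧ ∀ᵐ t ∂μ, Tendsto (fun n => x (ψ n) t) atTop (𝓝 0) := by
  have hpos : Tendsto (fun n => ∫ t, max (x n t) 0 ∂μ) atTop (𝓝 0) := by
    have h := tendsto_integral_of_dominated_convergence (μ := μ) (F := fun n t => max (x n t) 0)
      (f := fun _ => (0 : ℝ)) k (fun n => (hx n).pos_part.aestronglyMeasurable) hk
      (fun n => by
        filter_upwards [hxk n, hk0] with t h1 h2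
        rw [Real.norm_of_nonneg (le_max_right _ _)]
        exact max_le h1 h2) (by
        filter_upwards [hup] with t ht
        rw [Metric.tendsto_nhds]
        intro ε hε
        filter_upwards [ht (ε / 2) (by positivity)] with n hn
        rw [Real.dist_eq, sub_zero, abs_of_nonneg (le_max_right _ _)]
        exact max_lt (by linarith) hε)
    simpa using h
  have habs : Tendsto (fun n => ∫ t, ‖x n t‖ ∂μ) atTop (𝓝 0) := by
    rw [Metric.tendsto_nhds]
    intro ε hε
    filter_upwards [hpos.eventually (gt_mem_nhds (show (0 : ℝ) < ε / 4 by positivity)),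
      hlow (ε / 4) (by positivity)] with n h1 h2
    rw [Real.dist_eq, sub_zero, abs_of_nonneg (integral_nonneg fun t => norm_nonneg _)]
    have h3 : ∫ t, ‖x n t‖ ∂μ = 2 * (∫ t, max (x n t) 0 ∂μ) - ∫ t, x n t ∂μ := by
      rw [← integral_const_mul, ← integral_sub ((hx n).pos_part.const_mul 2) (hx n)]
      refine integral_congr_ae (Eventually.of_forall fun t => ?_)
      simp only [Real.norm_eq_abs]
      rcases le_total 0 (x n t) with h | h
      · rw [abs_of_nonneg h, max_eq_left h]; ring
      · rw [abs_of_nonpos h, max_eq_right h]; ring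
    rw [h3]
    linarith
  have hmeas : TendstoInMeasure μ x atTop (fun _ => (0 : ℝ)) := by
    refine tendstoInMeasure_of_tendsto_eLpNorm (p := 1) one_ne_zero
      (fun n => (hx n).aestronglyMeasurable) aestronglyMeasurable_const ?_
    have h1 : ∀ n, eLpNorm (x n - fun _ => (0 : ℝ)) 1 μ = ENNReal.ofReal (∫ t, ‖x n t‖ ∂μ) := by
      intro n
      rw [ofReal_integral_norm_eq_lintegral_enorm (hx n), eLpNorm_one_eq_lintegral_enorm]
      simp
    simp only [h1]
    simpa using ENNReal.tendsto_ofReal habs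
  exact hmeas.exists_seq_tendsto_ae

/-- Pointwise convergence together with an `L^p` bound, `p > 1`, allows to pass to the limit under
the integral. -/
lemma tendsto_integral_of_rpow_bound [IsFiniteMeasure μ] {α : ℝ} (hα : 1 < α) {y : ℕ → Ω → ℝ}
    {y₀ : Ω → ℝ} {b : ℕ → Ω → ℝ} {b₀ : Ω → ℝ}
    (hy : ∀ n, AEStronglyMeasurable (y n) μ) (hy₀ : AEStronglyMeasurable y₀ μ)
    (hb : ∀ n, Integrable (b n) μ) (hb₀ : Integrable b₀ μ)
    (hyb : ∀ n, ∀ᵐ t ∂μ, |y n t| ^ (α / (α - 1)) ≤ b n t)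
    (hyb₀ : ∀ᵐ t ∂μ, |y₀ t| ^ (α / (α - 1)) ≤ b₀ t) {c : ℝ} (hc : ∀ n, ∫ t, b n t ∂μ ≤ c)
    (hlim : ∀ᵐ t ∂μ, Tendsto (fun n => y n t) atTop (𝓝 (y₀ t))) :
    Tendsto (fun n => ∫ t, y n t ∂μ) atTop (𝓝 (∫ t, y₀ t ∂μ)) := by
  have hint : ∀ {z d : Ω → ℝ}, AEStronglyMeasurable z μ → Integrable d μ →
      (∀ᵐ t ∂μ, |z t| ^ (α / (α - 1)) ≤ d t) → Integrable z μ := by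
    intro z d hz hd hzd
    obtain ⟨K, hK, hyoung⟩ := exists_young hα one_pos
    refine (hd.add (integrable_const K)).mono' hz ?_
    filter_upwards [hzd] with t ht
    have := hyoung |z t| 1 (abs_nonneg _) zero_le_one
    rw [mul_one, Real.one_rpow, one_mul, mul_one] at this
    simp only [Real.norm_eq_abs, Pi.add_apply]
    linarith
  -- Clipped functions converge by dominated convergence. Young's inequality with a small weight `r`
  -- gives `|x| - K ≤ r * |x| ^ p`, `p` the conjugate exponent, so the clipped-off part is uniformly
  -- small in the mean.
  set clip : ℝ → ℝ → ℝ := fun K x => max (-K) (min x K) with hclip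
  have hclipc : ∀ K, Continuous (clip K) := fun K => by simp only [hclip]; fun_prop
  have hclipb : ∀ K, 0 ≤ K → ∀ x, ‖clip K x‖ ≤ K := fun K hK x => by
    rw [Real.norm_eq_abs, abs_le]
    exact ⟨le_max_left _ _, max_le (by linarith) (min_le_right _ _)⟩
  have hdiff : ∀ K, 0 ≤ K → ∀ x, |x - clip K x| ≤ max (|x| - K) 0 := by
    intro K hK x
    simp only [hclip]
    rcases le_total x K with h1 | h1
    · rw [min_eq_left h1]
      rcases le_total (-K) x with h2 | h2
      · rw [max_eq_right h2]; simp
      · rw [max_eq_left h2, abs_of_nonpos (by linarith : x ≤ 0),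
          abs_of_nonpos (by linarith : x - -K ≤ 0)]
        exact (by linarith : -(x - -K) = -x - K) ▸ le_max_left _ _
    · rw [min_eq_right h1, max_eq_right (by linarith), abs_of_nonneg (by linarith : 0 ≤ x),
        abs_of_nonneg (by linarith : 0 ≤ x - K)]
      exact le_max_left _ _
  have hbase : ∀ {z d : Ω → ℝ} {r K : ℝ}, 0 < r → 0 ≤ K → AEStronglyMeasurable z μ →
      Integrable d μ → (∀ᵐ t ∂μ, |z t| ^ (α / (α - 1)) ≤ d t) →
      (∀ a : ℝ, 0 ≤ a → a ≤ r * a ^ (α / (α - 1)) + K) →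
      |(∫ t, z t ∂μ) - ∫ t, clip K (z t) ∂μ| ≤ r * ∫ t, d t ∂μ := by
    intro z d r K hr hK hz hd hzd hyoung
    have hzi := hint hz hd hzd
    have hci : Integrable (fun t => clip K (z t)) μ :=
      (integrable_const K).mono' ((hclipc K).comp_aestronglyMeasurable hz)
        (Eventually.of_forall fun t => hclipb K hK _)
    rw [← integral_sub hzi hci, ← integral_const_mul, ← Real.norm_eq_abs]
    refine norm_integral_le_of_norm_le (hd.const_mul r) ?_
    filter_upwards [hzd] with t ht
    rw [Real.norm_eq_abs]
    refine (hdiff K hK _).trans (max_le ?_ ?_)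
    · have := hyoung _ (abs_nonneg (z t))
      have : r * |z t| ^ (α / (α - 1)) ≤ r * d t := by gcongr
      linarith
    · have : 0 ≤ d t := le_trans (by positivity) ht
      positivity
  rw [Metric.tendsto_nhds]
  intro ε hε
  set c' := max c (∫ t, b₀ t ∂μ) with hc'
  have hc0 : 0 ≤ c' := (integral_nonneg_of_ae (by
    filter_upwards [hyb₀] with t ht
    exact le_trans (by positivity) ht)).trans (le_max_right _ _)
  obtain ⟨K, hK, hyoung⟩ := exists_young hα (r := ε / (4 * (c' + 1))) (by positivity)
  have hyoung' : ∀ a : ℝ, 0 ≤ a → a ≤ ε / (4 * (c' + 1)) * a ^ (α / (α - 1)) + K := fun a ha => by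
    simpa using hyoung a 1 ha zero_le_one
  have hconv : Tendsto (fun n => ∫ t, clip K (y n t) ∂μ) atTop (𝓝 (∫ t, clip K (y₀ t) ∂μ)) := by
    refine tendsto_integral_of_dominated_convergence (fun _ => K)
      (fun n => (hclipc K).comp_aestronglyMeasurable (hy n)) (integrable_const K)
      (fun n => Eventually.of_forall fun t => hclipb K hK _) ?_
    filter_upwards [hlim] with t ht
    exact ((hclipc K).tendsto _).comp ht
  have hsmall : ∀ x ≤ c', ε / (4 * (c' + 1)) * x ≤ ε / 4 := fun x hx => by
    calc _ ≤ ε / (4 * (c' + 1)) * (c' + 1) := by gcongr; linarith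
      _ = ε / 4 := by field_simp
  filter_upwards [Metric.tendsto_nhds.1 hconv (ε / 4) (by positivity)] with n hn
  have h1 := (hbase (by positivity) hK (hy n) (hb n) (hyb n) hyoung').trans
    (hsmall _ ((hc n).trans (le_max_left _ _)))
  have h2 := (hbase (by positivity) hK hy₀ hb₀ hyb₀ hyoung').trans (hsmall _ (le_max_right _ _))
  rw [Real.dist_eq] at hn ⊢
  rw [abs_le] at h1 h2
  rw [abs_lt] at hn ⊢
  constructor <;> linarith [hn.1, hn.2, h1.1, h1.2, h2.1, h2.2]

end MeasureLemmas

end GelfandEvolution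

namespace GelfandEvolution

open Filter TopologicalSpace

/-! ### Identification of the limit -/

section Limit

variable {V H : Type*} [NormedAddCommGroup V] [NormedSpace ℝ V]
  [NormedAddCommGroup H] [InnerProductSpace ℝ H]
  {ι : V →L[ℝ] H} {T α β δ C : ℝ} {A : ℝ → V → StrongDual ℝ V} {f g : ℝ → ℝ} {ρ η : V → ℝ}

/-- For each level above the lower limit, infinitely many terms lie in a `V`-ball, whose weak limit
obeys the same bound. Injectivity of `ι` makes the limits at different levels coincide. -/
lemma IsGelfandTriple.exists_limit_le_liminf (hι : IsGelfandTriple ι) (hα : 1 < α) {v : ℕ → V}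
    {x : H} (hx : ∀ h, Tendsto (fun n => inner ℝ (ι (v n)) h) atTop (𝓝 (inner ℝ x h)))
    (hfin : liminf (fun n => ENNReal.ofReal (‖v n‖ ^ α)) atTop < ⊤) :
    ∃ a, ι a = x ∧
      ENNReal.ofReal (‖a‖ ^ α) ≤ liminf (fun n => ENNReal.ofReal (‖v n‖ ^ α)) atTop := by
  have hα0 : 0 < α := by linarith
  set L := liminf (fun n => ENNReal.ofReal (‖v n‖ ^ α)) atTop with hL
  have key : ∀ q : ℝ≥0∞, L < q → q < ⊤ → ∃ a, ι a = x ∧ ENNReal.ofReal (‖a‖ ^ α) ≤ q := by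
    intro q hLq hq
    have hfreq : ∃ᶠ n in atTop, ENNReal.ofReal (‖v n‖ ^ α) < q := frequently_lt_of_liminf_lt
      (by isBoundedDefault) hLq
    set s := {n | ENNReal.ofReal (‖v n‖ ^ α) < q} with hs
    have : (atTop ⊓ 𝓟 s).NeBot := frequently_mem_iff_neBot.1 hfreq
    have hmem : ∀ᶠ n in atTop ⊓ 𝓟 s, ‖v n‖ ≤ q.toReal ^ α⁻¹ := by
      refine eventually_inf_principal.2 (Eventually.of_forall fun n hn => ?_)
      have h1 : ‖v n‖ ^ α ≤ q.toReal := (ENNReal.ofReal_le_iff_le_toReal hq.ne).1 (le_of_lt hn)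
      calc ‖v n‖ = (‖v n‖ ^ α) ^ α⁻¹ := (Real.rpow_rpow_inv (norm_nonneg _) hα0.ne').symm
        _ ≤ _ := by gcongr
    obtain ⟨a, ha, han, -⟩ := hι.exists_weak_limit hmem fun h => (hx h).mono_left inf_le_left
    refine ⟨a, ha, (ENNReal.ofReal_le_iff_le_toReal hq.ne).2 ?_⟩
    calc ‖a‖ ^ α ≤ (q.toReal ^ α⁻¹) ^ α := by gcongr
      _ = q.toReal := Real.rpow_inv_rpow ENNReal.toReal_nonneg hα0.ne'
  obtain ⟨q, hq1, hq2⟩ := exists_between hfin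
  obtain ⟨a, ha, -⟩ := key q hq1 hq2
  refine ⟨a, ha, le_of_forall_gt_imp_ge_of_dense fun q hq => ?_⟩
  rcases eq_top_or_lt_top q with rfl | hq'
  · exact le_top
  · obtain ⟨b, hb, hbq⟩ := key q hq hq'
    rwa [hι.injective (hb.trans ha.symm)] at hbq

/-- A sequence bounded in `L^α(V)` that converges weakly in `H` at all times has its limit in
`L^α(V)`. -/
lemma IsGelfandTriple.exists_memLp_limit [CompleteSpace V] [MeasurableSpace V] [BorelSpace V]
    [CompleteSpace H] [SeparableSpace H] (hι : IsGelfandTriple ι) {S : ℝ} (hS : 0 ≤ S)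
    (hα : 1 < α) {v : ℕ → ℝ → V} (hv : ∀ n, Continuous (v n)) {u : ℝ → H}
    (hweak : ∀ t ∈ Icc 0 S, ∀ h,
      Tendsto (fun n => inner ℝ (ι (v n t)) h) atTop (𝓝 (inner ℝ (u t) h)))
    {c : ℝ} (hc : ∀ n, ∫ t in (0 : ℝ)..S, ‖v n t‖ ^ α ≤ c) :
    ∃ ū : ℝ → V, MemLp ū (ENNReal.ofReal α) (volume.restrict (Icc 0 S)) ∧
      ∀ᵐ t ∂(volume.restrict (Icc 0 S)), ι (ū t) = u t := by
  have hα0 : 0 < α := by linarith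
  have : SeparableSpace V := hι.separableSpace
  have : SecondCountableTopology V := UniformSpace.secondCountable_of_separable V
  have : SecondCountableTopology H := UniformSpace.secondCountable_of_separable H
  let _ : MeasurableSpace H := borel H
  have : BorelSpace H := ⟨rfl⟩
  set μ := volume.restrict (Icc 0 S) with hμ
  have hpc : ∀ n, Continuous fun t => ‖v n t‖ ^ α := fun n =>
    (hv n).norm.rpow_const fun _ => Or.inr hα0.le
  set L : ℝ → ℝ≥0∞ := fun t => liminf (fun n => ENNReal.ofReal (‖v n t‖ ^ α)) atTop with hL
  have hLm : Measurable L := Measurable.liminf fun n => (hpc n).measurable.ennreal_ofReal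
  have hLint : ∫⁻ t, L t ∂μ ≤ ENNReal.ofReal c := by
    refine (lintegral_liminf_le fun n => (hpc n).measurable.ennreal_ofReal).trans ?_
    refine (liminf_le_liminf (v := fun _ => ENNReal.ofReal c)
      (Eventually.of_forall fun n => ?_)).trans (by simp)
    change ∫⁻ t, ENNReal.ofReal (‖v n t‖ ^ α) ∂μ ≤ ENNReal.ofReal c
    rw [← ofReal_integral_eq_lintegral_ofReal (hpc n).continuousOn.integrableOn_Icc
      (Eventually.of_forall fun t => by positivity)]
    refine ENNReal.ofReal_le_ofReal ?_
    have := hc n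
    rwa [intervalIntegral.integral_of_le hS, ← integral_Icc_eq_integral_Ioc] at this
  have hLfin : ∀ᵐ t ∂μ, L t < ⊤ :=
    ae_lt_top hLm (hLint.trans_lt ENNReal.ofReal_lt_top).ne
  have hex : ∀ t, t ∈ Icc 0 S → L t < ⊤ → ∃ a, ι a = u t ∧ ENNReal.ofReal (‖a‖ ^ α) ≤ L t :=
    fun t ht htL => hι.exists_limit_le_liminf hα (hweak t ht) htL
  choose! ū hū using hex
  have hae : ∀ᵐ t ∂μ, ι (ū t) = u t ∧ ENNReal.ofReal (‖ū t‖ ^ α) ≤ L t := by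
    filter_upwards [hLfin, ae_restrict_mem measurableSet_Icc] with t h1 h2
    exact hū t h2 h1
  have hum : AEStronglyMeasurable u μ := by
    refine aestronglyMeasurable_of_inner fun h => ?_
    refine aestronglyMeasurable_of_tendsto_ae atTop (f := fun n t => inner ℝ (ι (v n t)) h)
      (fun n => ?_) ?_
    · have := hv n
      exact Continuous.aestronglyMeasurable (by fun_prop)
    · filter_upwards [ae_restrict_mem measurableSet_Icc] with t ht
      exact hweak t ht h
  -- The values of `ū` were chosen pointwise. Their measurability comes from that of `u`, since a
  -- continuous injection of a Polish space is a Borel embedding.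
  have hemb : MeasurableEmbedding ι := ι.continuous.measurableEmbedding hι.injective
  have hūm : AEStronglyMeasurable ū μ := by
    refine AEMeasurable.aestronglyMeasurable ?_
    rw [← hemb.aemeasurable_comp_iff]
    exact hum.aemeasurable.congr (hae.mono fun t ht => ht.1.symm)
  refine ⟨ū, (memLp_ofReal_iff hα0).2 ⟨hūm, ?_⟩, hae.mono fun t ht => ht.1⟩
  refine ⟨(hūm.norm.aemeasurable.pow_const _).aestronglyMeasurable, ?_⟩
  rw [hasFiniteIntegral_iff_ofReal (Eventually.of_forall fun t => by positivity)]
  calc ∫⁻ t, ENNReal.ofReal (‖ū t‖ ^ α) ∂μ ≤ ∫⁻ t, L t ∂μ :=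
        lintegral_mono_ae (hae.mono fun t ht => ht.2)
    _ < ⊤ := hLint.trans_lt ENNReal.ofReal_lt_top

/-- Coercivity and growth combined, with a competitor. -/
lemma exists_apply_sub_le (hα : 1 < α) (hβ : 0 ≤ β) (hδ : 0 < δ)
    (hf_nonneg : ∀ t ∈ Icc 0 T, 0 ≤ f t)
    (hg : IsCoercivityFunction g) (hcoer : GeneralizedCoercivity ι T A α δ f g)
    (hgrowth : Growth ι T A α β C f) {R : ℝ} (hR : 0 ≤ R) :
    ∃ c, 0 ≤ c ∧ ∀ t ∈ Icc 0 T, ∀ v w, ‖ι v‖ ≤ R →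
      A t v (v - w) ≤ -(δ / 4) * ‖v‖ ^ α + c * (1 + f t + ‖w‖ ^ α) := by
  obtain ⟨c, hc, hcA⟩ := hgrowth.rpow_le hα hβ hf_nonneg hR
  obtain ⟨K, hK, hy⟩ := exists_young hα (r := δ / (4 * (c + 1))) (by positivity)
  have hgR := hg.nonneg (R ^ 2) (by positivity)
  refine ⟨g (R ^ 2) / 2 + (1 / 2 + δ / 4) + K, by positivity, fun t ht v w hv => ?_⟩
  have hft := hf_nonneg t ht
  have h1 := hcoer t ht v
  have h2 : g (‖ι v‖ ^ 2) ≤ g (R ^ 2) :=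
    hg.monotoneOn (by simp only [mem_Ici]; positivity) (by simp only [mem_Ici]; positivity)
      (by gcongr)
  have h3 : -(A t v w) ≤ ‖A t v‖ * ‖w‖ := (neg_le_abs _).trans ((A t v).le_opNorm w)
  have h4 := hy _ _ (norm_nonneg (A t v)) (norm_nonneg w)
  have hvα : 0 ≤ ‖v‖ ^ α := by positivity
  have hwα : 0 ≤ ‖w‖ ^ α := by positivity
  have h5 : δ / (4 * (c + 1)) * ‖A t v‖ ^ (α / (α - 1)) ≤ δ / 4 * (f t + ‖v‖ ^ α) := by
    calc _ ≤ δ / (4 * (c + 1)) * ((c + 1) * (f t + ‖v‖ ^ α)) := by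
          gcongr
          have := hcA t ht v hv
          linarith
      _ = _ := by field_simp
  rw [map_sub]
  have h6 : 0 ≤ g (R ^ 2) * f t := by positivity
  have h7 : 0 ≤ g (R ^ 2) * ‖w‖ ^ α := by positivity
  have h8 : 0 ≤ K * f t := by positivity
  have h9 : 0 ≤ δ * ‖w‖ ^ α := by positivity
  nlinarith

/-- Weak limits of approximate solutions are solutions of the weak equation. -/
lemma exists_weak_solution_of_approx [CompleteSpace V] [MeasurableSpace V] [BorelSpace V]
    [CompleteSpace H] [SeparableSpace H] (hι : IsGelfandTriple ι) (hcompact : IsCompactOperator ι)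
    (hA : RestrictedlyMeasurable T A) (hα : 1 < α) (hβ : 0 ≤ β) (hδ : 0 < δ)
    (hf : IntegrableOn f (Icc 0 T)) (hf_nonneg : ∀ t ∈ Icc 0 T, 0 ≤ f t)
    (hρ : IsWeight ρ) (hη : IsWeight η) (hg : IsCoercivityFunction g)
    (hhemi : Hemicontinuity T A) (hmono : LocalMonotonicity ι T A f ρ η)
    (hcoer : GeneralizedCoercivity ι T A α δ f g)
    (hgrowth : Growth ι T A α β C f) {S : ℝ} (hS : S ∈ Ioc 0 T)
    {v : ℕ → ℝ → V} (hv : ∀ n, Continuous (v n)) {u : ℝ → H} {R c₀ : ℝ}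
    (hvR : ∀ n, ∀ t ∈ Icc 0 S, ‖ι (v n t)‖ ≤ R) (huR : ∀ t ∈ Icc 0 S, ‖u t‖ ≤ R)
    (hc₀ : ∀ n, ∫ t in (0 : ℝ)..S, ‖v n t‖ ^ α ≤ c₀)
    (hweak : ∀ t ∈ Icc 0 S, ∀ h,
      Tendsto (fun n => inner ℝ (ι (v n t)) h) atTop (𝓝 (inner ℝ (u t) h)))
    (hlim : ∀ s ∈ Icc 0 S, ∀ t ∈ Icc 0 S, ∀ z : V,
      Tendsto (fun n => ∫ r in s..t, A r (v n r) z) atTop (𝓝 (inner ℝ (u t - u s) (ι z))))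
    (hlow : ∀ ε > 0, ∀ᶠ n in atTop,
      (‖u S‖ ^ 2 - ‖u 0‖ ^ 2) / 2 - ε ≤ ∫ t in (0 : ℝ)..S, A t (v n t) (v n t)) :
    ∃ ū : ℝ → V, MemLp ū (ENNReal.ofReal α) (volume.restrict (Icc 0 S)) ∧
      (∀ᵐ t ∂(volume.restrict (Icc 0 S)), ι (ū t) = u t) ∧
      MemLp (fun t => A t (ū t)) (ENNReal.ofReal (α / (α - 1))) (volume.restrict (Icc 0 S)) ∧
      ∀ t ∈ Icc 0 S, ∀ z : V,
        inner ℝ (u t) (ι z) = inner ℝ (u 0) (ι z) + ∫ s in (0 : ℝ)..t, A s (ū s) z := by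
  have hα0 : 0 < α := by linarith
  have hp0 : 0 < α / (α - 1) := by linarith [one_lt_conjExponent hα]
  have hS0 : 0 ≤ S := hS.1.le
  have hzero : (0 : ℝ) ∈ Icc 0 S := by simp [hS0]
  have hSmem : S ∈ Icc 0 S := by simp [hS0]
  have hsubT : Icc 0 S ⊆ Icc 0 T := Icc_subset_Icc_right hS.2
  have hfS : IntegrableOn f (Icc 0 S) := hf.mono_set hsubT
  have hR0 : 0 ≤ R := (norm_nonneg _).trans (huR 0 hzero)
  obtain ⟨ū, hū, hιū⟩ := hι.exists_memLp_limit hS0 hα hv hweak hc₀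
  obtain ⟨c, hc, hcA⟩ := hgrowth.rpow_le hα hβ hf_nonneg hR0
  obtain ⟨c', hc', hcomp⟩ := exists_apply_sub_le hα hβ hδ hf_nonneg hg hcoer hgrowth hR0
  set μ := volume.restrict (Icc 0 S) with hμ
  have hvLp : ∀ n, MemLp (v n) (ENNReal.ofReal α) μ := fun n =>
    (memLp_ofReal_iff hα0).2 ⟨(hv n).aestronglyMeasurable,
      ((hv n).norm.rpow_const fun _ => Or.inr hα0.le).continuousOn.integrableOn_Icc⟩
  have hvpow : ∀ n, IntegrableOn (fun t => ‖v n t‖ ^ α) (Icc 0 S) := fun n =>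
    ((memLp_ofReal_iff hα0).1 (hvLp n)).2
  have hūpow : IntegrableOn (fun t => ‖ū t‖ ^ α) (Icc 0 S) := ((memLp_ofReal_iff hα0).1 hū).2
  have hAv : ∀ n, MemLp (fun t => A t (v n t)) (ENNReal.ofReal (α / (α - 1))) μ := fun n => by
    refine memLp_apply_of_growth hA hα hS.2 hf (hvLp n) (c := c) ?_
    filter_upwards [ae_restrict_mem measurableSet_Icc] with t ht
    exact hcA t (hsubT ht) _ (hvR n t ht)
  have hūc : ∀ᵐ t ∂μ, ‖A t (ū t)‖ ^ (α / (α - 1)) ≤ c * (f t + ‖ū t‖ ^ α) := by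
    filter_upwards [ae_restrict_mem measurableSet_Icc, hιū] with t ht h1
    exact hcA t (hsubT ht) _ (by rw [h1]; exact huR t ht)
  have hAū : MemLp (fun t => A t (ū t)) (ENNReal.ofReal (α / (α - 1))) μ :=
    memLp_apply_of_growth hA hα hS.2 hf hū hūc
  refine ⟨ū, hū, hιū, hAū, ?_⟩
  set F := ∫ t in (0 : ℝ)..S, f t with hF
  have hbint : ∀ n, IntegrableOn (fun t => c * (f t + ‖v n t‖ ^ α)) (Icc 0 S) := fun n =>
    (hfS.add (hvpow n)).const_mul c
  have hbS : ∀ n, ∫ t in (0 : ℝ)..S, c * (f t + ‖v n t‖ ^ α) ≤ c * (F + c₀) := by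
    intro n
    rw [intervalIntegral.integral_const_mul, intervalIntegral.integral_add
      (IntegrableOn.intervalIntegrable_of_subset hfS hzero hSmem)
      (IntegrableOn.intervalIntegrable_of_subset (hvpow n) hzero hSmem)]
    gcongr
    exact hc₀ n
  have hAbound : ∀ n, ∫ t in (0 : ℝ)..S, ‖A t (v n t)‖ ^ (α / (α - 1)) ≤ c * (F + c₀) := by
    intro n
    refine le_trans (intervalIntegral.integral_mono_on hS0
      (IntegrableOn.intervalIntegrable_of_subset ((memLp_ofReal_iff hp0).1 (hAv n)).2 hzero hSmem)
      (IntegrableOn.intervalIntegrable_of_subset (hbint n) hzero hSmem)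
      fun t ht => hcA t (hsubT ht) _ (hvR n t ht)) (hbS n)
  have hIoc : ∀ h : ℝ → ℝ, ∫ t in (0 : ℝ)..S, h t = ∫ t, h t ∂μ := fun h => by
    rw [intervalIntegral.integral_of_le hS0, ← integral_Icc_eq_integral_Ioc]
  set x : ℕ → ℝ → ℝ := fun n t => A t (v n t) (v n t - ū t) with hx
  set k : ℝ → ℝ := fun t => c' * (1 + f t + ‖ū t‖ ^ α) with hk
  have hxi : ∀ n, Integrable (x n) μ := fun n => integrable_apply hα (hAv n) ((hvLp n).sub hū)
  have hki : Integrable k μ := (((integrable_const _).add hfS).add hūpow).const_mul c'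
  have hxk : ∀ n, ∀ t ∈ Icc 0 S, x n t ≤ -(δ / 4) * ‖v n t‖ ^ α + k t := fun n t ht =>
    hcomp t (hsubT ht) _ _ (hvR n t ht)
  -- At a fixed time the approximations need not be bounded in `V`, but coercivity bounds those
  -- whose pairing `x n t` is not too negative.
  have hvbound : ∀ n, ∀ t ∈ Icc 0 S, ∀ m, m ≤ x n t → ‖v n t‖ ≤ ((k t - m) * (4 / δ)) ^ α⁻¹ := by
    intro n t ht m hm
    have h1 := hxk n t ht
    have h2 : ‖v n t‖ ^ α ≤ (k t - m) * (4 / δ) := by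
      rw [mul_div_assoc', le_div_iff₀ hδ]
      nlinarith
    calc ‖v n t‖ = (‖v n t‖ ^ α) ^ α⁻¹ := (Real.rpow_rpow_inv (norm_nonneg _) hα0.ne').symm
      _ ≤ _ := by gcongr
  have hup : ∀ᵐ t ∂μ, ∀ ε > 0, ∀ᶠ n in atTop, x n t ≤ ε := by
    filter_upwards [ae_restrict_mem measurableSet_Icc, hιū] with t ht hut ε hε
    -- Along the indices with `ε < x n t` the vectors are bounded in `V`, so they converge weakly in
    -- `V` and strongly in `H` to `ū t`. Local monotonicity with competitor `ū t` then makes the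
    -- pairing eventually at most `ε`.
    by_contra hcon
    simp only [not_eventually, not_le] at hcon
    have : (atTop ⊓ 𝓟 {n | ε < x n t}).NeBot := frequently_mem_iff_neBot.1 hcon
    have hev : ∀ᶠ n in atTop ⊓ 𝓟 {n | ε < x n t}, ε < x n t :=
      eventually_inf_principal.2 (Eventually.of_forall fun n hn => hn)
    have hbd := hev.mono fun n hn => hvbound n t ht ε (le_of_lt hn)
    have hw : ∀ h, Tendsto (fun n => inner ℝ (ι (v n t)) h) (atTop ⊓ 𝓟 {n | ε < x n t})
        (𝓝 (inner ℝ (u t) h)) := fun h => (hweak t ht h).mono_left inf_le_left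
    obtain ⟨a, ha, -, hva⟩ := hι.exists_weak_limit hbd hw
    have hstrong := tendsto_of_isCompactOperator hcompact hbd hw
    have hau : a = ū t := hι.injective (ha.trans hut.symm)
    subst hau
    rw [← hut] at hstrong
    obtain ⟨M, hM⟩ := hρ.bounded_on_balls (((k t - ε) * (4 / δ)) ^ α⁻¹)
    have h1 := eventually_apply_sub_le (hmono t (hsubT ht)) (hbd.mono fun n hn => hM _ hn)
      hva hstrong (ū t) hε
    obtain ⟨n, hn1, hn2⟩ := (h1.and hev).exists
    simp only [sub_self, map_zero, norm_zero] at hn1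
    simp only [hx] at hn2
    norm_num at hn1
    rw [map_sub] at hn2
    linarith
  have hxlow : ∀ ε > 0, ∀ᶠ n in atTop, -ε ≤ ∫ t, x n t ∂μ := by
    intro ε hε
    -- The self-pairing is bounded below and the pairing with `ū` above by the same half increment
    -- of the squared norm, so the difference has nonnegative lower limit.
    filter_upwards [hlow (ε / 2) (by positivity), eventually_integral_apply_le
      hι.denseRange hα hS.1 hAv hAbound huR hlim hū hιū (half_pos hε)] with n h1 h2
    have h3 : ∫ t, x n t ∂μ = (∫ t in (0 : ℝ)..S, A t (v n t) (v n t))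
        - ∫ t in (0 : ℝ)..S, A t (v n t) (ū t) := by
      rw [hIoc, hIoc, ← integral_sub (integrable_apply hα (hAv n) (hvLp n))
        (integrable_apply hα (hAv n) hū)]
      simp only [hx, map_sub]
    linarith
  obtain ⟨ψ, hψ, hψx⟩ := exists_subseq_tendsto_zero hxi hki (by
      filter_upwards [ae_restrict_mem measurableSet_Icc] with t ht
      have := hf_nonneg t (hsubT ht)
      simp only [hk]; positivity) (fun n => by
      filter_upwards [ae_restrict_mem measurableSet_Icc] with t ht
      have := hxk n t ht
      have : 0 ≤ δ / 4 * ‖v n t‖ ^ α := by positivity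
      linarith) hup hxlow
  have hpt : ∀ᵐ t ∂μ, ∀ z, Tendsto (fun n => A t (v (ψ n) t) z) atTop (𝓝 (A t (ū t) z)) := by
    filter_upwards [ae_restrict_mem measurableSet_Icc, hιū, hψx] with t ht hut hxt z
    have hbd : ∀ᶠ n in atTop, ‖v (ψ n) t‖ ≤ ((k t - (-1)) * (4 / δ)) ^ α⁻¹ := by
      filter_upwards [hxt.eventually (lt_mem_nhds (show (-1 : ℝ) < 0 by norm_num))] with n hn
      exact hvbound _ t ht _ hn.le
    have hw : ∀ h, Tendsto (fun n => inner ℝ (ι (v (ψ n) t)) h) atTop (𝓝 (inner ℝ (u t) h)) :=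
      fun h => (hweak t ht h).comp hψ.tendsto_atTop
    obtain ⟨a, ha, -, hva⟩ := hι.exists_weak_limit hbd hw
    have hstrong := tendsto_of_isCompactOperator hcompact hbd hw
    have hau : a = ū t := hι.injective (ha.trans hut.symm)
    subst hau
    rw [← hut] at hstrong
    obtain ⟨M, hM⟩ := hρ.bounded_on_balls (((k t - (-1)) * (4 / δ)) ^ α⁻¹)
    exact tendsto_apply_of_tendsto_apply_sub (hmono t (hsubT ht)) hη.bounded_on_balls
      (hhemi t (hsubT ht)) (hbd.mono fun n hn => hM _ hn) hva hstrong hxt z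
  intro t ht z
  have hsub : Ioc 0 t ⊆ Icc 0 S := Ioc_subset_Icc_self.trans (Icc_subset_Icc_right ht.2)
  have hle := Measure.restrict_mono_set (volume : Measure ℝ) hsub
  have hpow : ∀ w : StrongDual ℝ V, ∀ q, ‖w‖ ^ (α / (α - 1)) ≤ q →
      |w z| ^ (α / (α - 1)) ≤ ‖z‖ ^ (α / (α - 1)) * q := by
    intro w q hwq
    calc |w z| ^ (α / (α - 1)) ≤ (‖w‖ * ‖z‖) ^ (α / (α - 1)) := by
          gcongr
          exact w.le_opNorm z
      _ = ‖z‖ ^ (α / (α - 1)) * ‖w‖ ^ (α / (α - 1)) := by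
          rw [Real.mul_rpow (norm_nonneg _) (norm_nonneg _), mul_comm]
      _ ≤ _ := by gcongr
  have h1 := tendsto_integral_of_rpow_bound (μ := volume.restrict (Ioc 0 t)) hα
    (y := fun n s => A s (v (ψ n) s) z) (y₀ := fun s => A s (ū s) z)
    (b := fun n s => ‖z‖ ^ (α / (α - 1)) * (c * (f s + ‖v (ψ n) s‖ ^ α)))
    (b₀ := fun s => ‖z‖ ^ (α / (α - 1)) * (c * (f s + ‖ū s‖ ^ α)))
    (fun n => (integrable_apply_const hα (hAv (ψ n)) z).aestronglyMeasurable.mono_measure hle)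
    ((integrable_apply_const hα hAū z).aestronglyMeasurable.mono_measure hle)
    (fun n => ((hbint (ψ n)).mono_set hsub).const_mul _)
    ((IntegrableOn.mono_set ((hfS.add hūpow).const_mul c) hsub).const_mul _)
    (fun n => by
      filter_upwards [ae_restrict_mem measurableSet_Ioc] with s hs
      exact hpow _ _ (hcA s (hsubT (hsub hs)) _ (hvR _ s (hsub hs))))
    (Eventually.mono (ae_mono hle hūc) fun s hs => hpow _ _ hs)
    (c := ‖z‖ ^ (α / (α - 1)) * (c * (F + c₀)))
    (fun n => by
      rw [integral_const_mul]
      refine mul_le_mul_of_nonneg_left (le_trans ?_ (hbS (ψ n))) (by positivity)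
      rw [hIoc]
      refine setIntegral_mono_set (hbint (ψ n)) ?_ hsub.eventuallyLE
      filter_upwards [ae_restrict_mem measurableSet_Icc] with s hs
      have := hf_nonneg s (hsubT hs)
      simp only [Pi.zero_apply]
      positivity)
    (Eventually.mono (ae_mono hle hpt) fun s hs => hs z)
  have h2 := (hlim 0 hzero t ht z).comp hψ.tendsto_atTop
  simp only [Function.comp_def, intervalIntegral.integral_of_le ht.1] at h2
  have h3 := tendsto_nhds_unique h2 h1
  rw [inner_sub_left] at h3
  rw [intervalIntegral.integral_of_le ht.1, ← h3]
  ring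

end Limit

end GelfandEvolution

namespace GelfandEvolution

open Filter TopologicalSpace

/-! ### Existence for the weak equation -/

section Existence

variable {V H : Type*} [NormedAddCommGroup V] [NormedSpace ℝ V]
  [NormedAddCommGroup H] [InnerProductSpace ℝ H]
  {ι : V →L[ℝ] H} {T α β δ C : ℝ} {A : ℝ → V → StrongDual ℝ V} {f g : ℝ → ℝ} {ρ η : V → ℝ}

/-- Weak equicontinuity in time: the first term is made small through `r`, after which the second is
small for short intervals. Taking `r = 1` and unit vectors bounds the integrated functionals in the
dual norm. -/
lemma abs_integral_apply_le {S : ℝ} (hα : 1 < α) {w : ℝ → StrongDual ℝ V}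
    (hw : MemLp w (ENNReal.ofReal (α / (α - 1))) (volume.restrict (Icc 0 S)))
    {c : ℝ} (hc : ∫ t in (0 : ℝ)..S, ‖w t‖ ^ (α / (α - 1)) ≤ c) {r K : ℝ} (hr : 0 < r)
    (hy : ∀ a b : ℝ, 0 ≤ a → 0 ≤ b → a * b ≤ r * a ^ (α / (α - 1)) + K * b ^ α) {s t : ℝ}
    (hs : s ∈ Icc 0 S) (ht : t ∈ Icc 0 S) (z : V) :
    |∫ x in s..t, w x z| ≤ r * c + K * ‖z‖ ^ α * |t - s| := by
  wlog hst : s ≤ t generalizing s t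
  · rw [intervalIntegral.integral_symm, abs_neg, abs_sub_comm]
    exact this ht hs (le_of_not_ge hst)
  have hp0 : 0 < α / (α - 1) := by linarith [one_lt_conjExponent hα]
  have hwi := ((memLp_ofReal_iff hp0).1 hw).2
  have hwst := IntegrableOn.intervalIntegrable_of_subset hwi hs ht
  have h1 : |∫ x in s..t, w x z| ≤ ∫ x in s..t, (r * ‖w x‖ ^ (α / (α - 1)) + K * ‖z‖ ^ α) := by
    rw [← Real.norm_eq_abs]
    refine intervalIntegral.norm_integral_le_of_norm_le hst (Eventually.of_forall fun x _ => ?_)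
      ((hwst.const_mul r).add intervalIntegrable_const)
    exact ((w x).le_opNorm z).trans (hy _ _ (norm_nonneg _) (norm_nonneg _))
  rw [intervalIntegral.integral_add (hwst.const_mul r) intervalIntegrable_const,
    intervalIntegral.integral_const_mul, intervalIntegral.integral_const, smul_eq_mul] at h1
  have h2 : ∫ x in s..t, ‖w x‖ ^ (α / (α - 1)) ≤ c := by
    refine le_trans ?_ hc
    refine intervalIntegral.integral_mono_interval hs.1 hst ht.2
      (Eventually.of_forall fun x => by positivity)
      (IntegrableOn.intervalIntegrable_of_subset hwi ⟨le_rfl, hs.1.trans hs.2⟩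
        ⟨hs.1.trans hs.2, le_rfl⟩)
  rw [abs_of_nonneg (by linarith : 0 ≤ t - s)]
  have h3 : r * (∫ x in s..t, ‖w x‖ ^ (α / (α - 1))) ≤ r * c := by gcongr
  linarith

theorem exists_weak_solution [CompleteSpace V] [MeasurableSpace V] [BorelSpace V]
    [CompleteSpace H] [SeparableSpace H] (hι : IsGelfandTriple ι) (hcompact : IsCompactOperator ι)
    (hA : RestrictedlyMeasurable T A) (hα : 1 < α) (hβ : 0 ≤ β) (hδ : 0 < δ)
    (hf : IntegrableOn f (Icc 0 T)) (hf_nonneg : ∀ t ∈ Icc 0 T, 0 ≤ f t)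
    (hρ : IsWeight ρ) (hη : IsWeight η) (hg : IsCoercivityFunction g)
    (hhemi : Hemicontinuity T A) (hmono : LocalMonotonicity ι T A f ρ η)
    (hcoer : GeneralizedCoercivity ι T A α δ f g)
    (hgrowth : Growth ι T A α β C f) {S : ℝ} (hS : S ∈ Ioc 0 T) (u₀ : H)
    (hBihari : BihariTime f g u₀ S) :
    ∃ (u : ℝ → H) (ū : ℝ → V) (R : ℝ), u 0 = u₀ ∧ (∀ t ∈ Icc 0 S, ‖u t‖ ≤ R) ∧
      MemLp ū (ENNReal.ofReal α) (volume.restrict (Icc 0 S)) ∧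
      (∀ᵐ t ∂(volume.restrict (Icc 0 S)), ι (ū t) = u t) ∧
      MemLp (fun t => A t (ū t)) (ENNReal.ofReal (α / (α - 1))) (volume.restrict (Icc 0 S)) ∧
      ∀ t ∈ Icc 0 S, ∀ z : V,
        inner ℝ (u t) (ι z) = inner ℝ u₀ (ι z) + ∫ s in (0 : ℝ)..t, A s (ū s) z := by
  have hα0 : 0 < α := by linarith
  have hp0 : 0 < α / (α - 1) := by linarith [one_lt_conjExponent hα]
  have hS0 : 0 ≤ S := hS.1.le
  have hzero : (0 : ℝ) ∈ Icc 0 S := by simp [hS0]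
  have hSmem : S ∈ Icc 0 S := by simp [hS0]
  have hsubT : Icc 0 S ⊆ Icc 0 T := Icc_subset_Icc_right hS.2
  have hfS : IntegrableOn f (Icc 0 S) := hf.mono_set hsubT
  have : SeparableSpace V := hι.separableSpace
  set F := ∫ t in (0 : ℝ)..S, f t with hF
  have hF0 : 0 ≤ F :=
    intervalIntegral.integral_nonneg (μ := volume) hS0 fun t ht => hf_nonneg t (hsubT ht)
  obtain ⟨ε₀, hε₀, M, hM⟩ := exists_bihari_bound hg (K := ‖u₀‖ ^ 2 + F) (by positivity) hBihari
  set d := denseSeq V with hd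
  have hDd : DenseRange d := denseRange_denseSeq V
  have hDH : DenseRange fun j => ι (d j) := hι.denseRange.comp hDd ι.continuous
  set E : ℕ → Submodule ℝ V := fun n => Submodule.span ℝ (d '' Iic n) with hE
  have hEfin : ∀ n, FiniteDimensional ℝ (E n) := fun n =>
    FiniteDimensional.span_of_finite ℝ ((finite_Iic n).image d)
  have hdE : ∀ j n, j ≤ n → d j ∈ E n := fun j n hjn =>
    Submodule.subset_span ⟨j, hjn, rfl⟩
  have hgal := fun n : ℕ => exists_galerkin hι.injective hι.denseRange hA hα hβ hδ hf hf_nonneg hg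
    hcoer hgrowth hS u₀ hε₀ hM (E n) (ε := 1 / ((n : ℝ) + 1)) (by positivity)
  choose v w hv hw hweq hw0 hb using hgal
  have helim : Tendsto (fun n : ℕ => 1 / ((n : ℝ) + 1)) atTop (𝓝 0) :=
    tendsto_one_div_add_atTop_nhds_zero_nat
  have hele : ∀ n : ℕ, 1 / ((n : ℝ) + 1) ≤ 1 := fun n => by
    rw [div_le_one (by positivity)]
    linarith [(Nat.cast_nonneg n : (0 : ℝ) ≤ n)]
  have hM0 : 0 ≤ M := (sq_nonneg _).trans (hb 0 0 hzero).1
  set R := √M with hR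
  have hR0 : 0 ≤ R := Real.sqrt_nonneg M
  have hRM : R ^ 2 = M := Real.sq_sqrt hM0
  have hwR : ∀ n, ∀ t ∈ Icc 0 S, ‖ι (w n t)‖ ≤ R := fun n t ht =>
    Real.le_sqrt_of_sq_le (hb n t ht).1
  have hvR : ∀ n, ∀ t ∈ Icc 0 S, ‖ι (v n t)‖ ≤ R := fun n t ht =>
    Real.le_sqrt_of_sq_le (hb n t ht).2.1
  obtain ⟨c, hc, hcA⟩ := hgrowth.rpow_le hα hβ hf_nonneg hR0
  have hvLp : ∀ n, MemLp (v n) (ENNReal.ofReal α) (volume.restrict (Icc 0 S)) := fun n =>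
    (memLp_ofReal_iff hα0).2 ⟨(hv n).aestronglyMeasurable,
      ((hv n).norm.rpow_const fun _ => Or.inr hα0.le).continuousOn.integrableOn_Icc⟩
  have hvpow : ∀ n, IntervalIntegrable (fun t => ‖v n t‖ ^ α) volume 0 S := fun n =>
    IntegrableOn.intervalIntegrable_of_subset ((memLp_ofReal_iff hα0).1 (hvLp n)).2 hzero hSmem
  have hfi : IntervalIntegrable f volume 0 S :=
    IntegrableOn.intervalIntegrable_of_subset hfS hzero hSmem
  have hAv : ∀ n, MemLp (fun t => A t (v n t)) (ENNReal.ofReal (α / (α - 1)))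
      (volume.restrict (Icc 0 S)) := fun n => by
    refine memLp_apply_of_growth hA hα hS.2 hf (hvLp n) (c := c) ?_
    filter_upwards [ae_restrict_mem measurableSet_Icc] with t ht
    exact hcA t (hsubT ht) _ (hvR n t ht)
  have hAvi : ∀ n z, IntegrableOn (fun t => A t (v n t) z) (Icc 0 S) := fun n z =>
    integrable_apply_const hα (hAv n) z
  have hAvv : ∀ n, IntegrableOn (fun t => A t (v n t) (v n t)) (Icc 0 S) := fun n =>
    integrable_apply hα (hAv n) (hvLp n)
  -- Integrated coercivity inserted in the energy inequality at time `S`; the `1` covers the delay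
  -- error.
  set c₀ := (‖u₀‖ ^ 2 + 1 + S * g M + F) / δ with hc₀
  have hc₀v : ∀ n, ∫ t in (0 : ℝ)..S, ‖v n t‖ ^ α ≤ c₀ := by
    intro n
    have h1 := (hb n S hSmem).2.2.2
    have h2 : ‖ι (w n 0)‖ ^ 2 ≤ ‖u₀‖ ^ 2 := by
      have := hw0 n
      gcongr
    have h3 : ∫ t in (0 : ℝ)..S, 2 * A t (v n t) (v n t) ≤
        ∫ t in (0 : ℝ)..S, (-δ * ‖v n t‖ ^ α + (g M + f t)) := by
      refine intervalIntegral.integral_mono_on hS0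
        ((IntegrableOn.intervalIntegrable_of_subset (hAvv n) hzero hSmem).const_mul 2)
        (((hvpow n).const_mul _).add (intervalIntegrable_const.add hfi)) fun t ht => ?_
      have h4 := hcoer t (hsubT ht) (v n t)
      have h5 : g (‖ι (v n t)‖ ^ 2) ≤ g M :=
        hg.monotoneOn (by simp only [mem_Ici]; positivity) hM0 (hb n t ht).2.1
      linarith
    rw [intervalIntegral.integral_add ((hvpow n).const_mul _) (intervalIntegrable_const.add hfi),
      intervalIntegral.integral_add intervalIntegrable_const hfi,
      intervalIntegral.integral_const_mul, intervalIntegral.integral_const_mul,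
      intervalIntegral.integral_const, smul_eq_mul, sub_zero] at h3
    rw [hc₀, le_div_iff₀ hδ]
    have h6 := hele n
    have h7 : 0 ≤ ‖ι (w n S)‖ ^ 2 := by positivity
    linarith
  set c₁ := c * (F + c₀) with hc₁
  have hAbound : ∀ n, ∫ t in (0 : ℝ)..S, ‖A t (v n t)‖ ^ (α / (α - 1)) ≤ c₁ := by
    intro n
    calc ∫ t in (0 : ℝ)..S, ‖A t (v n t)‖ ^ (α / (α - 1))
        ≤ ∫ t in (0 : ℝ)..S, c * (f t + ‖v n t‖ ^ α) :=
          intervalIntegral.integral_mono_on hS0 (IntegrableOn.intervalIntegrable_of_subset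
            ((memLp_ofReal_iff hp0).1 (hAv n)).2 hzero hSmem) ((hfi.add (hvpow n)).const_mul c)
            fun t ht => hcA t (hsubT ht) _ (hvR n t ht)
      _ = c * (F + ∫ t in (0 : ℝ)..S, ‖v n t‖ ^ α) := by
          rw [intervalIntegral.integral_const_mul, intervalIntegral.integral_add hfi (hvpow n)]
      _ ≤ c₁ := by
          rw [hc₁]
          have := hc₀v n
          gcongr
  have hc₁0 : 0 ≤ c₁ := (intervalIntegral.integral_nonneg hS0
    (fun t _ => by positivity)).trans (hAbound 0)
  have hincr : ∀ n, ∀ z ∈ E n, ∀ s ∈ Icc 0 S, ∀ t ∈ Icc 0 S,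
      inner ℝ (ι (w n t) - ι (w n s)) (ι z) = ∫ x in s..t, A x (v n x) z := by
    intro n z hz s hs t ht
    rw [inner_sub_left, hweq n t ht z hz, hweq n s hs z hz, add_sub_add_left_eq_sub,
      intervalIntegral.integral_interval_sub_left
        (IntegrableOn.intervalIntegrable_of_subset (hAvi n z) hzero ht)
        (IntegrableOn.intervalIntegrable_of_subset (hAvi n z) hzero hs)]
  obtain ⟨φ, u, hφ, hu⟩ := exists_subseq_tendsto_inner hS0 (x := fun n t => ι (w n t)) hwR hDH
    (fun j ε hε => by
      obtain ⟨K, hK, hy⟩ := exists_young hα (r := ε / (2 * (c₁ + 1))) (by positivity)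
      set q := K * ‖d j‖ ^ α with hq
      have hq0 : 0 ≤ q := by positivity
      refine ⟨ε / (2 * (q + 1)), by positivity, ?_⟩
      filter_upwards [eventually_ge_atTop j] with n hn s hs t ht hst
      rw [hincr n _ (hdE j n hn) t ht s hs]
      refine (abs_integral_apply_le hα (hAv n) (hAbound n) (by positivity) hy ht hs _).trans ?_
      have h1 : ε / (2 * (c₁ + 1)) * c₁ ≤ ε / 2 := by
        calc _ ≤ ε / (2 * (c₁ + 1)) * (c₁ + 1) := by gcongr; linarith
          _ = ε / 2 := by field_simp
      have h2 : q * |s - t| ≤ ε / 2 := by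
        calc _ ≤ (q + 1) * (ε / (2 * (q + 1))) := by
              gcongr
              linarith
          _ = ε / 2 := by field_simp
      linarith)
  have hφe : Tendsto (fun n => 1 / ((φ n : ℝ) + 1)) atTop (𝓝 0) := helim.comp hφ.tendsto_atTop
  have hu0 : u 0 = u₀ := by
    have h1 : ∀ j, inner ℝ (u 0) (ι (d j)) = inner ℝ u₀ (ι (d j)) := by
      intro j
      refine tendsto_nhds_unique ((hu 0 hzero).2 (ι (d j))) (tendsto_const_nhds.congr' ?_)
      filter_upwards [eventually_ge_atTop j] with n hn
      rw [hweq _ 0 hzero _ (hdE j _ (hn.trans (hφ.id_le n)))]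
      simp
    refine hDH.equalizer (g := fun h => inner ℝ (u 0) h) (h := fun h => inner ℝ u₀ h)
      (by fun_prop) (by fun_prop) (funext h1) |> fun h => ext_inner_right ℝ fun x => congrFun h x
  have hweak : ∀ t ∈ Icc 0 S, ∀ h,
      Tendsto (fun n => inner ℝ (ι (v (φ n) t)) h) atTop (𝓝 (inner ℝ (u t) h)) := by
    intro t ht h
    have h1 : Tendsto (fun n => inner ℝ (ι (w (φ n) t - v (φ n) t)) h) atTop (𝓝 0) := by
      refine squeeze_zero_norm (a := fun n => ‖ι‖ * (1 / ((φ n : ℝ) + 1)) * ‖h‖) (fun n => ?_)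
        (by simpa only [mul_zero, zero_mul] using (hφe.const_mul ‖ι‖).mul_const ‖h‖)
      refine (norm_inner_le_norm _ _).trans ?_
      gcongr
      exact (ι.le_opNorm _).trans (mul_le_mul_of_nonneg_left (hb (φ n) t ht).2.2.1 (norm_nonneg _))
    have h2 := ((hu t ht).2 h).sub h1
    simpa [inner_sub_left] using h2
  have hApply : ∀ n s t z, s ∈ Icc 0 S → t ∈ Icc 0 S →
      (∫ x in s..t, A x (v n x)) z = ∫ x in s..t, A x (v n x) z := fun n s t z hs ht =>
    ((ContinuousLinearMap.apply ℝ ℝ z).intervalIntegral_comp_comm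
      (IntegrableOn.intervalIntegrable_of_subset ((hAv n).integrable (by
        rw [← ENNReal.ofReal_one]
        exact ENNReal.ofReal_le_ofReal (one_lt_conjExponent hα).le)) hs ht)).symm
  have hlim : ∀ s ∈ Icc 0 S, ∀ t ∈ Icc 0 S, ∀ z : V,
      Tendsto (fun n => ∫ r in s..t, A r (v (φ n) r) z) atTop
        (𝓝 (inner ℝ (u t - u s) (ι z))) := by
    intro s hs t ht z
    obtain ⟨K, hK, hy⟩ := exists_young hα one_pos
    have h1 := tendsto_clm_of_dense (l := atTop) hDd
      (b := fun n => ∫ x in s..t, A x (v (φ n) x)) (B := toDual ι (u t - u s))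
      (R := 1 * c₁ + K * 1 * |t - s|) (Eventually.of_forall fun n => by
        refine ContinuousLinearMap.opNorm_le_of_unit_norm (by positivity) fun x hx => ?_
        rw [hApply _ _ _ _ hs ht, Real.norm_eq_abs]
        have := abs_integral_apply_le hα (hAv (φ n)) (hAbound (φ n)) one_pos hy hs ht x
        rwa [hx, Real.one_rpow] at this) (fun j => by
        rw [toDual_apply, inner_sub_left]
        refine (((hu t ht).2 (ι (d j))).sub ((hu s hs).2 (ι (d j)))).congr' ?_
        filter_upwards [eventually_ge_atTop j] with n hn
        rw [hApply _ _ _ _ hs ht, ← hincr (φ n) _ (hdE j _ (hn.trans (hφ.id_le n))) s hs t ht,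
          inner_sub_left]) z
    simpa only [hApply _ _ _ _ hs ht, toDual_apply] using h1
  -- The Galerkin energy inequality combined with weak lower semicontinuity of the norm at time `S`;
  -- the initial norms are at most that of `u₀`, and the delay error tends to zero.
  have hlow : ∀ ε > 0, ∀ᶠ n in atTop,
      (‖u S‖ ^ 2 - ‖u 0‖ ^ 2) / 2 - ε ≤ ∫ t in (0 : ℝ)..S, A t (v (φ n) t) (v (φ n) t) := by
    intro ε hε
    have h1 := (hu S hSmem).2 (u S)
    rw [real_inner_self_eq_norm_sq] at h1
    filter_upwards [h1.eventually (lt_mem_nhds (show ‖u S‖ ^ 2 - ε / 4 < ‖u S‖ ^ 2 by linarith)),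
      hφe.eventually (gt_mem_nhds (show 0 < ε / 4 by positivity))] with n hn1 hn2
    have h2 := (hb (φ n) S hSmem).2.2.2
    have h3 : ‖ι (w (φ n) 0)‖ ^ 2 ≤ ‖u 0‖ ^ 2 := by
      rw [hu0]
      have := hw0 (φ n)
      gcongr
    have h4 := norm_sub_sq_real (ι (w (φ n) S)) (u S)
    have h5 := sq_nonneg ‖ι (w (φ n) S) - u S‖
    linarith
  obtain ⟨ū, h1, h2, h3, h4⟩ := exists_weak_solution_of_approx hι hcompact hA hα hβ hδ hf hf_nonneg
    hρ hη hg hhemi hmono hcoer hgrowth hS (fun n => hv (φ n)) (fun n => hvR (φ n))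
    (fun t ht => (hu t ht).1) (fun n => hc₀v (φ n)) hweak hlim hlow
  rw [hu0] at h4
  exact ⟨u, ū, R, hu0, fun t ht => (hu t ht).1, h1, h2, h3, h4⟩

end Existence

end GelfandEvolution

namespace GelfandEvolution

open Filter TopologicalSpace

/-! ### From the weak equation to solutions; Gronwall's lemma -/

section Solutions

variable {V H : Type*} [NormedAddCommGroup V] [NormedSpace ℝ V]
  [NormedAddCommGroup H] [InnerProductSpace ℝ H]
  {ι : V →L[ℝ] H} {T α : ℝ} {A : ℝ → V → StrongDual ℝ V}

lemma integral_deriv_mul_primitive {S a : ℝ} (hS : 0 ≤ S) {F φ : ℝ → ℝ}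
    (hF : IntegrableOn F (Icc 0 S)) (hφ : ContDiff ℝ 1 φ) (h0 : φ 0 = 0) (h1 : φ S = 0) :
    ∫ t in (0 : ℝ)..S, deriv φ t * (a + ∫ s in (0 : ℝ)..t, F s) =
      -∫ t in (0 : ℝ)..S, φ t * F t := by
  have hFi : IntervalIntegrable F volume 0 S :=
    IntegrableOn.intervalIntegrable_of_subset hF (by simp [hS]) (by simp [hS])
  have hac := hFi.absolutelyContinuousOnInterval_intervalIntegral (c := 0) (by simp)
  have hcac : AbsolutelyContinuousOnInterval (fun _ : ℝ => a) 0 S :=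
    contDiff_const.contDiffOn.absolutelyContinuousOnInterval
  have hibp := AbsolutelyContinuousOnInterval.integral_mul_deriv_eq_deriv_mul
    (hφ.contDiffOn (s := uIcc 0 S)).absolutelyContinuousOnInterval (hcac.add hac)
  have hcongr : ∫ t in (0 : ℝ)..S,
      φ t * deriv ((fun _ : ℝ => a) + fun x => ∫ s in (0 : ℝ)..x, F s) t =
      ∫ t in (0 : ℝ)..S, φ t * F t := by
    refine intervalIntegral.integral_congr_ae ?_
    filter_upwards [hFi.ae_hasDerivAt_integral] with t ht hmem
    have hd : deriv ((fun _ : ℝ => a) + fun x => ∫ s in (0 : ℝ)..x, F s) t = F t :=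
      ((ht (uIoc_subset_uIcc hmem) 0 (by simp)).const_add a).deriv
    rw [hd]
  rw [hcongr, h0, h1] at hibp
  rw [hibp]
  simp

/-- Tested against a fixed vector of `V`, the claim is integration by parts for an absolutely
continuous primitive; the boundary terms vanish by the support of the test function. -/
lemma hasGeneralizedDeriv_of_weak_equation (hα : 1 < α) {S : ℝ} (hS : 0 ≤ S) {u₀ : H} {u : ℝ → H}
    (hu : ContinuousOn u (Icc 0 S)) {w : ℝ → StrongDual ℝ V}
    (hw : MemLp w (ENNReal.ofReal (α / (α - 1))) (volume.restrict (Icc 0 S)))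
    (heq : ∀ t ∈ Icc 0 S, ∀ v : V,
      inner ℝ (u t) (ι v) = inner ℝ u₀ (ι v) + ∫ s in (0 : ℝ)..t, w s v) :
    HasGeneralizedDeriv S (fun t => toDual ι (u t)) w := by
  have hp1 : 1 ≤ ENNReal.ofReal (α / (α - 1)) := by
    rw [ENNReal.one_le_ofReal]; exact (one_lt_conjExponent hα).le
  have hUi : IntegrableOn (fun t => toDual ι (u t)) (Icc 0 S) := by
    refine ContinuousOn.integrableOn_Icc ?_
    exact ((toDualL ι).continuous.comp_continuousOn hu)
  have hwi : IntegrableOn w (Icc 0 S) := hw.integrable hp1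
  refine ⟨hUi.mono_set Ioo_subset_Icc_self, hwi.mono_set Ioo_subset_Icc_self, ?_⟩
  intro φ hφ hφc hsupp
  have hφ0 : φ 0 = 0 := image_eq_zero_of_notMem_tsupport fun h => lt_irrefl _ (hsupp h).1
  have hφS : φ S = 0 := image_eq_zero_of_notMem_tsupport fun h => lt_irrefl _ (hsupp h).2
  have hφ1 : ContDiff ℝ 1 φ := hφ.of_le (by norm_cast)
  have hdc : Continuous (deriv φ) := hφ1.continuous_deriv_one
  have hi1 : IntegrableOn (fun t => deriv φ t • toDual ι (u t)) (Ioo 0 S) :=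
    (hUi.continuousOn_smul hdc.continuousOn isCompact_Icc).mono_set Ioo_subset_Icc_self
  have hi2 : IntegrableOn (fun t => φ t • w t) (Ioo 0 S) :=
    (hwi.continuousOn_smul hφ.continuous.continuousOn isCompact_Icc).mono_set
      Ioo_subset_Icc_self
  ext v
  rw [neg_apply, ContinuousLinearMap.integral_apply hi1, ContinuousLinearMap.integral_apply hi2]
  simp only [smul_apply, smul_eq_mul, toDual_apply]
  rw [← integral_Ioc_eq_integral_Ioo, ← integral_Ioc_eq_integral_Ioo,
    ← intervalIntegral.integral_of_le hS, ← intervalIntegral.integral_of_le hS,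
    ← integral_deriv_mul_primitive hS (a := inner ℝ u₀ (ι v))
      (integrable_apply_const hα hw v) hφ1 hφ0 hφS]
  refine intervalIntegral.integral_congr fun t ht => ?_
  rw [uIcc_of_le hS] at ht
  simp only [heq t ht v]

lemma inner_sub_of_weak_equation (hα : 1 < α) {S : ℝ} (hS : 0 ≤ S) {u₀ : H} {u : ℝ → H}
    {w : ℝ → StrongDual ℝ V}
    (hw : MemLp w (ENNReal.ofReal (α / (α - 1))) (volume.restrict (Icc 0 S)))
    (heq : ∀ t ∈ Icc 0 S, ∀ v : V,
      inner ℝ (u t) (ι v) = inner ℝ u₀ (ι v) + ∫ s in (0 : ℝ)..t, w s v)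
    {s t : ℝ} (hs : s ∈ Icc 0 S) (ht : t ∈ Icc 0 S) (v : V) :
    inner ℝ (u t - u s) (ι v) = ∫ r in s..t, w r v := by
  have hz : (0 : ℝ) ∈ Icc 0 S := by simp [hS]
  have hi : IntegrableOn (fun r => w r v) (Icc 0 S) := integrable_apply_const hα hw v
  rw [inner_sub_left, heq t ht, heq s hs, add_sub_add_left_eq_sub]
  exact intervalIntegral.integral_interval_sub_left
    (IntegrableOn.intervalIntegrable_of_subset hi hz ht)
    (IntegrableOn.intervalIntegrable_of_subset hi hz hs)

lemma continuousOn_primitive_Icc {S : ℝ} (hS : 0 ≤ S) {F : ℝ → ℝ} (hF : IntegrableOn F (Icc 0 S)) :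
    ContinuousOn (fun t => ∫ s in (0 : ℝ)..t, F s) (Icc 0 S) := by
  have := intervalIntegral.continuousOn_primitive_interval (μ := volume) (f := F) (a := 0) (b := S)
    (by rwa [uIcc_of_le hS])
  rwa [uIcc_of_le hS] at this

/-- The equation gives weak continuity, the energy equality gives continuity of the norm, and in a
Hilbert space the two together give strong continuity. -/
lemma continuousOn_of_weak_equation (hι : DenseRange ι) (hα : 1 < α) {S : ℝ} (hS : 0 ≤ S) {u₀ : H}
    {u : ℝ → H} {R : ℝ} (hR : ∀ t ∈ Icc 0 S, ‖u t‖ ≤ R) {w : ℝ → StrongDual ℝ V}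
    (hw : MemLp w (ENNReal.ofReal (α / (α - 1))) (volume.restrict (Icc 0 S)))
    (heq : ∀ t ∈ Icc 0 S, ∀ v : V,
      inner ℝ (u t) (ι v) = inner ℝ u₀ (ι v) + ∫ s in (0 : ℝ)..t, w s v)
    {ū : ℝ → V} (hū : MemLp ū (ENNReal.ofReal α) (volume.restrict (Icc 0 S)))
    (hιu : ∀ᵐ t ∂(volume.restrict (Icc 0 S)), ι (ū t) = u t) :
    ContinuousOn u (Icc 0 S) := by
  have hnorm : ContinuousOn (fun t => ‖u t‖ ^ 2) (Icc 0 S) := by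
    refine ContinuousOn.congr (f := fun t => ‖u 0‖ ^ 2 + 2 * ∫ s in (0 : ℝ)..t, w s (ū s)) ?_
      fun t ht => norm_sq_eq_of_weak_equation hι hα hw hR
        (fun s hs t ht v => inner_sub_of_weak_equation hα hS hw heq hs ht v) hū hιu ht
    exact continuousOn_const.add (continuousOn_const.mul
      (continuousOn_primitive_Icc hS (integrable_apply hα hw hū)))
  have hweak : ∀ v : V, ContinuousOn (fun t => inner ℝ (u t) (ι v)) (Icc 0 S) := fun v =>
    ContinuousOn.congr (continuousOn_const.add
      (continuousOn_primitive_Icc hS (integrable_apply_const hα hw v))) fun t ht => heq t ht v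
  intro t₀ ht₀
  have hin := tendsto_clm_of_dense (l := 𝓝[Icc 0 S] t₀) hι (b := fun t => innerSL ℝ (u t))
    (B := innerSL ℝ (u t₀)) (R := R)
    (by filter_upwards [self_mem_nhdsWithin] with t ht using by
          rw [innerSL_apply_norm]; exact hR t ht)
    (fun v => by simpa using (hweak v t₀ ht₀).tendsto) (u t₀)
  have hlim := ((hnorm t₀ ht₀).tendsto.sub (hin.const_mul 2)).add_const (‖u t₀‖ ^ 2)
  have h0 : Tendsto (fun t => ‖u t - u t₀‖ ^ 2) (𝓝[Icc 0 S] t₀) (𝓝 0) := by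
    convert hlim using 2 with t
    · rw [innerSL_apply_apply, norm_sub_sq_real]
    · rw [innerSL_apply_apply, real_inner_self_eq_norm_sq]; ring
  have h1 := h0.sqrt
  simp only [norm_nonneg, Real.sqrt_sq, Real.sqrt_zero] at h1
  exact tendsto_iff_norm_sub_tendsto_zero.2 h1

theorem isSolution_of_weak_equation (hι : DenseRange ι) (hα : 1 < α) {S : ℝ} (hS : 0 ≤ S) {u₀ : H}
    {u : ℝ → H} {R : ℝ} (hR : ∀ t ∈ Icc 0 S, ‖u t‖ ≤ R)
    {ū : ℝ → V} (hū : MemLp ū (ENNReal.ofReal α) (volume.restrict (Icc 0 S)))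
    (hιu : ∀ᵐ t ∂(volume.restrict (Icc 0 S)), ι (ū t) = u t)
    (hw : MemLp (fun t => A t (ū t)) (ENNReal.ofReal (α / (α - 1))) (volume.restrict (Icc 0 S)))
    (heq : ∀ t ∈ Icc 0 S, ∀ v : V,
      inner ℝ (u t) (ι v) = inner ℝ u₀ (ι v) + ∫ s in (0 : ℝ)..t, A s (ū s) v) :
    IsSolution ι A α u₀ S u := by
  have hu := continuousOn_of_weak_equation hι hα hS hR hw heq hū hιu
  exact ⟨hu, ū, fun t => A t (ū t), hιu, hū, hw,
    hasGeneralizedDeriv_of_weak_equation hα hS hu hw heq, Eventually.of_forall fun _ => rfl, heq⟩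

/-- Gronwall's lemma with an integrable weight. -/
lemma eq_zero_of_le_integral_mul {S : ℝ} {y κ : ℝ → ℝ} (hy : ContinuousOn y (Icc 0 S))
    (hy0 : ∀ t ∈ Icc 0 S, 0 ≤ y t) (hκ : IntegrableOn κ (Icc 0 S))
    (hκ0 : ∀ t ∈ Icc 0 S, 0 ≤ κ t)
    (hle : ∀ t ∈ Icc 0 S, y t ≤ ∫ s in (0 : ℝ)..t, κ s * y s) :
    ∀ t ∈ Icc 0 S, y t = 0 := by
  intro t₁ ht₁
  have hS : 0 ≤ S := ht₁.1.trans ht₁.2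
  have hz : (0 : ℝ) ∈ Icc 0 S := by simp [hS]
  have hκy : IntegrableOn (fun s => κ s * y s) (Icc 0 S) := hκ.mul_continuousOn hy isCompact_Icc
  obtain ⟨d, hd, hdκ⟩ := Metric.uniformContinuousOn_iff.1
    (isCompact_Icc.uniformContinuousOn_of_continuous (continuousOn_primitive_Icc hS hκ))
    (1 / 2) (by norm_num)
  have hstep : ∀ n : ℕ, ∀ t ∈ Icc 0 S, t ≤ n * (d / 2) → y t = 0 := by
    intro n
    induction n with
    | zero =>
      intro t ht htn
      have : t = 0 := le_antisymm (by simpa using htn) ht.1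
      subst this
      exact le_antisymm (by simpa using hle 0 hz) (hy0 0 hz)
    | succ n ih =>
      set a := min S (n * (d / 2)) with ha
      set b := min S ((n + 1 : ℕ) * (d / 2)) with hb
      have hn0 : (0 : ℝ) ≤ n * (d / 2) := by positivity
      have haS : a ∈ Icc 0 S := ⟨le_min hS hn0, min_le_left _ _⟩
      have hab : a ≤ b := min_le_min_left _ (by push_cast; linarith)
      have hbS : b ≤ S := min_le_left _ _
      -- On an interval where `κ` has integral below one half and before which `y` vanishes, the
      -- maximum satisfies `y m ≤ y m / 2`, so it is zero.
      obtain ⟨m, hm, hmax⟩ := isCompact_Icc.exists_isMaxOn (nonempty_Icc.2 hab)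
        (hy.mono (Icc_subset_Icc haS.1 hbS))
      have hmS : m ∈ Icc 0 S := ⟨haS.1.trans hm.1, hm.2.trans hbS⟩
      have hya : ∀ t ∈ Icc 0 a, y t = 0 := fun t ht =>
        ih t ⟨ht.1, ht.2.trans haS.2⟩ (ht.2.trans (min_le_right _ _))
      have h1 : ∫ s in (0 : ℝ)..a, κ s * y s = 0 := by
        rw [intervalIntegral.integral_congr (g := fun _ => 0)]
        · simp
        · intro s hs
          rw [uIcc_of_le haS.1] at hs
          simp [hya s hs]
      have hi := fun {p q} (hp : p ∈ Icc 0 S) (hq : q ∈ Icc 0 S) =>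
        IntegrableOn.intervalIntegrable_of_subset hκ hp hq
      have hiy := fun {p q} (hp : p ∈ Icc 0 S) (hq : q ∈ Icc 0 S) =>
        IntegrableOn.intervalIntegrable_of_subset hκy hp hq
      have h2 := intervalIntegral.integral_add_adjacent_intervals (hiy hz haS) (hiy haS hmS)
      have h3 : ∫ s in a..m, κ s * y s ≤ ∫ s in a..m, κ s * y m := by
        refine intervalIntegral.integral_mono_on hm.1 (hiy haS hmS)
          ((hi haS hmS).mul_const _) fun s hs => ?_
        exact mul_le_mul_of_nonneg_left (hmax ⟨hs.1, hs.2.trans hm.2⟩)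
          (hκ0 s ⟨haS.1.trans hs.1, hs.2.trans hmS.2⟩)
      have hdist : dist m a < d := by
        rw [Real.dist_eq, abs_of_nonneg (by linarith [hm.1])]
        have : b - a ≤ d / 2 := by
          rw [ha, hb]
          push_cast
          rcases le_total S (n * (d / 2)) with h | h
          · rw [min_eq_left h, min_eq_left (by linarith)]; linarith
          · rw [min_eq_right h]
            have := min_le_right S (((n : ℝ) + 1) * (d / 2))
            linarith
        linarith [hm.2]
      have h4 := hdκ m hmS a haS hdist
      rw [Real.dist_eq, intervalIntegral.integral_interval_sub_left (hi hz hmS) (hi hz haS)] at h4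
      have h5 := (le_abs_self _).trans h4.le
      rw [intervalIntegral.integral_mul_const] at h3
      have h6 := hle m hmS
      have h7 := mul_le_mul_of_nonneg_right h5 (hy0 m hmS)
      have hym : y m ≤ 0 := by linarith
      intro t ht htn
      rcases le_total t a with h | h
      · exact hya t ⟨ht.1, h⟩
      · exact le_antisymm ((hmax ⟨h, le_min ht.2 htn⟩).trans hym) (hy0 t ht)
  obtain ⟨n, hn⟩ := exists_nat_ge (t₁ / (d / 2))
  exact hstep n t₁ ht₁ ((div_le_iff₀ (by positivity)).1 hn)

end Solutions

end GelfandEvolution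

namespace GelfandEvolution

open Filter TopologicalSpace

/-! ### Uniqueness under the weight bound -/

section Uniqueness

variable {V H : Type*} [NormedAddCommGroup V] [NormedSpace ℝ V]
  [NormedAddCommGroup H] [InnerProductSpace ℝ H]
  {ι : V →L[ℝ] H} {T α : ℝ} {A : ℝ → V → StrongDual ℝ V} {f g : ℝ → ℝ} {ρ η : V → ℝ}

theorem uniqueSolution_of_weightBound [MeasurableSpace V] (hι : IsGelfandTriple ι) (hα : 1 < α)
    (hf : IntegrableOn f (Icc 0 T)) (hf_nonneg : ∀ t ∈ Icc 0 T, 0 ≤ f t)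
    (hρ : IsWeight ρ) (hη : IsWeight η) (hmono : LocalMonotonicity ι T A f ρ η)
    (hbound : WeightBound ι α ρ η) {S : ℝ} (hS : S ∈ Ioc 0 T) (u₀ : H) :
    UniqueSolution ι A α u₀ S := by
  intro u₁ u₂ hu₁ hu₂
  obtain ⟨C, γ, hC, hγ, hρη⟩ := hbound
  obtain ⟨hc₁, ū₁, w₁, hae₁, hū₁, hw₁, -, hwA₁, heq₁⟩ := hu₁
  obtain ⟨hc₂, ū₂, w₂, hae₂, hū₂, hw₂, -, hwA₂, heq₂⟩ := hu₂
  have hα0 : 0 < α := by linarith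
  have hS0 : 0 ≤ S := hS.1.le
  have hz : (0 : ℝ) ∈ Icc 0 S := by simp [hS0]
  have hsubT : Icc 0 S ⊆ Icc 0 T := Icc_subset_Icc_right hS.2
  replace hw₁ := hw₁.ae_eq hwA₁
  replace hw₂ := hw₂.ae_eq hwA₂
  obtain ⟨R₁, hR₁⟩ := isCompact_Icc.exists_bound_of_continuousOn hc₁
  obtain ⟨R₂, hR₂⟩ := isCompact_Icc.exists_bound_of_continuousOn hc₂
  have hR₁0 : 0 ≤ R₁ := (norm_nonneg _).trans (hR₁ 0 hz)
  have hR₂0 : 0 ≤ R₂ := (norm_nonneg _).trans (hR₂ 0 hz)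
  have hw := hw₁.sub hw₂
  have hū := hū₁.sub hū₂
  have heq : ∀ t ∈ Icc 0 S, ∀ v : V, inner ℝ (u₁ t - u₂ t) (ι v) =
      inner ℝ (0 : H) (ι v) + ∫ s in (0 : ℝ)..t,
        ((fun t => A t (ū₁ t)) - fun t => A t (ū₂ t)) s v := fun t ht v => by
    have h₁ := integrable_apply_const hα hw₁ v
    have h₂ := integrable_apply_const hα hw₂ v
    simp only [Pi.sub_apply, sub_apply]
    rw [intervalIntegral.integral_sub (IntegrableOn.intervalIntegrable_of_subset h₁ hz ht)
      (IntegrableOn.intervalIntegrable_of_subset h₂ hz ht), inner_sub_left, heq₁ t ht, heq₂ t ht,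
      inner_zero_left]
    ring
  have hzero : u₁ 0 - u₂ 0 = 0 := by
    refine ext_inner_right ℝ fun h => ?_
    have := hι.denseRange.equalizer (g := fun h => inner ℝ (u₁ 0 - u₂ 0) h)
      (h := fun h => inner ℝ (0 : H) h) (by fun_prop) (by fun_prop)
      (funext fun v => by simpa using heq 0 hz v)
    exact congrFun this h
  -- Both solutions are bounded in `H` by continuity, so the weight bound makes the monotonicity
  -- factor integrable in time. The `2` comes from the energy equality for the difference.
  set κ : ℝ → ℝ := fun t => 2 * (f t + C * (1 + ‖ū₁ t‖ ^ α) * (1 + R₁ ^ γ)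
    + C * (1 + ‖ū₂ t‖ ^ α) * (1 + R₂ ^ γ)) with hκ
  have hκi : IntegrableOn κ (Icc 0 S) := by
    have h₁ := ((memLp_ofReal_iff hα0).1 hū₁).2
    have h₂ := ((memLp_ofReal_iff hα0).1 hū₂).2
    have hone : Integrable (fun _ : ℝ => (1 : ℝ)) (volume.restrict (Icc 0 S)) :=
      integrable_const 1
    exact (((hf.mono_set hsubT).add (((hone.add h₁).const_mul C).mul_const _)).add
      (((hone.add h₂).const_mul C).mul_const _)).const_mul 2
  have hyc : ContinuousOn (fun t => ‖u₁ t - u₂ t‖ ^ 2) (Icc 0 S) := (hc₁.sub hc₂).norm.pow 2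
  have hgron := eq_zero_of_le_integral_mul (y := fun t => ‖u₁ t - u₂ t‖ ^ 2) (κ := κ) hyc
    (fun t _ => by positivity) hκi
    (fun t ht => by
      have := hf_nonneg t (hsubT ht)
      have : 0 ≤ R₁ ^ γ := by positivity
      have : 0 ≤ R₂ ^ γ := by positivity
      simp only [hκ]
      positivity)
    (fun t ht => by
      have hn := norm_sq_eq_of_weak_equation hι.denseRange hα hw (u := fun t => u₁ t - u₂ t)
        (R := R₁ + R₂) (fun t ht => (norm_sub_le _ _).trans (add_le_add (hR₁ t ht) (hR₂ t ht)))
        (fun s hs t ht v => inner_sub_of_weak_equation (u := fun t => u₁ t - u₂ t)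
          hα hS0 hw heq hs ht v) hū
        (by filter_upwards [hae₁, hae₂] with t h₁ h₂ using by simp [h₁, h₂]) ht
      rw [hzero, norm_zero] at hn
      rw [hn, ← intervalIntegral.integral_const_mul]
      have hi₁ := IntegrableOn.intervalIntegrable_of_subset
        ((integrable_apply hα hw hū).const_mul 2) hz ht
      have hi₂ := IntegrableOn.intervalIntegrable_of_subset
        (hκi.mul_continuousOn hyc isCompact_Icc) hz ht
      have hle := intervalIntegral.integral_mono_ae_restrict ht.1 hi₁ hi₂ (by
        have hres : ∀ᵐ s ∂(volume.restrict (Icc 0 S)), ι (ū₁ s) = u₁ s ∧ ι (ū₂ s) = u₂ s :=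
          hae₁.and hae₂
        have hres' := ae_restrict_of_ae_restrict_of_subset (Icc_subset_Icc_right ht.2) hres
        filter_upwards [hres', ae_restrict_mem measurableSet_Icc] with s hs hst
        have hsS : s ∈ Icc 0 S := ⟨hst.1, hst.2.trans ht.2⟩
        have hm := hmono s (hsubT hsS) (ū₁ s) (ū₂ s)
        rw [map_sub ι, hs.1, hs.2] at hm
        have hw1 : ρ (ū₁ s) ≤ C * (1 + ‖ū₁ s‖ ^ α) * (1 + R₁ ^ γ) := by
          have h := hρη (ū₁ s)
          rw [hs.1] at h
          have h' : ‖u₁ s‖ ^ γ ≤ R₁ ^ γ :=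
            Real.rpow_le_rpow (norm_nonneg _) (hR₁ s hsS) hγ
          have h'' : C * (1 + ‖ū₁ s‖ ^ α) * (1 + ‖u₁ s‖ ^ γ) ≤
              C * (1 + ‖ū₁ s‖ ^ α) * (1 + R₁ ^ γ) := by gcongr
          linarith [hη.nonneg (ū₁ s)]
        have hw2 : η (ū₂ s) ≤ C * (1 + ‖ū₂ s‖ ^ α) * (1 + R₂ ^ γ) := by
          have h := hρη (ū₂ s)
          rw [hs.2] at h
          have h' : ‖u₂ s‖ ^ γ ≤ R₂ ^ γ :=
            Real.rpow_le_rpow (norm_nonneg _) (hR₂ s hsS) hγ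
          have h'' : C * (1 + ‖ū₂ s‖ ^ α) * (1 + ‖u₂ s‖ ^ γ) ≤
              C * (1 + ‖ū₂ s‖ ^ α) * (1 + R₂ ^ γ) := by gcongr
          linarith [hρ.nonneg (ū₂ s)]
        have hmul := mul_le_mul_of_nonneg_right (add_le_add (add_le_add_right hw1 (f s)) hw2)
          (sq_nonneg ‖u₁ s - u₂ s‖)
        simp only [Pi.sub_apply, hκ]
        linarith)
      simpa using hle)
  intro t ht
  have := hgron t ht
  exact sub_eq_zero.1 (norm_eq_zero.1 (pow_eq_zero_iff two_ne_zero |>.1 this))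

end Uniqueness

/-! ### The lifetime condition -/

section Lifetime

variable {H : Type*} [NormedAddCommGroup H] {T : ℝ} {f g : ℝ → ℝ}

lemma exists_bihariTime (hT : 0 < T) (hf : IntegrableOn f (Icc 0 T))
    (hf_nonneg : ∀ t ∈ Icc 0 T, 0 ≤ f t) (hg : IsCoercivityFunction g) (u₀ : H) :
    ∃ S ∈ Ioc 0 T, BihariTime f g u₀ S := by
  set K := ‖u₀‖ ^ 2 + ∫ t in (0 : ℝ)..T, f t with hK
  have hK0 : 0 ≤ K := by
    have := intervalIntegral.integral_nonneg (μ := volume) hT.le hf_nonneg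
    positivity
  -- On `(K, K + 1]` the reciprocal of `g` is at least `1 / G`, so every time below `1 / G` is
  -- admissible. The added `1` keeps `G` positive if `g` vanishes there.
  set G := g (K + 1) + 1 with hG
  have hG0 : 0 < G := by linarith [hg.nonneg (K + 1) (by linarith)]
  refine ⟨min T (G⁻¹ / 2), ⟨lt_min hT (by positivity), min_le_left _ _⟩, ?_⟩
  have hle : ‖u₀‖ ^ 2 + ∫ t in (0 : ℝ)..min T (G⁻¹ / 2), f t ≤ K := by
    have := intervalIntegral.integral_mono_interval (f := f) (μ := volume) le_rfl
      (le_min hT.le (by positivity : 0 ≤ G⁻¹ / 2)) (min_le_left T (G⁻¹ / 2))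
      ((ae_restrict_mem measurableSet_Ioc).mono fun t ht =>
        hf_nonneg t (Ioc_subset_Icc_self ht))
      (IntegrableOn.intervalIntegrable_of_subset hf (by simp [hT.le]) (by simp [hT.le]))
    linarith
  unfold BihariTime
  calc ENNReal.ofReal (min T (G⁻¹ / 2)) < (ENNReal.ofReal G)⁻¹ := by
        rw [← ENNReal.ofReal_inv_of_pos hG0, ENNReal.ofReal_lt_ofReal_iff (by positivity)]
        exact (min_le_right _ _).trans_lt (half_lt_self (by positivity))
    _ = ∫⁻ _ in Ioc K (K + 1), (ENNReal.ofReal G)⁻¹ := by simp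
    _ ≤ ∫⁻ x in Ioc K (K + 1), (ENNReal.ofReal (g x))⁻¹ := by
        refine setLIntegral_mono_ae' measurableSet_Ioc (Eventually.of_forall fun x hx => ?_)
        refine ENNReal.inv_le_inv.2 (ENNReal.ofReal_le_ofReal ?_)
        have h := hg.monotoneOn (hK0.trans hx.1.le : x ∈ Ici 0)
          (by linarith : (0 : ℝ) ≤ K + 1) hx.2
        linarith
    _ ≤ _ := lintegral_mono_set fun x hx => hle.trans_lt hx.1

lemma bihariTime_of_linear (hT : 0 ≤ T) (hf_nonneg : ∀ t ∈ Icc 0 T, 0 ≤ f t)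
    (hg : IsCoercivityFunction g) {c : ℝ} (hc : ∀ x, 0 ≤ x → g x = c * x) (u₀ : H) :
    BihariTime f g u₀ T := by
  set K := ‖u₀‖ ^ 2 + ∫ t in (0 : ℝ)..T, f t with hK
  have hK0 : 0 ≤ K := by
    have := intervalIntegral.integral_nonneg (μ := volume) hT hf_nonneg
    positivity
  have hc0 : 0 ≤ c := by
    have := hg.nonneg 1 zero_le_one
    rwa [hc 1 zero_le_one, mul_one] at this
  -- The logarithmic divergence makes the lifetime infinite. Using `c + 1` instead of `c` includes
  -- `c = 0`.
  have htop : ∫⁻ x in Ioi K, ENNReal.ofReal (((c + 1) * x)⁻¹) = ⊤ := by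
    by_contra hne
    have hint : IntegrableOn (fun x : ℝ => ((c + 1) * x)⁻¹) (Ioi K) := by
      refine (lintegral_ofReal_ne_top_iff_integrable
        (by fun_prop : Measurable fun x : ℝ => ((c + 1) * x)⁻¹).aestronglyMeasurable
        ((ae_restrict_mem measurableSet_Ioi).mono fun x hx => ?_)).1 hne
      have : 0 < x := hK0.trans_lt hx
      simp only [Pi.zero_apply]
      positivity
    refine not_integrableOn_Ioi_inv (a := K) ((hint.const_mul (c + 1)).congr ?_)
    refine Eventually.of_forall fun x => ?_
    have : c + 1 ≠ 0 := by positivity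
    simp only [mul_inv]
    field_simp
  have hle : ∫⁻ x in Ioi K, ENNReal.ofReal (((c + 1) * x)⁻¹) ≤
      ∫⁻ x in Ioi K, (ENNReal.ofReal (g x))⁻¹ := by
    refine setLIntegral_mono_ae' measurableSet_Ioi (Eventually.of_forall fun x hx => ?_)
    have hx0 : 0 < x := hK0.trans_lt hx
    rw [ENNReal.ofReal_inv_of_pos (by positivity), hc x hx0.le]
    exact ENNReal.inv_le_inv.2 (ENNReal.ofReal_le_ofReal (by nlinarith))
  unfold BihariTime
  rw [htop, top_le_iff] at hle
  rw [hle]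
  exact ENNReal.ofReal_lt_top

end Lifetime

end GelfandEvolution

/-! ### The main theorem -/

theorem theoremT1
    {V H : Type*} [NormedAddCommGroup V] [NormedSpace ℝ V] [CompleteSpace V]
    [MeasurableSpace V] [BorelSpace V]
    [NormedAddCommGroup H] [InnerProductSpace ℝ H] [CompleteSpace H]
    [TopologicalSpace.SeparableSpace H]
    (ι : V →L[ℝ] H) (hι : GelfandEvolution.IsGelfandTriple ι) (hcompact : IsCompactOperator ι)
    (T : ℝ) (hT : 0 < T) (A : ℝ → V → StrongDual ℝ V)
    (hA : GelfandEvolution.RestrictedlyMeasurable T A)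
    (α β δ C : ℝ) (hα : 1 < α) (hβ : 0 ≤ β) (hδ : 0 < δ)
    (f : ℝ → ℝ) (hf : IntegrableOn f (Icc 0 T) volume) (hf_nonneg : ∀ t ∈ Icc 0 T, 0 ≤ f t)
    (ρ η : V → ℝ) (hρ : GelfandEvolution.IsWeight ρ) (hη : GelfandEvolution.IsWeight η)
    (g : ℝ → ℝ) (hg : GelfandEvolution.IsCoercivityFunction g)
    (hemicontinuity : GelfandEvolution.Hemicontinuity T A)
    (local_monotonicity : GelfandEvolution.LocalMonotonicity ι T A f ρ η)
    (coercivity : GelfandEvolution.GeneralizedCoercivity ι T A α δ f g)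
    (growth : GelfandEvolution.Growth ι T A α β C f) :
    -- local existence, and uniqueness under the additional bound
    (∀ u₀ : H,
      (∃ T₀ ∈ Ioc 0 T, GelfandEvolution.BihariTime f g u₀ T₀) ∧
      ∀ T₀ ∈ Ioc 0 T, GelfandEvolution.BihariTime f g u₀ T₀ →
        (∃ u : ℝ → H, GelfandEvolution.IsSolution ι A α u₀ T₀ u) ∧
        (GelfandEvolution.WeightBound ι α ρ η →
          GelfandEvolution.UniqueSolution ι A α u₀ T₀)) ∧
    -- global existence and uniqueness for linear `g`
    ((∃ c : ℝ, ∀ x, 0 ≤ x → g x = c * x) →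
      ∀ u₀ : H,
        (∃ u : ℝ → H, GelfandEvolution.IsSolution ι A α u₀ T u) ∧
        (GelfandEvolution.WeightBound ι α ρ η →
          GelfandEvolution.UniqueSolution ι A α u₀ T)) := by
  have hlocal : ∀ u₀ : H, ∀ T₀ ∈ Ioc 0 T, GelfandEvolution.BihariTime f g u₀ T₀ →
      (∃ u : ℝ → H, GelfandEvolution.IsSolution ι A α u₀ T₀ u) ∧
      (GelfandEvolution.WeightBound ι α ρ η →
        GelfandEvolution.UniqueSolution ι A α u₀ T₀) := by
    intro u₀ T₀ hT₀ hBihari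
    refine ⟨?_, fun hbound => GelfandEvolution.uniqueSolution_of_weightBound hι hα hf hf_nonneg
      hρ hη local_monotonicity hbound hT₀ u₀⟩
    obtain ⟨u, ū, R, -, hR, hū, hιu, hw, heq⟩ := GelfandEvolution.exists_weak_solution hι hcompact
      hA hα hβ hδ hf hf_nonneg hρ hη hg hemicontinuity local_monotonicity coercivity growth hT₀ u₀
      hBihari
    exact ⟨u, GelfandEvolution.isSolution_of_weak_equation hι.denseRange hα hT₀.1.le hR hū hιu
      hw heq⟩
  refine ⟨fun u₀ => ⟨GelfandEvolution.exists_bihariTime hT hf hf_nonneg hg u₀, hlocal u₀⟩, ?_⟩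
  rintro ⟨c, hc⟩ u₀
  exact hlocal u₀ T ⟨hT, le_rfl⟩
    (GelfandEvolution.bihariTime_of_linear hT.le hf_nonneg hg hc u₀)
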